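/- Consider propositional temporal logic over the flow of time $(\mathbb{Z},<)$. A model $\mathfrak M$ says, for each $n\in\mathbb{Z}$, which propositional variables $p_0,p_1,\dots$ are true at $n$. Temporal literals are given by $\lambda ::= \bot \mid p_i \mid \Box\lambda \mid \Box_F\lambda \mid \Box_P\lambda$, where $\mathfrak M,n\models\Box\lambda$ iff $\mathfrak M,k\models\lambda$ for all $k\in\mathbb Z$, $\mathfrak M,n\models\Box_F\lambda$ iff $\mathfrak M,k\models\lambda$ for all $k>n$, and $\mathfrak M,n\models\Box_P\lambda$ iff $\mathfrak M,k\models\lambda$ for all $k<n$. A $\mathcal{PTL}_{\mathit{horn}}(\Box,\Box_F/\Box_P)$-formula $\varphi$ is a finite conjunction of formulas of the form $\psi$ or $\Box\psi$, where $\psi$ is a Horn clause $\lambda_1\wedge\dots\wedge\lambda_n\to\lambda$ with $n\ge 0$. It is satisfiable if $\mathfrak M,0\models\varphi$ for some model $\mathfrak M$. Let $|\varphi|$ be the length of $\varphi$ as a word over a finite alphabet (indices of variables written in binary), let $b(\varphi)$ be the number of occurrences of $\Box,\Box_F,\Box_P$ in the temporal literals of $\varphi$, and call a model $\mathfrak M$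 with $\mathfrak M,0\models\varphi$ a short model of $\varphi$ if, for $N=b(\varphi)+1$, its state at every $n\ge N$ is its state at $N$ and its state at every $n\le -N$ is its state at $-N$. 1. The satisfiability problem for $\mathcal{PTL}_{\mathit{horn}}(\Box,\Box_F/\Box_P)$-formulas is in PTime: the set of words representing satisfiable formulas is decided by a deterministic Turing machine in polynomial time. 2. Every satisfiable $\mathcal{PTL}_{\mathit{horn}}(\Box,\Box_F/\Box_P)$-formula $\varphi$ has a short model, that is, a model with a prefix of length linear in $|\varphi|$ (with $N\le|\varphi|+1$), continued in both directions by loops of length $1$. 3. Let $W=2b(\varphi)+1$, and let $H_\varphi$ be the following set of propositional Horn clauses over variables $\lambda^m$, for the subformulas $\lambda$ of temporal literals of $\varphi$ and $-W\le m\le W$: - $\lambda_1^0\wedge\dots\wedge\lambda_n^0\to\lambda^0$ for each conjunct $\lambda_1\wedge\dots\wedge\lambda_n\to\lambda$ of $\varphi$, and $\lambda_1^m\wedge\dots\wedge\lambda_n^m\to\lambda^m$, $-W\le m\le W$, for each conjunct $\Box(\lambda_1\wedge\dots\wedge\lambda_n\to\lambda)$ of $\varphi$; - $\bot^m\to\bot$,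 for $-W\le m\le W$, if $\bot$ is a subformula; - for each $\Box_F\lambda$: $(\Box_F\lambda)^m\to(\Box_F\lambda)^{m+1}$, $(\Box_F\lambda)^m\to\lambda^{m+1}$ and $(\Box_F\lambda)^{m+1}\wedge\lambda^{m+1}\to(\Box_F\lambda)^m$, for $-W\le m<W$, as well as $(\Box_F\lambda)^W\to\lambda^W$, $\lambda^W\to(\Box_F\lambda)^W$ and $(\Box_F\lambda)^{-W}\to\lambda^{-W}$; symmetrically for each $\Box_P\lambda$; - for each $\Box\lambda$: $(\Box\lambda)^m\to(\Box\lambda)^{m+1}$ and $(\Box\lambda)^{m+1}\to(\Box\lambda)^m$, for $-W\le m<W$, $(\Box\lambda)^m\to\lambda^m$, for $-W\le m\le W$, and $\bigwedge_{-W\le m\le W}\lambda^m\to(\Box\lambda)^0$. Then $\varphi$ has a short model iff $H_\varphi$ is satisfiable. More precisely, for every assignment satisfying $H_\varphi$, the model in which $p_i$ is true at $n$ iff $p_i^{\max(-W,\min(W,n))}$ is true under the assignment satisfies $\varphi$ at $0$; and every short model of $\varphi$ arises in this way from an assignment satisfying $H_\varphi$. The number of literal occurrences in $H_\varphi$ is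 bounded by a polynomial in $|\varphi|$. -/

import Mathlib

namespace HornPTL

/-! ### Syntax -/

/-- The temporal operators: `always` is "at all moments of time", `future` is "always in the
(strict) future" and `past` is "always in the (strict) past". -/
inductive BoxOp
  | always
  | future
  | past

/-- Temporal literals `λ ::= ⊥ | p | ★ λ`, where `★` is one of the three box operators.
Propositional variables are indexed by natural numbers. -/
inductive Lit
  | bot
  | var (p : ℕ)
  | box (o : BoxOp) (l : Lit)

/-- A Horn clause `λ₁ ∧ ⋯ ∧ λₙ → λ`; the body may be empty. -/
structure Clause where
  body : List Lit
  head : Lit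

/-- A conjunct of a formula: a clause `ψ` or a globally valid clause "always `ψ`". -/
inductive Conjunct
  | init (c : Clause)
  | glob (c : Clause)

/-- A formula is a finite conjunction of conjuncts; the empty conjunction is `⊤`. -/
abbrev Formula := List Conjunct

/-! ### Semantics over `(ℤ, <)` -/

/-- A temporal model: `M n p` says that the variable `p` is true at the moment `n`. -/
abbrev Model := ℤ → ℕ → Prop

def Lit.HoldsAt (M : Model) : ℤ → Lit → Prop
  | _, .bot => False
  | n, .var p => M n p
  | _, .box .always l => ∀ k : ℤ, l.HoldsAt M k
  | n, .box .future l => ∀ k : ℤ, n < k → l.HoldsAt M k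
  | n, .box .past l => ∀ k : ℤ, k < n → l.HoldsAt M k

def Clause.HoldsAt (M : Model) (n : ℤ) (c : Clause) : Prop :=
  (∀ l ∈ c.body, l.HoldsAt M n) → c.head.HoldsAt M n

def Conjunct.HoldsAt (M : Model) (n : ℤ) : Conjunct → Prop
  | .init c => c.HoldsAt M n
  | .glob c => ∀ k : ℤ, c.HoldsAt M k

def Formula.HoldsAt (M : Model) (n : ℤ) (φ : Formula) : Prop :=
  ∀ d ∈ φ, d.HoldsAt M n

def Formula.Satisfiable (φ : Formula) : Prop :=
  ∃ M : Model, φ.HoldsAt M 0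

/-! ### Formulas as words over a finite alphabet -/

inductive Symb
  | bot
  | var
  | bit (b : Bool)
  | endVar
  | box (o : BoxOp)
  | imp
  | init
  | glob

def Lit.encode : Lit → List Symb
  | .bot => [.bot]
  -- the index of a variable is written in binary
  | .var p => .var :: ((Computability.encodeNat p).map .bit ++ [.endVar])
  | .box o l => .box o :: l.encode

def Clause.encode (c : Clause) : List Symb :=
  c.body.flatMap Lit.encode ++ .imp :: c.head.encode

def Conjunct.encode : Conjunct → List Symb
  | .init c => .init :: c.encode
  | .glob c => .glob :: c.encode

def Formula.encode (φ : Formula) : List Symb :=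
  φ.flatMap Conjunct.encode

/-- The length of a formula, as a word. -/
def Formula.size (φ : Formula) : ℕ := φ.encode.length

/-- The satisfiability problem: the set of all words that represent satisfiable formulas. -/
def satisfiabilityProblem : Language Symb :=
  {w | ∃ φ : Formula, φ.encode = w ∧ φ.Satisfiable}

/-! ### Polynomial time -/

open Classical in
/-- A language is in PTime if its characteristic function, on all words over its alphabet, is
computed by a deterministic (multi-stack) Turing machine in a number of steps bounded by a
polynomial in the length of the word. All stack alphabets are required to be finite. -/
def InPTime {Γ : Type} (L : Language Γ) : Prop :=
  ∃ c : Turing.TM2ComputableInPolyTime (id : List Γ → List Γ) Computability.encodeBool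
      (fun w : List Γ => decide (w ∈ L)),
    ∀ k, Finite (c.tm.Γ k)

/-! ### Short models -/

/-- The number of occurrences of box operators in a literal. -/
def Lit.numBoxes : Lit → ℕ
  | .bot => 0
  | .var _ => 0
  | .box _ l => l.numBoxes + 1

def Clause.numBoxes (c : Clause) : ℕ :=
  (c.body.map Lit.numBoxes).sum + c.head.numBoxes

/-- The "always" in front of a global clause is not counted. -/
def Conjunct.numBoxes : Conjunct → ℕ
  | .init c => c.numBoxes
  | .glob c => c.numBoxes

def Formula.numBoxes (φ : Formula) : ℕ := (φ.map Conjunct.numBoxes).sum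

/-- Outside the interval from `-N` to `N`, the model repeats its state at `N` (in the future) and
its state at `-N` (in the past): it ends in loops of length 1 in both directions. -/
def Model.ConstantBeyond (M : Model) (N : ℕ) : Prop :=
  (∀ n : ℤ, (N : ℤ) ≤ n → M n = M N) ∧ (∀ n : ℤ, n ≤ -(N : ℤ) → M n = M (-(N : ℤ)))

/-- The bound on the prefixes of short models. -/
def Formula.prefixLength (φ : Formula) : ℕ := φ.numBoxes + 1

/-- `M` is a short model of `φ`. -/
def Formula.ShortModel (φ : Formula) (M : Model) : Prop :=
  M.ConstantBeyond φ.prefixLength ∧ φ.HoldsAt M 0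

/-! ### Propositional Horn formulas -/

/-- A propositional Horn clause over the variables `V`; the head `none` stands for `⊥`. -/
structure PropClause (V : Type) where
  body : List V
  head : Option V

def PropClause.SatisfiedBy {V : Type} (v : V → Prop) (c : PropClause V) : Prop :=
  (∀ x ∈ c.body, v x) → ∃ y, c.head = some y ∧ v y

/-- A Horn-SAT instance, i.e. a conjunction of propositional Horn clauses. -/
abbrev HornSAT (V : Type) := List (PropClause V)

def HornSAT.SatisfiedBy {V : Type} (v : V → Prop) (H : HornSAT V) : Prop :=
  ∀ c ∈ H, c.SatisfiedBy v

def HornSAT.Satisfiable {V : Type} (H : HornSAT V) : Prop :=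
  ∃ v : V → Prop, H.SatisfiedBy v

/-- The size of an instance: every clause contributes the number of its literals, where a head `⊥`
is counted as well. -/
def HornSAT.size {V : Type} (H : HornSAT V) : ℕ :=
  (H.map fun c => c.body.length + 1).sum

/-! ### The Horn-SAT instance of a formula -/

/-- The propositional variable `(l, m)` stands for "`l` is true at the moment `m`". -/
abbrev PVar := Lit × ℤ

/-- The moments `-N, …, N`. -/
def window (N : ℕ) : List ℤ := (List.range (2 * N + 1)).map fun i => (i : ℤ) - N

/-- The moments `-N, …, N - 1`. -/
def steps (N : ℕ) : List ℤ := (List.range (2 * N)).map fun i => (i : ℤ) - N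

/-- Clauses describing the semantics of `★ l` at the moments `-N, …, N` in a model in which `l` and
`★ l` do not change beyond `-N` and `N`. -/
def boxClauses (N : ℕ) (l : Lit) : BoxOp → HornSAT PVar
  | .future =>
      ((steps N).flatMap fun m =>
        [⟨[(.box .future l, m)], some (.box .future l, m + 1)⟩,
         ⟨[(.box .future l, m)], some (l, m + 1)⟩,
         ⟨[(.box .future l, m + 1), (l, m + 1)], some (.box .future l, m)⟩]) ++
      [⟨[(.box .future l, (N : ℤ))], some (l, (N : ℤ))⟩,
       ⟨[(l, (N : ℤ))], some (.box .future l, (N : ℤ))⟩,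
       ⟨[(.box .future l, -(N : ℤ))], some (l, -(N : ℤ))⟩]
  | .past =>
      ((steps N).flatMap fun m =>
        [⟨[(.box .past l, m + 1)], some (.box .past l, m)⟩,
         ⟨[(.box .past l, m + 1)], some (l, m)⟩,
         ⟨[(.box .past l, m), (l, m)], some (.box .past l, m + 1)⟩]) ++
      [⟨[(.box .past l, -(N : ℤ))], some (l, -(N : ℤ))⟩,
       ⟨[(l, -(N : ℤ))], some (.box .past l, -(N : ℤ))⟩,
       ⟨[(.box .past l, (N : ℤ))], some (l, (N : ℤ))⟩]
  | .always =>
      ((steps N).flatMap fun m =>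
        [⟨[(.box .always l, m)], some (.box .always l, m + 1)⟩,
         ⟨[(.box .always l, m + 1)], some (.box .always l, m)⟩]) ++
      ((window N).map fun m => ⟨[(.box .always l, m)], some (l, m)⟩) ++
      [⟨(window N).map fun m => (l, m), some (.box .always l, 0)⟩]

/-- Clauses describing the semantics of all subformulas of a literal. -/
def Lit.semClauses (N : ℕ) : Lit → HornSAT PVar
  | .bot => (window N).map fun m => ⟨[(.bot, m)], none⟩
  | .var _ => []
  | .box o l => boxClauses N l o ++ l.semClauses N

/-- The propositional clause `λ₁ᵐ ∧ ⋯ ∧ λₙᵐ → λᵐ`. -/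
def Clause.at (c : Clause) (m : ℤ) : PropClause PVar :=
  ⟨c.body.map fun l => (l, m), some (c.head, m)⟩

def Clause.semClauses (N : ℕ) (c : Clause) : HornSAT PVar :=
  c.body.flatMap (Lit.semClauses N) ++ c.head.semClauses N

def Conjunct.hornClauses (N : ℕ) : Conjunct → HornSAT PVar
  | .init c => c.at 0 :: c.semClauses N
  | .glob c => (window N).map c.at ++ c.semClauses N

/-- The moments represented in the Horn-SAT instance of `φ` are those from `-N` to `N` for this `N`.
In a short model of `φ` the variables are constant beyond `φ.numBoxes + 1`, and nested boxes
may take up to `φ.numBoxes` further moments to stabilize. -/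
def Formula.windowSize (φ : Formula) : ℕ := 2 * φ.numBoxes + 1

def Formula.hornInstance (φ : Formula) : HornSAT PVar :=
  φ.flatMap (Conjunct.hornClauses φ.windowSize)

/-- The model given by an assignment: read off the values of `(p, m)` for `-N ≤ m ≤ N` and repeat
the two extreme states forever. -/
def modelOf (N : ℕ) (v : PVar → Prop) : Model :=
  fun n p => v (.var p, max (-(N : ℤ)) (min (N : ℤ) n))

end HornPTL

/-! Short models. Horn clauses survive pointwise intersection of states. Given a model of φ at 0,
keep the moment 0 and one witness for every occurrence of a box: for □λ some moment where λ fails,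
for □_F λ the last such moment and for □_P λ the first one, whenever they exist. The kept moments
are placed at consecutive positions in their order, with the moment 0 at position 0. Every position
to their right represents a whole final segment of time, and every position to their left a whole
initial segment. A variable is true at a position iff it is true at all moments represented there.
By induction, every literal of φ is true at a position iff it is true in the old model at all
represented moments. For □_F λ (`future_represented`): if λ has a last failure, it was kept; if its
failures are unbounded, λ fails in the final segment. Bodies and heads of clauses thus pass back and
forth, and there are at most b(φ) witnesses, so the new model is constant beyond b(φ) + 1.

Horn-SAT. If variables are constant beyond K, a literal with d boxes is constant beyond K + d
(`Lit.stableBeyond`), so a window up to (b(φ) + 1) + b(φ) = W sees all changes, and the clauses at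
its ends describe the constant tails exactly. Truth of literals in a short model therefore satisfies
the instance (`Lit.satisfiedBy_holdsAt`). Conversely the clauses determine each box from its
argument, so any satisfying assignment agrees with truth in the model read off from it
(`Lit.holdsAt_modelOf`).

PTime. The instance is never written down. One fixed Datalog program runs on the input word; its
facts about literals are indexed by a position of the word and a moment, and an occurrence of a
literal is named by the position where it starts. The rules parse the word, evaluate clauses, copy
truth between equal literals and imitate the clauses for boxes. A word is accepted iff it parses and
falsity is not derivable. A closed set of facts without falsity gives a satisfying assignment, hence
a model; conversely the facts true in a short model form a closed set without falsity.

Datalog itself is polynomial (`inPTime_of_datalog`): there are polynomially many facts, each round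
that is not stable adds one, and a round is a nest of counter loops over the rule variables with
random access to a tape. Additional loops over dummy variables supply enough rounds. These
structured programs compile to multi-stack machines (`Runs.reachesIn`). -/

/-! ### Structured programs for a machine with a tape and counters -/

namespace StackProg

open Turing

variable {Γ C Q : Type}

/-- The names of the stacks: input, output, the two halves of a tape, and counters. -/
inductive Stk (Q : Type)
  | inp
  | out
  | left
  | right
  | cnt (q : Q)

noncomputable instance : DecidableEq (Stk Q) := Classical.decEq _

instance [Finite Q] : Finite (Stk Q) :=
  Finite.of_injective
    (fun k : Stk Q => match k with
      | .inp => (Sum.inl 0 : Fin 4 ⊕ Q)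
      | .out => .inl 1
      | .left => .inl 2
      | .right => .inl 3
      | .cnt q => .inr q)
    (by intro a b; cases a <;> cases b <;> simp)

/-- The alphabets of the stacks. -/
def Stk.Alph (Γ C : Type) : Stk Q → Type
  | .inp => Γ
  | .out => Bool
  | .left => C
  | .right => C
  | .cnt _ => Unit

/-- The data manipulated by structured programs. -/
@[ext]
structure Store (Γ C Q : Type) where
  acc : Bool
  inp : List Γ
  out : List Bool
  left : List C
  right : List C
  cnt : Q → ℕ

/-- Counters are kept in unary, which is affordable since all values are polynomial in the length of
the input. -/
def Store.stacks (a : Store Γ C Q) : ∀ k : Stk Q, List (k.Alph Γ C)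
  | .inp => a.inp
  | .out => a.out
  | .left => a.left
  | .right => a.right
  | .cnt q => List.replicate (a.cnt q) ()

theorem Store.update_left (a : Store Γ C Q) (l : List C) :
    Function.update a.stacks .left l = { a with left := l }.stacks := by
  funext k
  cases k with
  | left => exact Function.update_self ..
  | _ => exact Function.update_of_ne (by simp) ..

theorem Store.update_right (a : Store Γ C Q) (l : List C) :
    Function.update a.stacks .right l = { a with right := l }.stacks := by
  funext k
  cases k with
  | right => exact Function.update_self ..
  | _ => exact Function.update_of_ne (by simp) ..

theorem Store.update_inp (a : Store Γ C Q) (l : List Γ) :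
    Function.update a.stacks .inp l = { a with inp := l }.stacks := by
  funext k
  cases k with
  | inp => exact Function.update_self ..
  | _ => exact Function.update_of_ne (by simp) ..

theorem Store.update_out (a : Store Γ C Q) (l : List Bool) :
    Function.update a.stacks .out l = { a with out := l }.stacks := by
  funext k
  cases k with
  | out => exact Function.update_self ..
  | _ => exact Function.update_of_ne (by simp) ..

/-- Basic operations. -/
inductive Op (Γ C Q : Type)
  | inc (q : Q)
  | dec (q : Q)
  | moveRight
  | moveLeft
  | modify (f : Bool → C → Bool × C)
  | setAcc (f : Bool → Bool)
  | test (q : Q) (f : Bool → Bool → Bool)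
  | read (f : Γ → C)
  | place (c : C)
  | emit
  | erase

/-- Programs built from basic operations by composition and by loops that run while a stack is
nonempty. -/
inductive Prog (Γ C Q : Type)
  | op (o : Op Γ C Q)
  | seq (P P' : Prog Γ C Q)
  | loop (k : Stk Q) (P : Prog Γ C Q)

/-- The labels of a program. -/
def Prog.Lbl : Prog Γ C Q → Type
  | .op _ => Unit
  | .seq P P' => P.Lbl ⊕ P'.Lbl
  | .loop _ P => Option P.Lbl

theorem Prog.finiteLbl : (P : Prog Γ C Q) → Finite P.Lbl
  | .op _ => inferInstanceAs (Finite Unit)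
  | .seq P P' => by
      have := P.finiteLbl
      have := P'.finiteLbl
      exact inferInstanceAs (Finite (P.Lbl ⊕ P'.Lbl))
  | .loop _ P => by
      have := P.finiteLbl
      exact inferInstanceAs (Finite (Option P.Lbl))

variable [DecidableEq Q]

/-- The tape is `left` reversed followed by `right`, with the head on the first symbol of `right`.
An exhausted half reads as `blank`, so the tape is unbounded. -/
def Op.run (blank : C) : Op Γ C Q → Store Γ C Q → Store Γ C Q
  | .inc q, a => { a with cnt := Function.update a.cnt q (a.cnt q + 1) }
  | .dec q, a => { a with cnt := Function.update a.cnt q (a.cnt q - 1) }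
  | .moveRight, a => { a with left := a.right.head?.getD blank :: a.left, right := a.right.tail }
  | .moveLeft, a => { a with left := a.left.tail, right := a.left.head?.getD blank :: a.right }
  | .modify f, a =>
      { a with
        acc := (f a.acc (a.right.head?.getD blank)).1
        right := (f a.acc (a.right.head?.getD blank)).2 :: a.right.tail }
  | .setAcc f, a => { a with acc := f a.acc }
  | .test q f, a => { a with acc := f a.acc (a.cnt q == 0) }
  | .read f, a => { a with inp := a.inp.tail, left := (a.inp.head?.elim blank f) :: a.left }
  | .place c, a => { a with left := c :: a.left }
  | .emit, a => { a with out := a.acc :: a.out }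
  | .erase, a => { a with right := a.right.tail }

/-- `Runs blank P a b t` says that `P` turns `a` into `b` in at most `t` steps. -/
inductive Runs (blank : C) : Prog Γ C Q → Store Γ C Q → Store Γ C Q → ℕ → Prop
  | op (o a) : Runs blank (.op o) a (o.run blank a) 1
  | seq {P P' a b c t u} : Runs blank P a b t → Runs blank P' b c u →
      Runs blank (.seq P P') a c (t + u)
  | loop_done {k P a} : a.stacks k = [] → Runs blank (.loop k P) a a 1
  | loop_step {k P a b c t u} : a.stacks k ≠ [] → Runs blank P a b t →
      Runs blank (.loop k P) b c u → Runs blank (.loop k P) a c (1 + t + u)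
  | mono {P a b t u} : Runs blank P a b t → t ≤ u → Runs blank P a b u

/-! #### Compilation to stack machines -/

/-- Finite memory of the compiled machine: the accumulator, a register for a tape symbol and a
flag. -/
abbrev Mem (C : Type) := Bool × C × Bool

/-- `q'` is the continuation. A symbol popped from one stack travels in the register `s.2.1` to the
push that follows. -/
def Op.stmt (blank : C) {Λ : Type} (q' : TM2.Stmt (Stk.Alph (Q := Q) Γ C) Λ (Mem C)) :
    Op Γ C Q → TM2.Stmt (Stk.Alph (Q := Q) Γ C) Λ (Mem C)
  | .inc q => .push (.cnt q) (fun _ => ()) q'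
  | .dec q => .pop (.cnt q) (fun s _ => s) q'
  | .moveRight => .pop .right (fun s o => (s.1, Option.getD o blank, s.2.2))
      (.push .left (fun s => s.2.1) q')
  | .moveLeft => .pop .left (fun s o => (s.1, Option.getD o blank, s.2.2))
      (.push .right (fun s => s.2.1) q')
  | .modify f => .pop .right
      (fun s o => ((f s.1 (Option.getD o blank)).1, (f s.1 (Option.getD o blank)).2, s.2.2))
      (.push .right (fun s => s.2.1) q')
  | .setAcc f => .load (fun s => (f s.1, s.2)) q'
  | .test q f => .peek (.cnt q) (fun s o => (f s.1 (Option.isNone o), s.2)) q'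
  | .read f => .pop .inp (fun s o => (s.1, Option.elim o blank f, s.2.2))
      (.push .left (fun s => s.2.1) q')
  | .place c => .push .left (fun _ => c) q'
  | .emit => .push .out (fun s => s.1) q'
  | .erase => .pop .right (fun s _ => s) q'

theorem Store.update_cnt (a : Store Γ C Q) (q : Q) (n : ℕ) :
    Function.update a.stacks (.cnt q) (List.replicate n ()) =
      { a with cnt := Function.update a.cnt q n }.stacks := by
  funext k
  cases k with
  | cnt q' =>
    by_cases h : q' = q
    · subst h
      refine (Function.update_self ..).trans ?_
      simp only [Store.stacks, Function.update_self]
    · refine (Function.update_of_ne (by simpa using h) ..).trans ?_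
      simp only [Store.stacks, Function.update_of_ne h]
  | _ => exact Function.update_of_ne (by simp) ..

/-- The register and the flag are scratch memory that each operation or loop test refills before
using it, so their final content may stay unspecified. -/
theorem Op.stepAux_stmt (blank : C) {Λ : Type}
    (q' : TM2.Stmt (Stk.Alph (Q := Q) Γ C) Λ (Mem C)) (o : Op Γ C Q) (a : Store Γ C Q)
    (r : C × Bool) :
    ∃ r', TM2.stepAux (o.stmt blank q') (a.acc, r) a.stacks =
      TM2.stepAux q' ((o.run blank a).acc, r') (o.run blank a).stacks := by
  cases o with
  | inc q => exact ⟨r, congrArg (TM2.stepAux q' _) (a.update_cnt q (a.cnt q + 1))⟩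
  | dec q =>
    refine ⟨r, congrArg (TM2.stepAux q' _) (Eq.trans ?_ (a.update_cnt q (a.cnt q - 1)))⟩
    congr 1
    exact List.tail_replicate
  | moveRight =>
    refine ⟨(a.right.head?.getD blank, r.2), congrArg (TM2.stepAux q' _) ?_⟩
    change Function.update (Function.update a.stacks .right a.right.tail) .left
      (_ :: Function.update a.stacks .right a.right.tail .left) = _
    rw [a.update_right]
    exact Store.update_left _ _
  | moveLeft =>
    refine ⟨(a.left.head?.getD blank, r.2), congrArg (TM2.stepAux q' _) ?_⟩
    change Function.update (Function.update a.stacks .left a.left.tail) .right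
      (_ :: Function.update a.stacks .left a.left.tail .right) = _
    rw [a.update_left]
    exact Store.update_right _ _
  | modify f =>
    refine ⟨((f a.acc (a.right.head?.getD blank)).2, r.2), congrArg (TM2.stepAux q' _) ?_⟩
    change Function.update (Function.update a.stacks .right a.right.tail) .right
      (_ :: Function.update a.stacks .right a.right.tail .right) = _
    rw [a.update_right]
    exact Store.update_right _ _
  | setAcc f => exact ⟨r, rfl⟩
  | test q f =>
    refine ⟨r, congrArg (fun b => TM2.stepAux q' (f a.acc b, r) a.stacks) ?_⟩
    change Option.isNone (List.head? (List.replicate (a.cnt q) ())) = _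
    cases a.cnt q <;> rfl
  | read f =>
    refine ⟨(a.inp.head?.elim blank f, r.2), congrArg (TM2.stepAux q' _) ?_⟩
    change Function.update (Function.update a.stacks .inp a.inp.tail) .left
      (_ :: Function.update a.stacks .inp a.inp.tail .left) = _
    rw [a.update_inp]
    exact Store.update_left _ _
  | place c => exact ⟨r, congrArg (TM2.stepAux q' _) (a.update_left _)⟩
  | emit => exact ⟨r, congrArg (TM2.stepAux q' _) (a.update_out _)⟩
  | erase => exact ⟨r, congrArg (TM2.stepAux q' _) (a.update_right _)⟩

def Prog.entry : (P : Prog Γ C Q) → P.Lbl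
  | .op _ => ()
  | .seq P _ => Sum.inl P.entry
  | .loop _ _ => none

/-- The code of a program whose labels are embedded by `e` and which continues at `next`. -/
def Prog.code (blank : C) {Λ : Type} : (P : Prog Γ C Q) → (P.Lbl → Λ) → Λ → P.Lbl →
    TM2.Stmt (Stk.Alph (Q := Q) Γ C) Λ (Mem C)
  | .op o, _, next, _ => o.stmt blank (.goto fun _ => next)
  | .seq P P', e, next, l => Sum.casesOn (motive := fun _ => TM2.Stmt _ Λ (Mem C)) l
      (fun l => P.code blank (fun l => e (Sum.inl l)) (e (Sum.inr P'.entry)) l)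
      (fun l => P'.code blank (fun l => e (Sum.inr l)) next l)
  | .loop k P, e, next, l => Option.casesOn (motive := fun _ => TM2.Stmt _ Λ (Mem C)) l
      (.peek k (fun s o => (s.1, s.2.1, Option.isSome o))
        (.branch (fun s => s.2.2) (.goto fun _ => e (some P.entry)) (.goto fun _ => next)))
      (fun l => P.code blank (fun l => e (some l)) (e none) l)

/-- `c` reaches `c'` in at most `t` steps. -/
def ReachesIn {X : Type} (f : X → Option X) (c c' : X) (t : ℕ) : Prop :=
  ∃ u ≤ t, (flip bind f)^[u] (some c) = some c'

theorem ReachesIn.trans {X : Type} {f : X → Option X} {a b c : X} {t u : ℕ}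
    (h : ReachesIn f a b t) (h' : ReachesIn f b c u) : ReachesIn f a c (t + u) := by
  obtain ⟨t', ht, h⟩ := h
  obtain ⟨u', hu, h'⟩ := h'
  exact ⟨u' + t', by omega, by rw [Function.iterate_add_apply, h, h']⟩

theorem ReachesIn.single {X : Type} {f : X → Option X} {a b : X} (h : f a = some b) :
    ReachesIn f a b 1 := ⟨1, le_rfl, h⟩

/-- Induction on the run. Allowing any machine that carries the code of `P` at embedded labels, and
any continuation `next`, lets subprograms share one machine: the first half of a composition
continues at the second half, a loop body at the loop head. -/
theorem Runs.reachesIn {blank : C} {P : Prog Γ C Q} {a b : Store Γ C Q} {t : ℕ}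
    (h : Runs blank P a b t) {Λ : Type} (M : Λ → TM2.Stmt (Stk.Alph (Q := Q) Γ C) Λ (Mem C))
    (e : P.Lbl → Λ) (next : Λ) (hM : ∀ l, M (e l) = P.code blank e next l) (r : C × Bool) :
    ∃ r', ReachesIn (TM2.step M) ⟨some (e P.entry), (a.acc, r), a.stacks⟩
      ⟨some next, (b.acc, r'), b.stacks⟩ t := by
  induction h generalizing next r with
  | op o a =>
    obtain ⟨r', hr'⟩ := o.stepAux_stmt blank (.goto fun _ => next) a r
    refine ⟨r', ReachesIn.single ?_⟩
    simp only [TM2.step, hM, Prog.code]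
    rw [hr']
    rfl
  | @seq P P' a b c t u _ _ ih₁ ih₂ =>
    obtain ⟨r₁, h₁⟩ := ih₁ (fun l => e (Sum.inl l)) (e (Sum.inr P'.entry))
      (fun l => hM (Sum.inl l)) r
    obtain ⟨r₂, h₂⟩ := ih₂ (fun l => e (Sum.inr l)) next (fun l => hM (Sum.inr l)) r₁
    exact ⟨r₂, h₁.trans h₂⟩
  | @loop_done k P a hk =>
    refine ⟨(r.1, false), ReachesIn.single ?_⟩
    have := hM none
    simp only [Prog.entry, TM2.step]
    rw [this]
    simp [Prog.code, hk]
  | @loop_step k P a b c t u hk _ _ ih₁ ih₂ =>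
    obtain ⟨r₁, h₁⟩ := ih₁ (fun l => e (some l)) (e none) (fun l => hM (some l)) (r.1, true)
    obtain ⟨r₂, h₂⟩ := ih₂ e next hM r₁
    refine ⟨r₂, (ReachesIn.trans (ReachesIn.single ?_) h₁).trans h₂⟩
    have := hM none
    simp only [Prog.entry, TM2.step]
    rw [this]
    obtain ⟨x, xs, hx⟩ := List.exists_cons_of_ne_nil hk
    simp [Prog.code, hx]
  | mono _ hle ih =>
    obtain ⟨r', u, hu, h⟩ := ih e next hM r
    exact ⟨r', u, hu.trans hle, h⟩

/-- The machine executing a structured program. -/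
noncomputable def machine [Finite Γ] [Finite C] [Finite Q] (blank : C) (P : Prog Γ C Q) :
    FinTM2 :=
  letI := Fintype.ofFinite C
  letI := Fintype.ofFinite (Stk Q)
  letI := P.finiteLbl
  letI := Fintype.ofFinite (Option P.Lbl)
  letI : Fintype ((Stk.inp : Stk Q).Alph Γ C) := Fintype.ofFinite Γ
  { K := Stk Q
    k₀ := .inp
    k₁ := .out
    Γ := Stk.Alph Γ C
    Λ := Option P.Lbl
    main := some P.entry
    σ := Mem C
    initialState := (false, blank, false)
    -- The extra label resets the memory, since a halting configuration is required to have the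
    -- initial state.
    m := fun l => l.elim (.load (fun _ => (false, blank, false)) .halt)
      (P.code blank some none) }

/-- All stacks but the output must end empty because halting configurations have that form. The
polynomial grows by 1 for the halting step. -/
theorem inPTime_of_runs [Finite Γ] [Finite C] [Finite Q] (blank : C) (P : Prog Γ C Q)
    (L : Language Γ) (p : Polynomial ℕ)
    (h : ∀ w : List Γ, ∃ b acc, (b = true ↔ w ∈ L) ∧
      Runs blank P ⟨false, w, [], [], [], fun _ => 0⟩ ⟨acc, [], [b], [], [], fun _ => 0⟩
        (p.eval w.length)) :
    HornPTL.InPTime L := by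
  classical
  have key : ∀ w : List Γ, Nonempty (TM2OutputsInTime (machine blank P)
      (w.map (Equiv.refl Γ).invFun)
      (some ((Computability.encodeBool (decide (w ∈ L))).map (Equiv.refl Bool).invFun))
      ((p + 1).eval w.length)) := by
    intro w
    obtain ⟨b, acc, hb, hr⟩ := h w
    obtain ⟨r', hr⟩ := hr.reachesIn (machine blank P).m some none (fun l => rfl) (blank, false)
    have hfin : ReachesIn (TM2.step (machine blank P).m) ⟨some none, (acc, r'),
        (⟨acc, [], [b], [], [], fun _ => 0⟩ : Store Γ C Q).stacks⟩
        (⟨none, (false, blank, false),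
        (⟨acc, [], [b], [], [], fun _ => 0⟩ : Store Γ C Q).stacks⟩) 1 :=
      ReachesIn.single rfl
    obtain ⟨t, ht, he⟩ := hr.trans hfin
    have hbd : decide (w ∈ L) = b := by
      cases b <;> simpa using hb
    refine ⟨⟨⟨t, ?_⟩, ?_⟩⟩
    · refine Eq.trans ?_ (he.trans ?_)
      · congr 2
        unfold initList
        congr 1
        funext k
        cases k with
        | inp => exact (dif_pos rfl).trans (List.map_id w)
        | _ => exact dif_neg (fun h : _ = Stk.inp => by cases h)
      · simp only [Option.map_some]
        congr 1
        unfold haltList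
        congr 1
        funext k
        rw [hbd]
        symm
        cases k with
        | out => exact dif_pos rfl
        | _ => exact dif_neg (fun h : _ = Stk.out => by cases h)
    · simpa using ht
  refine ⟨⟨⟨machine blank P, Equiv.refl Γ, Equiv.refl Bool⟩, p + 1, fun w => ?_⟩, ?_⟩
  · exact Classical.choice (key w)
  · intro k
    change Finite (Stk.Alph (Q := Q) Γ C k)
    cases k <;> simp only [Stk.Alph] <;> infer_instance

end StackProg

/-! ### Random access and bounded loops -/

namespace StackProg

theorem Store.stacks_cnt_ne {Γ C Q : Type} {a : Store Γ C Q} {q : Q} (h : a.cnt q ≠ 0) :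
    a.stacks (.cnt q) ≠ [] := by
  change List.replicate (a.cnt q) () ≠ []
  simpa using h

/-! ### Counter loops and access to the tape -/

section Transfer

variable {Γ C Q : Type} [DecidableEq Q] {blank : C}

/-- A store with empty input and output. -/
def st (κ : Q → ℕ) (acc : Bool) (T : List C × List C) : Store Γ C Q :=
  ⟨acc, [], [], T.1, T.2, κ⟩

/-- Run `P` once for every unit of the counter `c`, moving the units of `c` to `d` one by one;
restore both counters at the end. -/
def transfer (c d : Q) (P : Prog Γ C Q) : Prog Γ C Q :=
  .seq (.loop (.cnt c) (.seq (.op (.dec c)) (.seq P (.op (.inc d)))))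
    (.loop (.cnt d) (.seq (.op (.dec d)) (.op (.inc c))))

/-- The counters `κ` with the values of `c` and `d` replaced. -/
def setTwo (κ : Q → ℕ) (c d : Q) (x y : ℕ) : Q → ℕ :=
  Function.update (Function.update κ c x) d y

theorem runs_restore {c d : Q} (hcd : c ≠ d) (κ : Q → ℕ) (acc : Bool) (T : List C × List C)
    (i j : ℕ) :
    Runs (Γ := Γ) blank (.loop (.cnt d) (.seq (.op (.dec d)) (.op (.inc c))))
      (st (setTwo κ c d j i) acc T) (st (setTwo κ c d (j + i) 0) acc T) (i * 3 + 1) := by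
  induction i generalizing j with
  | zero => exact (Runs.loop_done (by simp [Store.stacks, st, setTwo])).mono (by simp)
  | succ i ih =>
    refine Runs.mono (Runs.loop_step (b := st (setTwo κ c d (j + 1) i) acc T) (t := 2)
      (u := i * 3 + 1) ?_ ?_ ?_) (by omega)
    · exact Store.stacks_cnt_ne (by simp [st, setTwo])
    · convert Runs.seq (Runs.op (Op.dec d) _) (Runs.op (Op.inc c) _) using 1
      simp only [st, Op.run, Store.mk.injEq, true_and]
      funext q
      simp only [setTwo, Function.update_apply]
      split_ifs <;> simp_all
    · have := ih (j + 1)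
      rwa [show j + (i + 1) = j + 1 + i by omega]

/-- Before pass `i` the counter `c` holds `κ c - i` and `d` holds `i`. As `P` runs after the
decrement of `c` and before the increment of `d`, it sees `κ c - 1 - i` and `i`: the second counter
is the loop index. A pass costs `t + 3` steps, and restoring one unit costs 3 more. -/
theorem runs_transfer {c d : Q} (hcd : c ≠ d) {P : Prog Γ C Q} {κ : Q → ℕ} (hd : κ d = 0)
    (acc : ℕ → Bool) (T : ℕ → List C × List C) (t : ℕ)
    (h : ∀ i < κ c, Runs blank P (st (setTwo κ c d (κ c - 1 - i) i) (acc i) (T i))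
      (st (setTwo κ c d (κ c - 1 - i) i) (acc (i + 1)) (T (i + 1))) t) :
    Runs blank (transfer c d P) (st κ (acc 0) (T 0)) (st κ (acc (κ c)) (T (κ c)))
      (κ c * (t + 6) + 2) := by
  have h₁ : ∀ j i, i + j = κ c →
      Runs blank (.loop (.cnt c) (.seq (.op (.dec c)) (.seq P (.op (.inc d)))))
        (st (setTwo κ c d j i) (acc i) (T i))
        (st (setTwo κ c d 0 (κ c)) (acc (κ c)) (T (κ c))) (j * (t + 3) + 1) := by
    intro j
    induction j with
    | zero =>
      intro i hi
      obtain rfl : i = κ c := by omega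
      exact (Runs.loop_done (by simp [Store.stacks, st, setTwo, hcd])).mono (by simp)
    | succ j ih =>
      intro i hi
      refine Runs.mono (Runs.loop_step (b := st (setTwo κ c d j (i + 1)) (acc (i + 1)) (T (i + 1)))
        (t := 1 + (t + 1)) (u := j * (t + 3) + 1) ?_ ?_ (ih (i + 1) (by omega))) ?_
      · exact Store.stacks_cnt_ne (by simp [st, setTwo, hcd])
      · have hP := h i (by omega)
        rw [show κ c - 1 - i = j by omega] at hP
        refine Runs.seq (b := st (setTwo κ c d j i) (acc i) (T i)) ?_ (Runs.seq hP ?_)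
        · convert Runs.op (Op.dec c) _ using 1
          simp only [st, Op.run, Store.mk.injEq, true_and]
          funext q
          simp only [setTwo, Function.update_apply]
          split_ifs <;> simp_all
        · convert Runs.op (Op.inc d) _ using 1
          simp only [st, Op.run, Store.mk.injEq, true_and]
          funext q
          simp only [setTwo, Function.update_apply]
          split_ifs <;> simp_all
      · have : (j + 1) * (t + 3) = j * (t + 3) + (t + 3) := by ring
        omega
  have h₀ : setTwo κ c d (κ c) 0 = κ := by
    funext q
    simp only [setTwo, Function.update_apply]
    split_ifs <;> simp_all
  have h₂ := h₁ (κ c) 0 (by omega)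
  have h₃ := runs_restore (Γ := Γ) (blank := blank) hcd κ (acc (κ c)) (T (κ c)) (κ c) 0
  rw [Nat.zero_add] at h₃
  rw [h₀] at h₂ h₃
  refine (Runs.seq h₂ h₃).mono ?_
  have : κ c * (t + 6) = κ c * (t + 3) + κ c * 3 := by ring
  omega

/-- Move the head of the tape to the right. -/
def moveR (blank : C) (T : List C × List C) : List C × List C :=
  (T.2.head?.getD blank :: T.1, T.2.tail)

theorem runs_advance {c d : Q} (hcd : c ≠ d) {P : Prog Γ C Q} {κ : Q → ℕ} (hd : κ d = 0)
    (acc : Bool) (T : List C × List C) (k t : ℕ)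
    (h : ∀ i < κ c, ∀ T, Runs blank P (st (setTwo κ c d (κ c - 1 - i) i) acc T)
      (st (setTwo κ c d (κ c - 1 - i) i) acc ((moveR blank)^[k] T)) t) :
    Runs blank (transfer c d P) (st κ acc T) (st κ acc ((moveR blank)^[κ c * k] T))
      (κ c * (t + 6) + 2) := by
  have := runs_transfer (blank := blank) (P := P) hcd hd (fun _ => acc)
    (fun i => (moveR blank)^[i * k] T) t (fun i hi => by
      have := h i hi ((moveR blank)^[i * k] T)
      rwa [← Function.iterate_add_apply, show k + i * k = (i + 1) * k by ring] at this)
  simpa using this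

/-- Apply `f` to the `k`-th symbol of a tape, extending the tape if necessary. -/
def modifyAt (blank : C) (f : C → C) : ℕ → List C → List C
  | 0, R => f (R.head?.getD blank) :: R.tail
  | k + 1, R => R.head?.getD blank :: modifyAt blank f k R.tail

theorem getD_modifyAt (f : C → C) (k : ℕ) (R : List C) (i : ℕ) :
    (modifyAt blank f k R).getD i blank =
      if i = k then f (R.getD k blank) else R.getD i blank := by
  induction k generalizing R i with
  | zero => cases i <;> cases R <;> simp [modifyAt]
  | succ k ih =>
    simp only [List.getD_eq_getElem?_getD] at ih
    cases i <;> cases R <;> simp [modifyAt, ih]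

/-- The left side is what rewinding leaves after walking `k` cells and applying `f` there; hence
walk, modify and rewind amount to `modifyAt`. -/
theorem rewind_moveR (f : C → C) (k : ℕ) (T : List C × List C) :
    ((moveR blank)^[k] T).1.reverse ++ (f (((moveR blank)^[k] T).2.head?.getD blank) ::
      ((moveR blank)^[k] T).2.tail) = T.1.reverse ++ modifyAt blank f k T.2 := by
  induction k generalizing T with
  | zero => rfl
  | succ k ih =>
    rw [Function.iterate_succ_apply, ih]
    simp [moveR, modifyAt]

theorem head_moveR (k : ℕ) (T : List C × List C) :
    ((moveR blank)^[k] T).2.head?.getD blank = T.2.getD k blank := by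
  induction k generalizing T with
  | zero => cases h : T.2 <;> simp [h]
  | succ k ih =>
    rw [Function.iterate_succ_apply, ih]
    cases h : T.2 <;> simp [moveR, h]

theorem length_moveR (k : ℕ) (T : List C × List C) :
    ((moveR blank)^[k] T).1.length = T.1.length + k := by
  induction k generalizing T with
  | zero => rfl
  | succ k ih =>
    rw [Function.iterate_succ_apply, ih]
    simp [moveR]
    omega

/-- Move the head to the left end of the tape. -/
def rewind : Prog Γ C Q := .loop .left (.op .moveLeft)

theorem runs_rewind (κ : Q → ℕ) (acc : Bool) (L R : List C) :
    Runs (Γ := Γ) blank rewind (st κ acc (L, R)) (st κ acc ([], L.reverse ++ R))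
      (L.length * 2 + 1) := by
  induction L generalizing R with
  | nil => exact (Runs.loop_done rfl).mono (by simp)
  | cons c L ih =>
    refine Runs.mono (Runs.loop_step (b := st κ acc (L, c :: R)) (t := 1)
      (u := L.length * 2 + 1) (List.cons_ne_nil c L) (Runs.op .moveLeft _) ?_)
      (by simp; omega)
    simpa [rewind] using ih (c :: R)

end Transfer

/-! ### Loop variables, addresses and nested loops -/

/-- The counters of a machine with loop variables `V`: the value of a variable, the number of
remaining values, the number of all values, and two auxiliary counters. -/
inductive Ctr (V : Type)
  | pos (v : V)
  | rem (v : V)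
  | len
  | tmp
  | tmpLen

noncomputable instance {V : Type} : DecidableEq (Ctr V) := Classical.decEq _

instance {V : Type} [Finite V] : Finite (Ctr V) :=
  Finite.of_injective
    (fun k : Ctr V => match k with
      | .len => (Sum.inl 0 : Fin 3 ⊕ V ⊕ V)
      | .tmp => .inl 1
      | .tmpLen => .inl 2
      | .pos v => .inr (.inl v)
      | .rem v => .inr (.inr v))
    (by intro a b; cases a <;> cases b <;> simp)

/-- Summands of an address; the value of `row` is the number of values of a variable. -/
inductive Atom (V : Type)
  | one
  | row
  | var (v : V)
  | mul (v : V)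

def Atom.val {V : Type} (N : ℕ) (e : V → ℕ) : Atom V → ℕ
  | .one => 1
  | .row => N
  | .var v => e v
  | .mul v => e v * N

/-- An address. -/
abbrev Path (V : Type) := List (Atom V)

def Path.val {V : Type} (N : ℕ) (e : V → ℕ) (p : Path V) : ℕ := (p.map (Atom.val N e)).sum

section Loops

variable {Γ C V W : Type} {blank : C}

/-- The counters when the variables `v` with `env v = some i` have the value `i < N` and the other
variables are not in use. -/
def ctr (N : ℕ) (env : V → Option ℕ) : Ctr V → ℕ
  | .pos v => (env v).getD 0
  -- One less than the values not yet finished: `transfer` removes the unit of the current pass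
  -- before it runs the body.
  | .rem v => (env v).elim N fun i => N - 1 - i
  | .len => N
  | .tmp => 0
  | .tmpLen => 0

/-- Addresses mention only the variables in `V`; those in `W` merely repeat loops. -/
def Atom.move : Atom V → Prog Γ C (Ctr (V ⊕ W))
  | .one => .op .moveRight
  | .row => transfer .len .tmpLen (.op .moveRight)
  | .var v => transfer (.pos (.inl v)) .tmp (.op .moveRight)
  | .mul v => transfer (.pos (.inl v)) .tmp (transfer .len .tmpLen (.op .moveRight))

def Path.move : Path V → Prog Γ C (Ctr (V ⊕ W))
  | [] => .op (.setAcc id)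
  | a :: p => .seq a.move (Path.move p)

/-- The values of the variables in `V`. -/
def inlVal (env : V ⊕ W → Option ℕ) (v : V) : ℕ := (env (.inl v)).getD 0

def InRange (N : ℕ) (env : V → Option ℕ) : Prop := ∀ v, ∀ i ∈ env v, i < N

theorem InRange.inlVal_le {N : ℕ} {env : V ⊕ W → Option ℕ} (h : InRange N env) (v : V) :
    inlVal env v ≤ N := by
  unfold inlVal
  cases hv : env (.inl v) with
  | none => simp
  | some i => exact (h _ i hv).le

theorem runs_row {κ : Ctr V → ℕ} (h : κ .tmpLen = 0) (acc : Bool) (T : List C × List C) :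
    Runs (Γ := Γ) blank (transfer .len .tmpLen (.op .moveRight)) (st κ acc T)
      (st κ acc ((moveR blank)^[κ .len] T)) (κ .len * 7 + 2) := by
  have := runs_advance (Γ := Γ) (blank := blank) (P := .op .moveRight) (c := Ctr.len)
    (d := .tmpLen) (by simp) h acc T 1 1 (fun i _ T => Runs.op _ _)
  simpa using this

theorem Atom.runs_move (a : Atom V) {N : ℕ} {env : V ⊕ W → Option ℕ} (h : InRange N env)
    (acc : Bool) (T : List C × List C) :
    Runs (Γ := Γ) blank a.move (st (ctr N env) acc T)
      (st (ctr N env) acc ((moveR blank)^[a.val N (inlVal env)] T))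
      (N * (N * 7 + 8) + 2 + 1) := by
  have hN : N * (N * 7 + 8) = N * (N * 7) + N * 8 := by ring
  cases a with
  | one => exact (Runs.op _ _).mono (by omega)
  | row => exact (runs_row rfl acc T).mono (by simp only [ctr]; omega)
  | var v =>
    have h1 := runs_advance (Γ := Γ) (blank := blank) (P := .op .moveRight)
      (κ := ctr N env) (c := .pos (.inl v)) (d := .tmp) (by simp) rfl acc T 1 1
      (fun i _ T => Runs.op _ _)
    rw [Nat.mul_one] at h1
    refine h1.mono ?_
    have := h.inlVal_le v
    change inlVal env v * 7 + 2 ≤ _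
    omega
  | mul v =>
    have h1 := runs_advance (Γ := Γ) (blank := blank)
      (P := transfer .len .tmpLen (.op .moveRight))
      (κ := ctr N env) (c := .pos (.inl v)) (d := .tmp) (by simp) rfl acc T N (N * 7 + 2)
      (fun i _ T => by
        have h2 := runs_row (Γ := Γ) (blank := blank) (κ := setTwo (ctr N env) (.pos (.inl v)) .tmp
          (ctr N env (.pos (.inl v)) - 1 - i) i) (by simp [setTwo, ctr]) acc T
        rwa [show setTwo (ctr N env) (.pos (.inl v)) .tmp
          (ctr N env (.pos (.inl v)) - 1 - i) i .len = N by simp [setTwo, ctr]] at h2)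
    refine h1.mono ?_
    have := Nat.mul_le_mul_right (N * 7 + 8) (h.inlVal_le v)
    change inlVal env v * (N * 7 + 8) + 2 ≤ _
    omega

theorem Path.runs_move (p : Path V) {N : ℕ} {env : V ⊕ W → Option ℕ} (h : InRange N env)
    (acc : Bool) (T : List C × List C) :
    Runs (Γ := Γ) blank p.move (st (ctr N env) acc T)
      (st (ctr N env) acc ((moveR blank)^[p.val N (inlVal env)] T))
      (p.length * (N * (N * 7 + 8) + 3) + 1) := by
  induction p generalizing T with
  | nil => exact (Runs.op _ _).mono (by simp)
  | cons a p ih =>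
    have h' := (a.runs_move (Γ := Γ) (blank := blank) h acc T).seq (ih _)
    rw [← Function.iterate_add_apply, Nat.add_comm (Path.val _ _ _)] at h'
    refine h'.mono ?_
    simp only [List.length_cons]
    rw [Nat.add_mul]
    omega

theorem Atom.val_le (a : Atom V) {N : ℕ} {e : V → ℕ} (h : ∀ v, e v ≤ N) (hN : 1 ≤ N) :
    a.val N e ≤ N * N := by
  cases a with
  | one => exact Nat.mul_pos hN hN
  | row => exact Nat.le_mul_of_pos_left N hN
  | var v => exact (h v).trans (Nat.le_mul_of_pos_left N hN)
  | mul v => exact Nat.mul_le_mul_right N (h v)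

theorem Path.val_le (p : Path V) {N : ℕ} {e : V → ℕ} (h : ∀ v, e v ≤ N) (hN : 1 ≤ N) :
    p.val N e ≤ p.length * (N * N) := by
  induction p with
  | nil => simp [Path.val]
  | cons a p ih =>
    simp only [Path.val, List.map_cons, List.sum_cons, List.length_cons] at ih ⊢
    have := a.val_le h hN
    rw [Nat.add_mul]
    omega

/-! #### Programs that preserve the counters -/

/-- A store with the head at the left end of the tape. -/
def clean (N : ℕ) (env : V → Option ℕ) (s : Bool × List C) : Store Γ C (Ctr V) :=
  st (ctr N env) s.1 ([], s.2)

/-- `P` computes `F` in polynomial time when the variables in `U` are not in use. -/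
def Computes (blank : C) (P : Prog Γ C (Ctr V)) (U : List V)
    (F : ℕ → (V → Option ℕ) → Bool × List C → Bool × List C) : Prop :=
  ∃ p : Polynomial ℕ, ∀ N env s, 1 ≤ N → InRange N env → (∀ v ∈ U, env v = none) →
    Runs blank P (clean N env s) (clean N env (F N env s)) (p.eval N)

theorem Computes.seq {P P' : Prog Γ C (Ctr V)} {U : List V}
    {F F' : ℕ → (V → Option ℕ) → Bool × List C → Bool × List C}
    (h : Computes blank P U F) (h' : Computes blank P' U F') :
    Computes blank (.seq P P') U (fun N env s => F' N env (F N env s)) := by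
  obtain ⟨p, hp⟩ := h
  obtain ⟨p', hp'⟩ := h'
  refine ⟨p + p', fun N env s hN hr hU => ?_⟩
  rw [Polynomial.eval_add]
  exact (hp N env s hN hr hU).seq (hp' N env _ hN hr hU)

theorem computes_setAcc (f : Bool → Bool) (U : List V) :
    Computes (Γ := Γ) blank (.op (.setAcc f)) U (fun _ _ s => (f s.1, s.2)) :=
  ⟨1, fun N env s _ _ _ => by rw [Polynomial.eval_one]; exact Runs.op _ _⟩

theorem computes_test (q : Ctr V) (f : Bool → Bool → Bool) (U : List V) :
    Computes (Γ := Γ) blank (.op (.test q f)) U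
      (fun N env s => (f s.1 (ctr N env q == 0), s.2)) :=
  ⟨1, fun N env s _ _ _ => by rw [Polynomial.eval_one]; exact Runs.op _ _⟩

/-- Update the accumulator and the tape symbol at the given address. -/
def access (p : Path V) (f : Bool → C → Bool × C) : Prog Γ C (Ctr (V ⊕ W)) :=
  .seq p.move (.seq (.op (.modify f)) rewind)

theorem computes_access (p : Path V) (f : Bool → C → Bool × C) (U : List (V ⊕ W)) :
    Computes (Γ := Γ) blank (access p f) U (fun N env s =>
      ((f s.1 (s.2.getD (p.val N (inlVal env)) blank)).1,
        modifyAt blank (fun c => (f s.1 c).2) (p.val N (inlVal env)) s.2)) := by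
  refine ⟨.C p.length * (.X * (.X * .C 7 + .C 8) + .C 3) + .C 1 +
    (.C 1 + (.C p.length * (.X * .X) * .C 2 + .C 1)), fun N env s hN hr _ => ?_⟩
  simp only [Polynomial.eval_add, Polynomial.eval_mul, Polynomial.eval_C, Polynomial.eval_X]
  refine (p.runs_move hr s.1 ([], s.2)).seq (Runs.seq (Runs.op (.modify f) _)
    (Runs.mono (t := (((moveR blank)^[p.val N (inlVal env)] ([], s.2)).1.length * 2 + 1)) ?_ ?_))
  · have h := runs_rewind (Γ := Γ) (blank := blank) (ctr N env)
      (f s.1 (((moveR blank)^[p.val N (inlVal env)] ([], s.2)).2.head?.getD blank)).1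
      ((moveR blank)^[p.val N (inlVal env)] ([], s.2)).1
      ((f s.1 (((moveR blank)^[p.val N (inlVal env)] ([], s.2)).2.head?.getD blank)).2 ::
        ((moveR blank)^[p.val N (inlVal env)] ([], s.2)).2.tail)
    rw [rewind_moveR (fun c => (f s.1 c).2)] at h
    simp only [clean]
    rw [← head_moveR (p.val N (inlVal env)) ([], s.2)]
    exact h
  · rw [length_moveR]
    have := p.val_le (e := inlVal env) hr.inlVal_le hN
    simp only [List.length_nil, Nat.zero_add]
    omega

variable [DecidableEq V]

/-- Run `P` for all values of a variable. -/
def forVar (v : V) (P : Prog Γ C (Ctr V)) : Prog Γ C (Ctr V) := transfer (.rem v) (.pos v) P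

/-- Apply `g 0, …, g (n - 1)` in this order. -/
def iter {S : Type} (g : ℕ → S → S) : ℕ → S → S
  | 0, s => s
  | n + 1, s => g n (iter g n s)

/-- For an unused `v` the counters `rem v` and `pos v` hold `N` and 0, and during pass `i` of
`transfer` they hold `N - 1 - i` and `i`, exactly as if `v` had the value `i`. -/
theorem Computes.forVar {P : Prog Γ C (Ctr V)} {U : List V}
    {F : ℕ → (V → Option ℕ) → Bool × List C → Bool × List C} {v : V} (hv : v ∉ U)
    (h : Computes blank P U F) :
    Computes blank (forVar v P) (v :: U) (fun N env s =>
      iter (fun i s => F N (Function.update env v (some i)) s) N s) := by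
  obtain ⟨p, hp⟩ := h
  refine ⟨.X * (p + .C 6) + .C 2, fun N env s hN hr hU => ?_⟩
  simp only [Polynomial.eval_add, Polynomial.eval_mul, Polynomial.eval_C, Polynomial.eval_X]
  have hv' : env v = none := hU v (by simp)
  have hc : ctr N env (.rem v) = N := by simp [ctr, hv']
  have := runs_transfer (Γ := Γ) (blank := blank) (P := P) (κ := ctr N env) (c := .rem v)
    (d := .pos v) (by simp) (by simp [ctr, hv'])
    (fun n => (iter (fun i s => F N (Function.update env v (some i)) s) n s).1)
    (fun n => ([], (iter (fun i s => F N (Function.update env v (some i)) s) n s).2))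
    (p.eval N) (fun i hi => by
      rw [hc] at hi ⊢
      have he : setTwo (ctr N env) (.rem v) (.pos v) (N - 1 - i) i =
          ctr N (Function.update env v (some i)) := by
        funext q
        simp only [setTwo, Function.update_apply]
        cases q with
        | pos u => by_cases h : u = v <;> simp [ctr, h]
        | rem u => by_cases h : u = v <;> simp [ctr, h]
        | _ => simp [ctr]
      rw [he]
      refine hp N _ _ hN ?_ ?_
      · intro u j hj
        by_cases h : u = v
        · subst h
          simp only [Function.update_self, Option.mem_def, Option.some.injEq] at hj
          omega
        · rw [Function.update_of_ne h] at hj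
          exact hr u j hj
      · intro u hu
        rw [Function.update_of_ne (by rintro rfl; exact hv hu)]
        exact hU u (by simp [hu]))
  rw [hc] at this
  exact this

/-- Nested loops. -/
def nest (P : Prog Γ C (Ctr V)) : List V → Prog Γ C (Ctr V)
  | [] => P
  | v :: vs => forVar v (nest P vs)

/-- The effect of nested loops. -/
def sweep {S : Type} (N : ℕ) (F : (V → Option ℕ) → S → S) :
    List V → (V → Option ℕ) → S → S
  | [], env, s => F env s
  | v :: vs, env, s => iter (fun i s => sweep N F vs (Function.update env v (some i)) s) N s

theorem Computes.nest {P : Prog Γ C (Ctr V)}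
    {F : ℕ → (V → Option ℕ) → Bool × List C → Bool × List C} (h : Computes blank P [] F)
    {vs : List V} (hvs : vs.Nodup) :
    Computes blank (nest P vs) vs (fun N env s => sweep N (F N) vs env s) := by
  induction vs with
  | nil => exact h
  | cons v vs ih =>
    rw [List.nodup_cons] at hvs
    exact (ih hvs.2).forVar hvs.1

end Loops

end StackProg

/-! ### Datalog programs over words -/

namespace StackProg

/-! ### Sweeps over all values of the variables -/

section Sweep

variable {V S S' : Type} [DecidableEq V]

theorem iter_rel {r : S → S' → Prop} {g : ℕ → S → S} {g' : ℕ → S' → S'} {N : ℕ}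
    (h : ∀ i < N, ∀ s s', r s s' → r (g i s) (g' i s')) {s : S} {s' : S'} (hs : r s s') :
    r (iter g N s) (iter g' N s') := by
  induction N with
  | zero => exact hs
  | succ N ih => exact h N (by omega) _ _ (ih fun i hi => h i (by omega))

theorem InRange.update {N : ℕ} {env : V → Option ℕ} (h : InRange N env) (v : V) {i : ℕ}
    (hi : i < N) : InRange N (Function.update env v (some i)) := by
  intro u j hj
  by_cases huv : u = v
  · subst huv
    simp only [Function.update_self, Option.mem_def, Option.some.injEq] at hj
    omega
  · rw [Function.update_of_ne huv] at hj
    exact h u j hj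

/-- A simulation principle, used to relate tapes to the sets of facts stored on them, and, with a
trivial second component, to propagate an upper bound through a sweep. -/
theorem sweep_rel {r : S → S' → Prop} {N : ℕ} {F : (V → Option ℕ) → S → S}
    {G : (V → Option ℕ) → S' → S'}
    (h : ∀ env, InRange N env → ∀ s s', r s s' → r (F env s) (G env s')) (vs : List V)
    {env : V → Option ℕ} (henv : InRange N env) {s : S} {s' : S'} (hs : r s s') :
    r (sweep N F vs env s) (sweep N G vs env s') := by
  induction vs generalizing env s s' with
  | nil => exact h env henv s s' hs
  | cons v vs ih => exact iter_rel (fun i hi s s' hs => ih (henv.update v hi) hs) hs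

theorem sweep_append (N : ℕ) (F : (V → Option ℕ) → S → S) (us vs : List V)
    (env : V → Option ℕ) (s : S) :
    sweep N F (us ++ vs) env s = sweep N (sweep N F vs) us env s := by
  induction us generalizing env s with
  | nil => rfl
  | cons u us ih =>
    simp only [List.cons_append, sweep]
    congr 1
    funext i s
    exact ih _ _

theorem iter_const (f : S → S) (n : ℕ) (s : S) : iter (fun _ => f) n s = f^[n] s := by
  induction n with
  | zero => rfl
  | succ n ih => rw [Function.iterate_succ_apply', ← ih]; rfl

theorem sweep_const (N : ℕ) (f : S → S) (vs : List V) (env : V → Option ℕ) (s : S) :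
    sweep N (fun _ => f) vs env s = f^[N ^ vs.length] s := by
  induction vs generalizing env s with
  | nil => simp [sweep]
  | cons v vs ih =>
    simp only [sweep, ih, iter_const]
    rw [List.length_cons, pow_succ, Function.iterate_mul]

theorem sweep_congr {W : Type} [DecidableEq W] {N : ℕ} {F : (V ⊕ W → Option ℕ) → S → S}
    (hF : ∀ env env', (∀ v, env (.inl v) = env' (.inl v)) → F env = F env') (vs : List (V ⊕ W))
    {env env' : V ⊕ W → Option ℕ} (h : ∀ v, env (.inl v) = env' (.inl v)) :
    sweep N F vs env = sweep N F vs env' := by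
  induction vs generalizing env env' with
  | nil => exact hF env env' h
  | cons u vs ih =>
    funext s
    simp only [sweep]
    congr 1
    funext i
    refine ih fun v => ?_
    simp only [Function.update_apply, h]

/-- Loops over variables that `F` ignores only repeat it. A fixed number of such loops yields any
desired polynomial number of rounds. -/
theorem sweep_inr {W : Type} [DecidableEq W] {N : ℕ} {F : (V ⊕ W → Option ℕ) → S → S}
    (hF : ∀ env env', (∀ v, env (.inl v) = env' (.inl v)) → F env = F env') (us : List W)
    (env : V ⊕ W → Option ℕ) (s : S) :
    sweep N F (us.map .inr) env s = (F env)^[N ^ us.length] s := by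
  have hc := sweep_const N (F env) (us.map (Sum.inr : W → V ⊕ W)) env s
  rw [List.length_map] at hc
  rw [← hc]
  clear hc
  have : ∀ env', (∀ v, env (.inl v) = env' (.inl v)) →
      sweep N F (us.map .inr) env' s = sweep N (fun _ => F env) (us.map .inr) env' s := by
    induction us generalizing s with
    | nil => intro env' h; simp only [List.map_nil, sweep]; rw [hF _ _ h]
    | cons u us ih =>
      intro env' h
      simp only [List.map_cons, sweep]
      congr 1
      funext i s
      exact ih s _ fun v => by rw [Function.update_of_ne (by simp), h]
  exact this env fun _ => rfl

end Sweep

/-! ### Fixed points of inflationary operators -/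

section Inflationary

variable {V α : Type} [DecidableEq V]

theorem subset_iter {g : ℕ → Set α → Set α} (h : ∀ i X, X ⊆ g i X) (n : ℕ) (X : Set α) :
    X ⊆ iter g n X := by
  induction n with
  | zero => exact subset_rfl
  | succ n ih => exact ih.trans (h n _)

/-- Each step can only enlarge the set, so if the composition adds nothing then no single step does.
-/
theorem iter_fixed {g : ℕ → Set α → Set α} (h : ∀ i X, X ⊆ g i X) {n : ℕ} {X : Set α}
    (hX : iter g n X = X) : ∀ i < n, g i X = X := by
  induction n with
  | zero => simp
  | succ n ih =>
    have h₁ : iter g n X = X :=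
      ((h n _).trans hX.subset).antisymm (subset_iter h n X)
    intro i hi
    rcases Nat.lt_succ_iff_lt_or_eq.1 hi with hi | rfl
    · exact ih h₁ i hi
    · have : g i (iter g i X) = X := hX
      rwa [h₁] at this

theorem subset_sweep {N : ℕ} {G : (V → Option ℕ) → Set α → Set α} (h : ∀ env X, X ⊆ G env X)
    (vs : List V) (env : V → Option ℕ) (X : Set α) : X ⊆ sweep N G vs env X := by
  induction vs generalizing env X with
  | nil => exact h env X
  | cons v vs ih => exact subset_iter (fun i X => ih _ X) N X

theorem sweep_fixed {N : ℕ} {G : (V → Option ℕ) → Set α → Set α} (h : ∀ env X, X ⊆ G env X)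
    {vs : List V} {env : V → Option ℕ} {X : Set α} (hX : sweep N G vs env X = X)
    {env' : V → Option ℕ} (h₁ : ∀ v, v ∉ vs → env' v = env v)
    (h₂ : ∀ v ∈ vs, ∃ i < N, env' v = some i) : G env' X = X := by
  induction vs generalizing env with
  | nil =>
    obtain rfl : env' = env := funext fun v => h₁ v (by simp)
    exact hX
  | cons v vs ih =>
    obtain ⟨i, hi, hv⟩ := h₂ v (by simp)
    refine ih (iter_fixed (fun i X => subset_sweep h vs _ X) hX i hi) (fun u hu => ?_)
      fun u hu => h₂ u (by simp [hu])
    by_cases huv : u = v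
    · subst huv; simp [hv]
    · rw [Function.update_of_ne huv]
      exact h₁ u (by simp [huv, hu])

/-- Until the iteration becomes stable every round adds an element of `U`, which can happen at most
`U.ncard` times. -/
theorem iterate_fixed {F : Set α → Set α} (hF : ∀ X, X ⊆ F X) {U : Set α} (hU : U.Finite)
    (hFU : ∀ X ⊆ U, F X ⊆ U) {k : ℕ} (hk : U.ncard ≤ k) : F (F^[k] ∅) = F^[k] ∅ := by
  have hsub : ∀ k, F^[k] ∅ ⊆ U := by
    intro k
    induction k with
    | zero => simp
    | succ k ih => rw [Function.iterate_succ_apply']; exact hFU _ ih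
  have key : ∀ k, F (F^[k] ∅) = F^[k] ∅ ∨ k + 1 ≤ (F^[k + 1] ∅).ncard := by
    intro k
    induction k with
    | zero =>
      by_cases h : F ∅ = ∅
      · exact .inl h
      · refine .inr ?_
        have : (F ∅).Finite := hU.subset (hsub 1)
        exact (Set.ncard_pos this).2 (Set.nonempty_iff_ne_empty.2 h)
    | succ k ih =>
      rw [← Function.iterate_succ_apply' F k] at ih
      by_cases h : F (F^[k + 1] ∅) = F^[k + 1] ∅
      · exact .inl h
      · refine .inr ?_
        rcases ih with ih | ih
        · exact absurd ((congrArg F ih).trans (Function.iterate_succ_apply' F k ∅).symm) h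
        · rw [Function.iterate_succ_apply' F (k + 1)]
          have hss : F^[k + 1] ∅ ⊂ F (F^[k + 1] ∅) := (hF _).ssubset_of_ne (Ne.symm h)
          have hfin : (F (F^[k + 1] ∅)).Finite := by
            rw [← Function.iterate_succ_apply' F (k + 1)]
            exact hU.subset (hsub _)
          have := Set.ncard_lt_ncard hss hfin
          omega
  rcases key k with h | h
  · exact h
  · have := Set.ncard_le_ncard (hsub (k + 1)) hU
    omega

end Inflationary

/-! #### Rules and their semantics -/

variable {Γ Tag V : Type}

/-- Premises of rules. The variables range over the numbers less than `4 * n + 3`, where `n` is the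
length of the input word, and the facts are pairs of a number and a tag. -/
inductive Premise (Γ Tag V : Type)
  /-- the input has the given letter, or its end, at the position `v` -/
  | letter (v : V) (a : Option Γ)
  | fact (p : Path V) (t : Tag)
  /-- the variable has its largest value (or not) -/
  | last (v : V) (b : Bool)

structure Rule (Γ Tag V : Type) where
  premises : List (Premise Γ Tag V)
  target : Path V
  tag : Tag

/-- This is the number of moments from `-(2n + 1)` to `2n + 1`, where `n` is the length of `w`. A
formula written as `w` has at most `n` boxes, so its window fits, and every position, including the
end of the word, lies below this number. -/
def range (w : List Γ) : ℕ := 4 * w.length + 3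

/-- `some none` marks the position just after the word, `none` all positions beyond it. -/
def letterAt (w : List Γ) (i : ℕ) : Option (Option Γ) := (w.map some ++ [none])[i]?

def Premise.Holds (w : List Γ) (e : V → ℕ) (X : Set (ℕ × Tag)) : Premise Γ Tag V → Prop
  | .letter v a => letterAt w (e v) = some a
  | .fact p t => (p.val (range w) e, t) ∈ X
  | .last v b => e v + 1 = range w ↔ b = true

def Rule.Fires (w : List Γ) (e : V → ℕ) (X : Set (ℕ × Tag)) (r : Rule Γ Tag V) : Prop :=
  ∀ q ∈ r.premises, q.Holds w e X

def Rule.Closed (w : List Γ) (X : Set (ℕ × Tag)) (r : Rule Γ Tag V) : Prop :=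
  ∀ e : V → ℕ, (∀ v, e v < range w) → r.Fires w e X → (r.target.val (range w) e, r.tag) ∈ X

/-- The least set of facts closed under the rules. -/
def derivable {ι : Type} (rule : ι → Rule Γ Tag V) (w : List Γ) : Set (ℕ × Tag) :=
  ⋂₀ {X | ∀ n, (rule n).Closed w X}

theorem Premise.Holds.mono {w : List Γ} {e : V → ℕ} {X Y : Set (ℕ × Tag)} (h : X ⊆ Y)
    {q : Premise Γ Tag V} (hq : q.Holds w e X) : q.Holds w e Y := by
  cases q with
  | fact p t => exact h hq
  | _ => exact hq

theorem closed_derivable {ι : Type} (rule : ι → Rule Γ Tag V) (w : List Γ) (n : ι) :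
    (rule n).Closed w (derivable rule w) := fun e he hf _ hX =>
  hX n e he fun q hq => (hf q hq).mono (Set.sInter_subset_of_mem hX)

theorem derivable_subset {ι : Type} {rule : ι → Rule Γ Tag V} {w : List Γ} {X : Set (ℕ × Tag)}
    (h : ∀ n, (rule n).Closed w X) : derivable rule w ⊆ X := Set.sInter_subset_of_mem h

/-- Add the conclusion of a rule if it fires. -/
def Rule.apply (w : List Γ) (e : V → ℕ) (r : Rule Γ Tag V) (X : Set (ℕ × Tag)) :
    Set (ℕ × Tag) :=
  X ∪ {x | x = (r.target.val (range w) e, r.tag) ∧ r.Fires w e X}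

/-- Rules see the conclusions of earlier ones in the same pass, as on the tape, which is updated in
place. The least fixed point is not affected. -/
def applyAll (w : List Γ) (e : V → ℕ) : List (Rule Γ Tag V) → Set (ℕ × Tag) → Set (ℕ × Tag)
  | [], X => X
  | r :: rs, X => applyAll w e rs (r.apply w e X)

theorem subset_applyAll (w : List Γ) (e : V → ℕ) (rs : List (Rule Γ Tag V))
    (X : Set (ℕ × Tag)) : X ⊆ applyAll w e rs X := by
  induction rs generalizing X with
  | nil => exact subset_rfl
  | cons r rs ih => exact Set.subset_union_left.trans (ih _)

theorem applyAll_fixed {w : List Γ} {e : V → ℕ} {rs : List (Rule Γ Tag V)}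
    {X : Set (ℕ × Tag)} (h : applyAll w e rs X = X) : ∀ r ∈ rs, r.apply w e X = X := by
  induction rs with
  | nil => simp
  | cons r rs ih =>
    have hr : r.apply w e X = X :=
      ((subset_applyAll w e rs _).trans h.subset).antisymm Set.subset_union_left
    have h' : applyAll w e rs X = X := by
      have := h
      rwa [applyAll, hr] at this
    intro r' hr'
    rcases List.mem_cons.1 hr' with rfl | hr'
    · exact hr
    · exact ih h' r' hr'

theorem applyAll_subset {w : List Γ} {e : V → ℕ} {rs : List (Rule Γ Tag V)}
    {X Y : Set (ℕ × Tag)} (hXY : X ⊆ Y)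
    (hY : ∀ r ∈ rs, ∀ Z ⊆ Y, r.Fires w e Z → (r.target.val (range w) e, r.tag) ∈ Y) :
    applyAll w e rs X ⊆ Y := by
  induction rs generalizing X with
  | nil => exact hXY
  | cons r rs ih =>
    refine ih (Set.union_subset hXY ?_) fun r hr => hY r (by simp [hr])
    rintro x ⟨rfl, hx⟩
    exact hY r (by simp) X hXY hx

/-- The sweeps over all values of the variables compute the least fixed point. -/
theorem sweep_eq_derivable [Fintype V] [DecidableEq V] [Finite Tag] {ι : Type} [Fintype ι]
    (rule : ι → Rule Γ Tag V) (w : List Γ) {c q : ℕ}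
    (hc : ∀ n, (rule n).target.length ≤ c) (hq : 2 + (c + 1) * Nat.card Tag ≤ q) :
    sweep (range w) (fun env => applyAll w (inlVal env) (Finset.univ.toList.map rule))
      ((List.finRange q).map .inr ++ (Finset.univ : Finset V).toList.map .inl)
      (fun _ => none) ∅ = derivable rule w := by
  set N := range w with hNdef
  have hN : 3 ≤ N := by rw [hNdef, range]; omega
  set G : (V ⊕ Fin q → Option ℕ) → Set (ℕ × Tag) → Set (ℕ × Tag) :=
    fun env => applyAll w (inlVal env) (Finset.univ.toList.map rule) with hG
  set F : Set (ℕ × Tag) → Set (ℕ × Tag) :=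
    sweep N G ((Finset.univ : Finset V).toList.map .inl) (fun _ => none) with hFdef
  have hGinfl : ∀ env X, X ⊆ G env X := fun env X => subset_applyAll _ _ _ _
  have hGc : ∀ env env', (∀ v, env (.inl v) = env' (.inl v)) → G env = G env' := by
    intro env env' h
    have : inlVal env = inlVal env' := by funext v; simp only [inlVal, h]
    simp only [hG, this]
  have hsub : ∀ {Y : Set (ℕ × Tag)}, (∀ n, ∀ e : V → ℕ, (∀ v, e v < N) → ∀ Z ⊆ Y,
      (rule n).Fires w e Z → ((rule n).target.val N e, (rule n).tag) ∈ Y) →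
      ∀ X ⊆ Y, F X ⊆ Y := by
    intro Y hY X hX
    refine sweep_rel (r := fun X (_ : Unit) => X ⊆ Y) (G := fun _ => id) ?_ _ ?_ (s' := ()) hX
    · intro env henv X _ hX
      refine applyAll_subset hX ?_
      intro r hr
      obtain ⟨n, -, rfl⟩ := List.mem_map.1 hr
      refine hY n _ fun v => ?_
      unfold inlVal
      cases hv : env (.inl v) with
      | none => simp only [Option.getD_none]; omega
      | some i => exact henv _ i hv
    · intro v i hi
      simp at hi
  -- The outer loops run over the dummy variables, so the whole sweep is `N ^ q` rounds of `F`.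
  rw [sweep_append, sweep_inr (fun env env' h => sweep_congr hGc _ h), List.length_finRange]
  change F^[N ^ q] ∅ = _
  -- A summand of an address is at most `N * N`, so all targets of rules lie in this finite set of
  -- polynomial size.
  set U : Set (ℕ × Tag) := (Set.Iio (c * (N * N) + 1)) ×ˢ Set.univ with hU
  have hUfin : U.Finite := (Set.finite_Iio _).prod Set.finite_univ
  have hUcard : U.ncard ≤ N ^ q := by
    rw [hU, Set.ncard_prod, Set.ncard_univ, ← Nat.card_coe_set_eq, Nat.card_eq_fintype_card,
      Fintype.card_Iio, Nat.card_Iio]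
    -- The exponent `q` is chosen for this estimate: 2 for the factor `N ^ 2`, and `(c + 1) *
    -- Nat.card Tag` to absorb the constant factor by `x ≤ N ^ x`.
    calc (c * (N * N) + 1) * Nat.card Tag ≤ ((c + 1) * Nat.card Tag) * N ^ 2 := by
          have : 1 ≤ N * N := Nat.mul_pos (by omega) (by omega)
          nlinarith [Nat.zero_le (Nat.card Tag)]
      _ ≤ N ^ ((c + 1) * Nat.card Tag) * N ^ 2 :=
          Nat.mul_le_mul_right _ (Nat.lt_pow_self (by omega)).le
      _ = N ^ (2 + (c + 1) * Nat.card Tag) := by rw [← pow_add, Nat.add_comm]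
      _ ≤ N ^ q := Nat.pow_le_pow_right (by omega) hq
  have hfix : F (F^[N ^ q] ∅) = F^[N ^ q] ∅ := by
    refine iterate_fixed (fun X => subset_sweep hGinfl _ _ X) hUfin (hsub ?_) hUcard
    intro n e he Z _ _
    refine ⟨?_, trivial⟩
    have := (rule n).target.val_le (N := N) (e := e) (fun v => (he v).le) (by omega)
    have := Nat.mul_le_mul_right (N * N) (hc n)
    simp only [Set.mem_Iio]
    omega
  apply subset_antisymm
  · have : ∀ k, F^[k] ∅ ⊆ derivable rule w := by
      intro k
      induction k with
      | zero => simp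
      | succ k ih =>
        rw [Function.iterate_succ_apply']
        refine hsub ?_ _ ih
        intro n e he Z hZ hf
        exact closed_derivable rule w n e he fun q hq => (hf q hq).mono hZ
    exact this _
  -- The stable set is closed: each instance of a rule occurs in the sweep, and there it adds
  -- nothing new.
  · refine derivable_subset fun n e he hf => ?_
    have h₁ := sweep_fixed hGinfl hfix (env' := fun v => v.elim (fun v => some (e v))
      fun _ => none) ?_ ?_
    · have h₂ := applyAll_fixed h₁ (rule n) (List.mem_map.2 ⟨n, by simp, rfl⟩)
      rw [← h₂]
      exact Set.mem_union_right _ ⟨rfl, hf⟩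
    · rintro (v | v) hv
      · simp at hv
      · rfl
    · intro v hv
      obtain ⟨v, -, rfl⟩ := List.mem_map.1 hv
      exact ⟨e v, he v, rfl⟩

end StackProg

namespace StackProg

/-! #### Datalog programs run in polynomial time -/

section Program

variable {Γ Tag V W : Type}

/-- A cell of the tape: a letter of the input (or its end), and facts about the address. -/
abbrev Cell (Γ Tag : Type) := Option (Option Γ) × (Tag → Bool)

def blankCell : Cell Γ Tag := (none, fun _ => false)

open Classical in
-- Each premise is conjoined to the accumulator. The last value of a variable is recognised by its
-- `rem` counter being empty.
noncomputable def Premise.prog : Premise Γ Tag V → Prog Γ (Cell Γ Tag) (Ctr (V ⊕ W))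
  | .letter v a => access [.var v] fun acc c => (acc && decide (c.1 = some a), c)
  | .fact p t => access p fun acc c => (acc && c.2 t, c)
  | .last v b => .op (.test (.rem (.inl v)) fun acc z => acc && (z == b))

noncomputable def premisesProg : List (Premise Γ Tag V) → Prog Γ (Cell Γ Tag) (Ctr (V ⊕ W))
  | [] => .op (.setAcc fun _ => true)
  | q :: qs => .seq (premisesProg qs) q.prog

open Classical in
noncomputable def Rule.prog (r : Rule Γ Tag V) : Prog Γ (Cell Γ Tag) (Ctr (V ⊕ W)) :=
  .seq (premisesProg r.premises)
    (access r.target fun acc c => (acc, c.1, fun t => c.2 t || (acc && decide (t = r.tag))))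

noncomputable def rulesProg : List (Rule Γ Tag V) → Prog Γ (Cell Γ Tag) (Ctr (V ⊕ W))
  | [] => .op (.setAcc id)
  | r :: rs => .seq r.prog (rulesProg rs)

/-- The tape contains the letters of `w` and the facts in `X`. -/
def Represents (w : List Γ) (X : Set (ℕ × Tag)) (R : List (Cell Γ Tag)) : Prop :=
  ∀ i, (R.getD i blankCell).1 = letterAt w i ∧
    ∀ t, (R.getD i blankCell).2 t = true ↔ (i, t) ∈ X

theorem Represents.modifyAt_id {w : List Γ} {X : Set (ℕ × Tag)} {R : List (Cell Γ Tag)}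
    (h : Represents w X R) (k : ℕ) : Represents w X (modifyAt blankCell (fun c => c) k R) := by
  intro i
  rw [getD_modifyAt]
  split_ifs with hi
  · subst hi; exact h i
  · exact h i

theorem Premise.computes_prog (q : Premise Γ Tag V) :
    ∃ F, Computes blankCell (q.prog (W := W)) [] F ∧
      ∀ (w : List Γ) env s X, InRange (range w) env → Represents w X s.2 →
        Represents w X (F (range w) env s).2 ∧
        ((F (range w) env s).1 = true ↔ s.1 = true ∧ q.Holds w (inlVal env) X) := by
  cases q with
  | letter v a =>
    refine ⟨_, computes_access _ _ _, fun w env s X _ h => ⟨h.modifyAt_id _, ?_⟩⟩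
    rw [Bool.and_eq_true, @decide_eq_true_iff _ (_), (h _).1]
    simp [Premise.Holds, Path.val, Atom.val]
  | fact p t =>
    refine ⟨_, computes_access _ _ _, fun w env s X _ h => ⟨h.modifyAt_id _, ?_⟩⟩
    simp only [Bool.and_eq_true, (h _).2, Premise.Holds]
  | last v b =>
    refine ⟨_, computes_test _ _ _, fun w env s X hr h => ⟨h, ?_⟩⟩
    have key : (ctr (range w) env (.rem (.inl v)) == 0) = true ↔
        inlVal env v + 1 = range w := by
      have hN : 3 ≤ range w := by unfold range; omega
      simp only [ctr, inlVal, beq_iff_eq]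
      cases hv : env (.inl v) with
      -- An unused variable has value 0 and a full `rem` counter, so both sides fail, as `range w`
      -- is at least 3.
      | none => simp only [Option.elim_none, Option.getD_none]; omega
      | some i =>
        have := hr _ i hv
        simp only [Option.elim_some, Option.getD_some]
        omega
    simp only [Bool.and_eq_true, Premise.Holds, ← key]
    cases b <;> simp

theorem computes_premisesProg (qs : List (Premise Γ Tag V)) :
    ∃ F, Computes blankCell (premisesProg (W := W) qs) [] F ∧
      ∀ (w : List Γ) env s X, InRange (range w) env → Represents w X s.2 →
        Represents w X (F (range w) env s).2 ∧
        ((F (range w) env s).1 = true ↔ ∀ q ∈ qs, q.Holds w (inlVal env) X) := by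
  induction qs with
  | nil => exact ⟨_, computes_setAcc _ _, fun w env s X _ h => ⟨h, by simp⟩⟩
  | cons q qs ih =>
    obtain ⟨F, hF, hF'⟩ := ih
    obtain ⟨F₁, hF₁, hF₁'⟩ := q.computes_prog (W := W)
    refine ⟨_, hF.seq hF₁, fun w env s X hr h => ?_⟩
    obtain ⟨h₁, h₂⟩ := hF' w env s X hr h
    obtain ⟨h₃, h₄⟩ := hF₁' w env _ X hr h₁
    refine ⟨h₃, h₄.trans ?_⟩
    rw [h₂, List.forall_mem_cons, and_comm]

theorem Rule.computes_prog (r : Rule Γ Tag V) :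
    ∃ F, Computes blankCell (r.prog (W := W)) [] F ∧
      ∀ (w : List Γ) env s X, InRange (range w) env → Represents w X s.2 →
        Represents w (r.apply w (inlVal env) X) (F (range w) env s).2 := by
  obtain ⟨F, hF, hF'⟩ := computes_premisesProg (W := W) r.premises
  refine ⟨_, hF.seq (computes_access _ _ _), fun w env s X hr h => ?_⟩
  obtain ⟨h₁, h₂⟩ := hF' w env s X hr h
  intro i
  dsimp only
  rw [getD_modifyAt]
  simp only [Rule.apply, Set.mem_union, Set.mem_ofPred_eq, Prod.mk.injEq, Rule.Fires, ← h₂]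
  split_ifs with hi
  · subst hi
    refine ⟨(h₁ _).1, fun t => ?_⟩
    simp only [Bool.or_eq_true, Bool.and_eq_true, decide_eq_true_eq, (h₁ _).2, true_and]
    rw [and_comm]
  · refine ⟨(h₁ _).1, fun t => ?_⟩
    rw [(h₁ i).2 t]
    simp [hi]

theorem computes_rulesProg (rs : List (Rule Γ Tag V)) :
    ∃ F, Computes blankCell (rulesProg (W := W) rs) [] F ∧
      ∀ (w : List Γ) env s X, InRange (range w) env → Represents w X s.2 →
        Represents w (applyAll w (inlVal env) rs X) (F (range w) env s).2 := by
  induction rs with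
  | nil => exact ⟨_, computes_setAcc _ _, fun w env s X _ h => h⟩
  | cons r rs ih =>
    obtain ⟨F, hF, hF'⟩ := ih
    obtain ⟨F₁, hF₁, hF₁'⟩ := r.computes_prog (W := W)
    exact ⟨_, hF₁.seq hF, fun w env s X hr h => hF' w env _ _ hr (hF₁' w env s X hr h)⟩

end Program

/-! #### Preparing and clearing the stacks -/

section Setup

variable {Γ C Q V : Type} [DecidableEq Q] {blank : C}

/-- Every step adds at most one symbol to the tape. -/
theorem Runs.length_le {P : Prog Γ C Q} {a b : Store Γ C Q} {t : ℕ} (h : Runs blank P a b t) :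
    b.left.length + b.right.length ≤ a.left.length + a.right.length + t := by
  induction h with
  | op o a => cases o <;> simp [Op.run] <;> omega
  | seq _ _ ih₁ ih₂ => omega
  | loop_done => omega
  | loop_step _ _ _ ih₁ ih₂ => omega
  | mono _ _ ih => omega

def incAll : List Q → Prog Γ C Q
  | [] => .op (.setAcc id)
  | q :: qs => .seq (.op (.inc q)) (incAll qs)

theorem runs_incAll {qs : List Q} (h : qs.Nodup) (a : Store Γ C Q) :
    Runs blank (incAll qs) a { a with cnt := fun q => a.cnt q + if q ∈ qs then 1 else 0 }
      (qs.length + 1) := by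
  induction qs generalizing a with
  | nil =>
    have hs : ({ a with cnt := fun q => a.cnt q + if q ∈ [] then 1 else 0 } : Store Γ C Q) =
        (Op.setAcc id).run blank a := Store.ext rfl rfl rfl rfl rfl (by funext q; simp [Op.run])
    rw [hs]
    exact Runs.op _ _
  | cons q qs ih =>
    rw [List.nodup_cons] at h
    have h₁ := (Runs.op (blank := blank) (.inc q) a).seq (ih h.2 _)
    have hs : ({ a with cnt := fun q' => a.cnt q' + if q' ∈ q :: qs then 1 else 0 } :
        Store Γ C Q) = { a with cnt := fun q' => ((Op.inc q).run blank a).cnt q' +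
          if q' ∈ qs then 1 else 0 } := Store.ext rfl rfl rfl rfl rfl <| by
      funext q'
      by_cases hq : q' = q
      · subst hq; simp [h.1, Op.run]
      · simp [hq, Op.run]
    rw [hs]
    exact h₁.mono (by simp only [List.length_cons]; omega)

def clearAll : List Q → Prog Γ C Q
  | [] => .op (.setAcc id)
  | q :: qs => .seq (.loop (.cnt q) (.op (.dec q))) (clearAll qs)

theorem runs_clear (q : Q) (n : ℕ) (a : Store Γ C Q) (hn : a.cnt q = n) :
    Runs blank (.loop (.cnt q) (.op (.dec q))) a
      { a with cnt := Function.update a.cnt q 0 } (n * 2 + 1) := by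
  induction n generalizing a with
  | zero =>
    have : { a with cnt := Function.update a.cnt q 0 } = a := by
      ext1 <;> try rfl
      simp [← hn]
    rw [this]
    refine (Runs.loop_done ?_).mono (by simp)
    change List.replicate (a.cnt q) () = []
    rw [hn]
    rfl
  | succ n ih =>
    have := ih ((Op.dec q).run blank a) (by simp [Op.run, hn])
    simp only [Op.run, Function.update_idem] at this
    exact (Runs.loop_step (Store.stacks_cnt_ne (by omega)) (Runs.op _ _) this).mono (by omega)

theorem runs_clearAll (qs : List Q) {N : ℕ} (a : Store Γ C Q) (h : ∀ q, a.cnt q ≤ N) :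
    Runs blank (clearAll qs) a { a with cnt := fun q => if q ∈ qs then 0 else a.cnt q }
      (qs.length * (N * 2 + 1) + 1) := by
  induction qs generalizing a with
  | nil =>
    have hs : ({ a with cnt := fun q => if q ∈ [] then 0 else a.cnt q } : Store Γ C Q) =
        (Op.setAcc id).run blank a := Store.ext rfl rfl rfl rfl rfl (by funext q; simp [Op.run])
    rw [hs]
    exact (Runs.op _ _).mono (by omega)
  | cons q qs ih =>
    have h₁ := (runs_clear (blank := blank) q _ a rfl).mono
      (u := N * 2 + 1) (by have := h q; omega)
    have h₂ := h₁.seq (ih { a with cnt := Function.update a.cnt q 0 } fun q' => by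
      by_cases hq : q' = q
      · subst hq; simp
      · simpa [hq] using h q')
    have hs : ({ a with cnt := fun q' => if q' ∈ q :: qs then 0 else a.cnt q' } : Store Γ C Q) =
        { a with cnt := fun q' => if q' ∈ qs then 0 else Function.update a.cnt q 0 q' } :=
      Store.ext rfl rfl rfl rfl rfl <| by
        funext q'
        by_cases hq : q' = q
        · subst hq; simp
        · simp [hq]
    rw [hs]
    refine h₂.mono ?_
    simp only [List.length_cons]
    rw [Nat.add_mul]
    omega

theorem runs_erase (a : Store Γ C Q) :
    Runs blank (.loop .right (.op .erase)) a { a with right := [] } (a.right.length * 2 + 1) := by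
  obtain ⟨acc, inp, out, left, right, cnt⟩ := a
  induction right with
  | nil => exact (Runs.loop_done rfl).mono (by simp)
  | cons c R ih =>
    refine (Runs.loop_step (a := ⟨acc, inp, out, left, c :: R, cnt⟩) ?_ (Runs.op _ _) ih).mono
      (by simp; omega)
    exact List.cons_ne_nil c R

variable [Fintype V]

/-- The counters that are not zero when no variable is in use. -/
noncomputable def restCtrs (V : Type) [Fintype V] : List (Ctr V) :=
  .len :: (Finset.univ : Finset V).toList.map .rem

theorem nodup_restCtrs : (restCtrs V).Nodup := by
  refine List.nodup_cons.2 ⟨by simp, (Finset.nodup_toList _).map ?_⟩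
  intro a b h
  cases h
  rfl

theorem mem_restCtrs {q : Ctr V} : q ∈ restCtrs V ↔ ctr 1 (fun _ : V => none) q = 1 := by
  cases q <;> simp [restCtrs, ctr]

/-- With no variable in use, exactly the counters in `restCtrs` hold `N`, so incrementing them
together raises `N` by one. -/
noncomputable def grow : ℕ → Prog Γ C (Ctr V)
  | 0 => .op (.setAcc id)
  | n + 1 => .seq (incAll (restCtrs V)) (grow n)

theorem runs_grow (n N : ℕ) (acc : Bool) (inp : List Γ) (out : List Bool) (left right : List C) :
    Runs blank (grow (V := V) n) ⟨acc, inp, out, left, right, ctr N fun _ => none⟩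
      ⟨acc, inp, out, left, right, ctr (N + n) fun _ => none⟩
      (n * ((restCtrs V).length + 1) + 1) := by
  induction n generalizing N with
  | zero => exact (Runs.op _ _).mono (by omega)
  | succ n ih =>
    have h₁ := (runs_incAll (blank := blank) nodup_restCtrs
      (⟨acc, inp, out, left, right, ctr N fun _ : V => none⟩ : Store Γ C (Ctr V)))
    have h₂ : (fun q => ctr N (fun _ : V => none) q + if q ∈ restCtrs V then 1 else 0) =
        ctr (N + 1) fun _ => none := by
      funext q
      simp only [mem_restCtrs]
      cases q <;> simp [ctr]
    simp only [h₂] at h₁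
    have h₃ := h₁.seq (ih (N + 1))
    rw [show N + 1 + n = N + (n + 1) by omega] at h₃
    refine h₃.mono ?_
    rw [Nat.add_mul]
    omega

/-- Move the input to the tape, mark its end, and set up the counters. -/
noncomputable def startup (f : Γ → C) (fin : C) : Prog Γ C (Ctr V) :=
  .seq (.loop .inp (.seq (.op (.read f)) (grow 4)))
    (.seq (grow 3) (.seq (.op (.place fin)) rewind))

/-- Every letter raises `N` by 4 and the end of the input by 3, which gives `range w`. -/
theorem runs_startup (f : Γ → C) (fin : C) :
    ∃ p : Polynomial ℕ, ∀ w : List Γ,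
      Runs blank (startup (V := V) f fin) ⟨false, w, [], [], [], fun _ => 0⟩
        (clean (range w) (fun _ => none) (false, w.map f ++ [fin])) (p.eval w.length) := by
  set m := (restCtrs V).length + 1 with hm
  refine ⟨.X * .C (1 + (1 + (4 * m + 1))) + .C 1 +
    (.C (3 * m + 1) + (.C 1 + ((.X + .C 1) * .C 2 + .C 1))), fun w => ?_⟩
  have h₁ : ∀ (w : List Γ) (L : List C) (N : ℕ),
      Runs blank (.loop .inp (.seq (.op (.read f)) (grow 4)))
        ⟨false, w, [], L, [], ctr N fun _ : V => none⟩
        ⟨false, [], [], (w.map f).reverse ++ L, [], ctr (N + 4 * w.length) fun _ : V => none⟩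
        (w.length * (1 + (1 + (4 * m + 1))) + 1) := by
    intro w
    induction w with
    | nil => intro L N; exact (Runs.loop_done rfl).mono (by simp)
    | cons a w ih =>
      intro L N
      have h := Runs.loop_step (k := .inp)
        (a := ⟨false, a :: w, [], L, [], ctr N fun _ : V => none⟩) (List.cons_ne_nil a w)
        ((Runs.op (.read f) ⟨false, a :: w, [], L, [], ctr N fun _ : V => none⟩).seq
          (runs_grow (blank := blank) (V := V) 4 N false w [] (f a :: L) []))
        (ih (f a :: L) (N + 4))
      simp only [List.map_cons, List.reverse_cons, List.append_assoc, List.singleton_append]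
      rw [show N + 4 * (a :: w).length = N + 4 + 4 * w.length by simp; omega]
      refine h.mono ?_
      rw [List.length_cons, Nat.add_mul]
      omega
  have h₀ : (fun _ => 0) = ctr 0 (fun _ : V => none) := by
    funext q
    cases q <;> simp [ctr]
  simp only [Polynomial.eval_add, Polynomial.eval_mul, Polynomial.eval_C, Polynomial.eval_X]
  rw [h₀]
  refine (h₁ w [] 0).seq ((runs_grow 3 _ _ _ _ _ _).seq ((Runs.op (.place fin) _).seq ?_))
  have h₂ := runs_rewind (Γ := Γ) (blank := blank) (ctr (0 + 4 * w.length + 3) fun _ : V => none)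
    false (fin :: ((w.map f).reverse ++ [])) []
  simp only [List.append_nil, List.reverse_cons, List.reverse_reverse, List.length_cons,
    List.length_reverse, List.length_map] at h₂
  simp only [List.append_nil]
  rw [Nat.zero_add] at h₂ ⊢
  exact h₂

/-- Output whether the first cell of the tape satisfies `f`, and clear all stacks. -/
noncomputable def finish (f : C → Bool) : Prog Γ C (Ctr V) :=
  .seq (.op (.modify fun _ c => (f c, c))) (.seq (.op .emit)
    (.seq (.loop .right (.op .erase)) (clearAll (restCtrs V))))

theorem runs_finish (f : C → Bool) (N : ℕ) (s : Bool × List C) :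
    ∃ acc, Runs blank (finish f) (clean N (fun _ : V => none) s)
      (⟨acc, [], [f (s.2.getD 0 blank)], [], [], fun _ => 0⟩ : Store Γ C (Ctr V))
      (1 + (1 + ((s.2.length + 1) * 2 + 1 + ((restCtrs V).length * (N * 2 + 1) + 1)))) := by
  refine ⟨f (s.2.getD 0 blank), (Runs.op _ _).seq ((Runs.op _ _).seq (Runs.seq
    ((runs_erase _).mono ?_) ?_))⟩
  · simp only [Op.run, clean, st, List.length_cons, List.length_tail]
    omega
  · convert runs_clearAll (N := N) (restCtrs V) _ ?_ using 1
    · simp only [Op.run, clean, st, mem_restCtrs, Store.mk.injEq, true_and]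
      have hh : s.2.getD 0 blank = s.2.head?.getD blank := by cases s.2 <;> rfl
      refine ⟨by rw [hh], by rw [hh], ?_⟩
      funext q
      cases q <;> simp [ctr]
    · intro q
      simp only [Op.run, clean, st]
      cases q <;> simp [ctr]

end Setup

/-- A language is in PTime if it consists of the words for which a Datalog program derives one fact
about the number 0, but not another one. -/
theorem inPTime_of_datalog {Γ Tag V ι : Type} [Finite Γ] [Finite Tag] [Finite V] [Finite ι]
    (rule : ι → Rule Γ Tag V) (yes no : Tag) (L : Language Γ)
    (hL : ∀ w, w ∈ L ↔ (0, yes) ∈ derivable rule w ∧ (0, no) ∉ derivable rule w) :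
    HornPTL.InPTime L := by
  classical
  have := Fintype.ofFinite V
  have := Fintype.ofFinite ι
  obtain ⟨c, hc⟩ : ∃ c, ∀ n, (rule n).target.length ≤ c :=
    ⟨Finset.univ.sup fun n => (rule n).target.length,
      fun n => Finset.le_sup (f := fun n => (rule n).target.length) (Finset.mem_univ n)⟩
  set q := 2 + (c + 1) * Nat.card Tag with hq
  set vs : List (V ⊕ Fin q) :=
    (List.finRange q).map .inr ++ (Finset.univ : Finset V).toList.map .inl with hvs
  have hnd : vs.Nodup := by
    refine List.nodup_append.2 ⟨(List.nodup_finRange q).map Sum.inr_injective,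
      (Finset.nodup_toList _).map Sum.inl_injective, ?_⟩
    intro a ha b hb
    obtain ⟨x, -, rfl⟩ := List.mem_map.1 ha
    obtain ⟨y, -, rfl⟩ := List.mem_map.1 hb
    simp
  obtain ⟨F, hF, hF'⟩ := computes_rulesProg (W := Fin q) (Finset.univ.toList.map rule)
  obtain ⟨p, hp⟩ := hF.nest hnd
  obtain ⟨p₀, hp₀⟩ := runs_startup (V := V ⊕ Fin q) (blank := blankCell)
    (fun a : Γ => ((some (some a), fun _ => false) : Cell Γ Tag)) (some none, fun _ => false)
  set p₁ := p.comp (.C 4 * .X + .C 3) with hp₁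
  set k := (restCtrs (V ⊕ Fin q)).length with hk
  refine inPTime_of_runs (blankCell : Cell Γ Tag)
    (.seq (startup (fun a => (some (some a), fun _ => false)) (some none, fun _ => false)) (.seq (nest (rulesProg (Finset.univ.toList.map rule)) vs)
      (finish fun c => c.2 yes && !c.2 no))) L
    (p₀ + (p₁ + (.C 1 + (.C 1 + ((.X + .C 1 + p₁ + .C 1) * .C 2 + .C 1 +
      (.C k * ((.C 4 * .X + .C 3) * .C 2 + .C 1) + .C 1)))))) fun w => ?_
  have hN : 1 ≤ range w := by unfold range; omega
  have h₀ := hp₀ w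
  have hr₀ : InRange (range w) (fun _ : V ⊕ Fin q => none) := by
    intro v i hi
    simp at hi
  have h₁ := hp (range w) (fun _ => none) (false, w.map
    (fun a : Γ => ((some (some a), fun _ => false) : Cell Γ Tag)) ++ [(some none, fun _ => false)])
    hN hr₀ fun _ _ => rfl
  have hinit : Represents w ∅ (w.map (fun a : Γ => ((some (some a), fun _ => false) :
      Cell Γ Tag)) ++ [(some none, fun _ => false)]) := by
    intro i
    rcases lt_trichotomy i w.length with hi | rfl | hi
    · simp [letterAt, List.getElem?_append, hi]
    · simp [letterAt]
    · have : ¬ i < w.length := by omega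
      have h' : i - w.length ≠ 0 := by omega
      simp [letterAt, List.getElem?_append, this, h', blankCell]
  -- The sweep over tapes mirrors the sweep over sets of facts, which computes the derivable facts.
  have hrep := sweep_rel (N := range w) (F := F (range w))
    (G := fun env => applyAll w (inlVal env) (Finset.univ.toList.map rule))
    (r := fun s X => Represents w X s.2)
    (fun env henv s X h => hF' w env s X henv h) vs hr₀ (s := (false, _)) hinit
  rw [sweep_eq_derivable rule w hc le_rfl] at hrep
  set s' := sweep (range w) (F (range w)) vs (fun _ => none) (false, w.map
    (fun a : Γ => ((some (some a), fun _ => false) : Cell Γ Tag)) ++ [(some none, fun _ => false)])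
  obtain ⟨acc, h₂⟩ := runs_finish (Γ := Γ) (V := V ⊕ Fin q) (blank := blankCell)
    (fun c : Cell Γ Tag => c.2 yes && !c.2 no) (range w) s'
  refine ⟨_, acc, ?_, (h₀.seq (h₁.seq h₂)).mono ?_⟩
  · rw [hL, Bool.and_eq_true, Bool.not_eq_true', ← Bool.not_eq_true, (hrep 0).2, (hrep 0).2]
  -- Erasing takes time linear in the length of the tape, which is bounded by its initial length
  -- plus the running time of the sweep.
  · have hlen := h₁.length_le
    simp only [clean, st, List.length_nil, Nat.zero_add, List.length_append, List.length_map,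
      List.length_singleton] at hlen
    have hr : range w = 4 * w.length + 3 := rfl
    simp only [hp₁, Polynomial.eval_add, Polynomial.eval_mul, Polynomial.eval_C,
      Polynomial.eval_X, Polynomial.eval_comp]
    rw [← hr, hk]
    change s'.2.length ≤ _ at hlen
    omega

end StackProg

/-! ### Boxes on finite windows -/

namespace HornPTL

/-- The moment of the window from `-N` to `N` that is closest to `n`. -/
def clamp (N : ℕ) (n : ℤ) : ℤ := max (-(N : ℤ)) (min (N : ℤ) n)

theorem clamp_neg (N : ℕ) (n : ℤ) : clamp N (-n) = -clamp N n := by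
  unfold clamp; omega

theorem clamp_of_mem {N : ℕ} {n : ℤ} (h : -(N : ℤ) ≤ n) (h' : n ≤ N) : clamp N n = n := by
  unfold clamp; omega

theorem neg_le_clamp (N : ℕ) (n : ℤ) : -(N : ℤ) ≤ clamp N n := by
  unfold clamp; omega

theorem clamp_le (N : ℕ) (n : ℤ) : clamp N n ≤ N := by
  unfold clamp; omega

/-- Here `b` stands for the box and `t` for its argument. A true box passes to the right together
with its argument, and its truth is recovered by descending from `N`. Beyond `N` the clamped
argument keeps its value at `N`, whence `h₄` and `h₅`. If `n` lies before `-N`, then `-N` is itself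
a later moment, but the steps only reach `-N + 1`; this case needs `h₆`. -/
theorem future_iff_clamp {N : ℕ} {t b : ℤ → Prop}
    (h₁ : ∀ m, -(N : ℤ) ≤ m → m < N → b m → b (m + 1))
    (h₂ : ∀ m, -(N : ℤ) ≤ m → m < N → b m → t (m + 1))
    (h₃ : ∀ m, -(N : ℤ) ≤ m → m < N → b (m + 1) → t (m + 1) → b m)
    (h₄ : b N → t N) (h₅ : t N → b N) (h₆ : b (-N) → t (-N)) (n : ℤ) :
    b (clamp N n) ↔ ∀ k, n < k → t (clamp N k) := by
  have hmono : ∀ (j : ℕ) (m : ℤ), -(N : ℤ) ≤ m → m + j ≤ N → b m → b (m + j) := by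
    intro j
    induction j with
    | zero => intro m _ _ h; simpa using h
    | succ j ih =>
      intro m hm hj h
      have := h₁ (m + j) (by omega) (by push_cast at hj; omega) (ih m hm (by push_cast at hj; omega) h)
      rwa [add_assoc] at this
  have hdown : ∀ (j : ℕ) (m : ℤ), m = N - j → -(N : ℤ) ≤ m → t N →
      (∀ k, m < k → k ≤ N → t k) → b m := by
    intro j
    induction j with
    | zero => intro m hm _ ht _; obtain rfl : m = N := by omega
              exact h₅ ht
    | succ j ih =>
      intro m hm hN ht hk
      refine h₃ m hN (by omega) (ih (m + 1) (by omega) (by omega) ht fun k h h' => hk k (by omega) h')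
        (hk (m + 1) (by omega) (by omega))
  constructor
  · intro hb k hk
    by_cases hkN : clamp N k = -N
    · rw [hkN]
      have : clamp N n = -N := by unfold clamp at *; omega
      exact h₆ (this ▸ hb)
    · by_cases hnk : clamp N n < clamp N k
      · have := hmono (clamp N k - 1 - clamp N n).toNat (clamp N n) (neg_le_clamp N n)
          (by have := clamp_le N k; omega) hb
        have h := h₂ _ (by unfold clamp at *; omega) (by unfold clamp at *; omega) this
        rwa [show clamp N n + ((clamp N k - 1 - clamp N n).toNat : ℤ) + 1 = clamp N k by omega] at h
      · have e₁ : clamp N n = N := by unfold clamp at *; omega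
        have e₂ : clamp N k = N := by unfold clamp at *; omega
        rw [e₂]
        exact h₄ (e₁ ▸ hb)
  · intro h
    have hle := clamp_le N n
    refine hdown (N - clamp N n).toNat _ (by omega) (neg_le_clamp N n) ?_ ?_
    · have := h (max (N : ℤ) (n + 1)) (by omega)
      rwa [show clamp N (max (N : ℤ) (n + 1)) = N by unfold clamp; omega] at this
    · intro k hk hkN
      have := h k (by unfold clamp at hk; omega)
      rwa [clamp_of_mem (by unfold clamp at hk; omega) hkN] at this

/-- Time reversal of `future_iff_clamp`. -/
theorem past_iff_clamp {N : ℕ} {t b : ℤ → Prop}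
    (h₁ : ∀ m, -(N : ℤ) ≤ m → m < N → b (m + 1) → b m)
    (h₂ : ∀ m, -(N : ℤ) ≤ m → m < N → b (m + 1) → t m)
    (h₃ : ∀ m, -(N : ℤ) ≤ m → m < N → b m → t m → b (m + 1))
    (h₄ : b (-N) → t (-N)) (h₅ : t (-N) → b (-N)) (h₆ : b N → t N) (n : ℤ) :
    b (clamp N n) ↔ ∀ k, k < n → t (clamp N k) := by
  have key := future_iff_clamp (N := N) (t := fun m => t (-m)) (b := fun m => b (-m))
    (fun m h h' hb => h₁ _ (by omega) (by omega) (by simpa using hb))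
    (fun m h h' hb => h₂ _ (by omega) (by omega) (by simpa using hb))
    (fun m h h' hb ht => by
      have := h₃ (-(m + 1)) (by omega) (by omega) hb ht
      simpa using this)
    h₄ h₅ (by simpa using h₆) (-n)
  simp only [clamp_neg, neg_neg] at key
  rw [key]
  constructor
  · intro h k hk
    have := h (-k) (by omega)
    simpa [clamp_neg] using this
  · intro h k hk
    rw [← clamp_neg]
    exact h (-k) (by omega)

/-- The steps make `b` constant on the window, so introducing it at a single moment is enough. -/
theorem always_iff_clamp {N : ℕ} {t b : ℤ → Prop}
    (h₁ : ∀ m, -(N : ℤ) ≤ m → m < N → b m → b (m + 1))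
    (h₂ : ∀ m, -(N : ℤ) ≤ m → m < N → b (m + 1) → b m)
    (h₃ : ∀ m, -(N : ℤ) ≤ m → m ≤ N → b m → t m)
    (m₀ : ℤ) (hm₀ : -(N : ℤ) ≤ m₀) (hm₀' : m₀ ≤ N)
    (h₄ : (∀ m, -(N : ℤ) ≤ m → m ≤ N → t m) → b m₀) (n : ℤ) :
    b (clamp N n) ↔ ∀ k, t (clamp N k) := by
  have hshift : ∀ (j : ℕ) (m : ℤ), -(N : ℤ) ≤ m → m + j ≤ N → (b m ↔ b (m + j)) := by
    intro j
    induction j with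
    | zero => intro m _ _; simp
    | succ j ih =>
      intro m hm hj
      push_cast at hj ⊢
      rw [ih m hm (by omega), ← add_assoc]
      exact ⟨h₁ _ (by omega) (by omega), h₂ _ (by omega) (by omega)⟩
  have hall : ∀ m m', -(N : ℤ) ≤ m → m ≤ N → -(N : ℤ) ≤ m' → m' ≤ N → (b m → b m') := by
    intro m m' h h' h'' h''' hb
    have e₁ := hshift (m + N).toNat (-N) le_rfl (by omega)
    have e₂ := hshift (m' + N).toNat (-N) le_rfl (by omega)
    rw [show -(N : ℤ) + ((m + N).toNat : ℤ) = m by omega] at e₁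
    rw [show -(N : ℤ) + ((m' + N).toNat : ℤ) = m' by omega] at e₂
    exact e₂.1 (e₁.2 hb)
  constructor
  · intro h k
    exact h₃ _ (neg_le_clamp N k) (clamp_le N k) (hall _ _ (neg_le_clamp N n) (clamp_le N n)
      (neg_le_clamp N k) (clamp_le N k) h)
  · intro h
    refine hall m₀ _ hm₀ hm₀' (neg_le_clamp N n) (clamp_le N n) (h₄ fun m hm hm' => ?_)
    have := h m
    rwa [clamp_of_mem hm hm'] at this

/-! ### From assignments to models -/

theorem steps_eq (N : ℕ) : steps N = (List.range (2 * N)).map fun i : ℕ => (i : ℤ) - N := by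
  simp [steps, List.map_eq_flatMap, List.flatMap_assoc]

theorem window_eq (N : ℕ) :
    window N = (List.range (2 * N + 1)).map fun i : ℕ => (i : ℤ) - N := by
  simp [window, List.map_eq_flatMap, List.flatMap_assoc]

theorem mem_steps {N : ℕ} {m : ℤ} : m ∈ steps N ↔ -(N : ℤ) ≤ m ∧ m < N := by
  simp only [steps_eq, List.mem_map, List.mem_range]
  constructor
  · rintro ⟨i, hi, rfl⟩; omega
  · rintro ⟨h, h'⟩; exact ⟨(m + N).toNat, by omega, by omega⟩

theorem mem_window {N : ℕ} {m : ℤ} : m ∈ window N ↔ -(N : ℤ) ≤ m ∧ m ≤ N := by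
  simp only [window_eq, List.mem_map, List.mem_range]
  constructor
  · rintro ⟨i, hi, rfl⟩; omega
  · rintro ⟨h, h'⟩; exact ⟨(m + N).toNat, by omega, by omega⟩

theorem HornSAT.satisfiedBy_append {V : Type} {v : V → Prop} {H H' : HornSAT V} :
    HornSAT.SatisfiedBy v (H ++ H' : List (PropClause V)) ↔
      H.SatisfiedBy v ∧ H'.SatisfiedBy v := by
  simp only [HornSAT.SatisfiedBy, List.forall_mem_append]

theorem PropClause.satisfiedBy_some {V : Type} {v : V → Prop} {B : List V} {y : V} :
    (⟨B, some y⟩ : PropClause V).SatisfiedBy v ↔ ((∀ x ∈ B, v x) → v y) := by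
  simp [PropClause.SatisfiedBy]

theorem satisfiedBy_future {N : ℕ} {l : Lit} {v : PVar → Prop} :
    HornSAT.SatisfiedBy v (boxClauses N l .future) ↔
      (∀ m, -(N : ℤ) ≤ m → m < N →
        (v (.box .future l, m) → v (.box .future l, m + 1)) ∧
        (v (.box .future l, m) → v (l, m + 1)) ∧
        (v (.box .future l, m + 1) → v (l, m + 1) → v (.box .future l, m))) ∧
      (v (.box .future l, N) → v (l, N)) ∧ (v (l, N) → v (.box .future l, N)) ∧
      (v (.box .future l, -N) → v (l, -N)) := by
  simp only [HornSAT.SatisfiedBy, boxClauses, List.forall_mem_append, List.forall_mem_flatMap,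
    List.forall_mem_cons, PropClause.satisfiedBy_some, mem_steps, and_imp, List.not_mem_nil,
    false_imp_iff, implies_true, and_true]

theorem satisfiedBy_past {N : ℕ} {l : Lit} {v : PVar → Prop} :
    HornSAT.SatisfiedBy v (boxClauses N l .past) ↔
      (∀ m, -(N : ℤ) ≤ m → m < N →
        (v (.box .past l, m + 1) → v (.box .past l, m)) ∧
        (v (.box .past l, m + 1) → v (l, m)) ∧
        (v (.box .past l, m) → v (l, m) → v (.box .past l, m + 1))) ∧
      (v (.box .past l, -N) → v (l, -N)) ∧ (v (l, -N) → v (.box .past l, -N)) ∧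
      (v (.box .past l, N) → v (l, N)) := by
  simp only [HornSAT.SatisfiedBy, boxClauses, List.forall_mem_append, List.forall_mem_flatMap,
    List.forall_mem_cons, PropClause.satisfiedBy_some, mem_steps, and_imp, List.not_mem_nil,
    false_imp_iff, implies_true, and_true]

theorem satisfiedBy_always {N : ℕ} {l : Lit} {v : PVar → Prop} :
    HornSAT.SatisfiedBy v (boxClauses N l .always) ↔
      ((∀ m, -(N : ℤ) ≤ m → m < N →
        (v (.box .always l, m) → v (.box .always l, m + 1)) ∧
        (v (.box .always l, m + 1) → v (.box .always l, m))) ∧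
      (∀ m, -(N : ℤ) ≤ m → m ≤ N → v (.box .always l, m) → v (l, m))) ∧
      ((∀ m, -(N : ℤ) ≤ m → m ≤ N → v (l, m)) → v (.box .always l, 0)) := by
  simp only [HornSAT.SatisfiedBy, boxClauses, List.forall_mem_append, List.forall_mem_flatMap,
    List.forall_mem_cons, PropClause.satisfiedBy_some, mem_steps, and_imp, List.not_mem_nil,
    false_imp_iff, implies_true, and_true, List.forall_mem_map, mem_window]

/-- Induction on `l`: the clauses for a box determine its variables from those of its argument. Thus
every satisfying assignment is correct, not only the least one. -/
theorem Lit.holdsAt_modelOf {N : ℕ} {v : PVar → Prop} {l : Lit}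
    (h : HornSAT.SatisfiedBy v (l.semClauses N)) (n : ℤ) :
    l.HoldsAt (modelOf N v) n ↔ v (l, clamp N n) := by
  induction l generalizing n with
  | bot =>
    simp only [Lit.HoldsAt, false_iff]
    intro hv
    obtain ⟨y, hy, -⟩ := h ⟨[(.bot, clamp N n)], none⟩
      (List.mem_map.2 ⟨_, mem_window.2 ⟨neg_le_clamp N n, clamp_le N n⟩, rfl⟩) (by simpa using hv)
    cases hy
  | var p => rfl
  | box o l ih =>
    obtain ⟨hb, hl⟩ := HornSAT.satisfiedBy_append.1 h
    have ih := ih hl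
    cases o with
    | always =>
      obtain ⟨⟨h₁, h₂⟩, h₃⟩ := satisfiedBy_always.1 hb
      simp only [Lit.HoldsAt, ih]
      exact (always_iff_clamp (t := fun m => v (l, m)) (b := fun m => v (.box .always l, m))
        (fun m h h' => (h₁ m h h').1) (fun m h h' => (h₁ m h h').2) h₂ 0 (by omega) (by omega)
        h₃ n).symm
    | future =>
      obtain ⟨h₁, h₂, h₃, h₄⟩ := satisfiedBy_future.1 hb
      simp only [Lit.HoldsAt, ih]
      exact (future_iff_clamp (t := fun m => v (l, m)) (b := fun m => v (.box .future l, m))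
        (fun m h h' => (h₁ m h h').1) (fun m h h' => (h₁ m h h').2.1)
        (fun m h h' => (h₁ m h h').2.2) h₂ h₃ h₄ n).symm
    | past =>
      obtain ⟨h₁, h₂, h₃, h₄⟩ := satisfiedBy_past.1 hb
      simp only [Lit.HoldsAt, ih]
      exact (past_iff_clamp (t := fun m => v (l, m)) (b := fun m => v (.box .past l, m))
        (fun m h h' => (h₁ m h h').1) (fun m h h' => (h₁ m h h').2.1)
        (fun m h h' => (h₁ m h h').2.2) h₂ h₃ h₄ n).symm

theorem Clause.holdsAt_modelOf {N : ℕ} {v : PVar → Prop} {c : Clause}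
    (h : HornSAT.SatisfiedBy v (c.semClauses N)) (n : ℤ) :
    c.HoldsAt (modelOf N v) n ↔ (c.at (clamp N n)).SatisfiedBy v := by
  obtain ⟨hb, hh⟩ := HornSAT.satisfiedBy_append.1 h
  have hb' : ∀ l ∈ c.body, HornSAT.SatisfiedBy v (l.semClauses N) := fun l hl d hd =>
    hb d (List.mem_flatMap.2 ⟨l, hl, hd⟩)
  rw [Clause.at, PropClause.satisfiedBy_some, List.forall_mem_map, Clause.HoldsAt,
    Lit.holdsAt_modelOf hh]
  refine imp_congr ?_ Iff.rfl
  exact forall₂_congr fun l hl => Lit.holdsAt_modelOf (hb' l hl) n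

theorem Formula.holdsAt_modelOf {N : ℕ} {v : PVar → Prop} {φ : Formula}
    (h : HornSAT.SatisfiedBy v (φ.flatMap (Conjunct.hornClauses N))) :
    φ.HoldsAt (modelOf N v) 0 := by
  intro d hd
  have hd' : HornSAT.SatisfiedBy v (d.hornClauses N) := fun c hc =>
    h c (List.mem_flatMap.2 ⟨d, hd, hc⟩)
  cases d with
  | init c =>
    have h₁ := List.forall_mem_cons.1 hd'
    refine (Clause.holdsAt_modelOf h₁.2 0).2 ?_
    rw [clamp_of_mem (by omega) (by omega)]
    exact h₁.1
  | glob c =>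
    obtain ⟨h₁, h₂⟩ := HornSAT.satisfiedBy_append.1 hd'
    intro k
    exact (Clause.holdsAt_modelOf h₂ k).2
      (h₁ _ (List.mem_map.2 ⟨_, mem_window.2 ⟨neg_le_clamp N k, clamp_le N k⟩, rfl⟩))

/-! ### From short models to assignments -/

/-- Outside the interval from `-K` to `K`, the truth value of `t` does not change. -/
def StableBeyond (t : ℤ → Prop) (K : ℕ) : Prop :=
  (∀ n m, (K : ℤ) ≤ n → (K : ℤ) ≤ m → t n → t m) ∧
    ∀ n m, n ≤ -(K : ℤ) → m ≤ -(K : ℤ) → t n → t m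

theorem StableBeyond.mono {t : ℤ → Prop} {K K' : ℕ} (h : StableBeyond t K) (hK : K ≤ K') :
    StableBeyond t K' :=
  ⟨fun n m hn hm => h.1 n m (by omega) (by omega),
    fun n m hn hm => h.2 n m (by omega) (by omega)⟩

/-- A box costs one moment: □_F λ at `n` depends on λ from `n + 1` on, and if `n` lies at least one
step inside the constant past of λ, then `n + 1` is still in it and stands for all the moments
there. The past is symmetric, and □λ never changes. -/
theorem Lit.stableBeyond {M : Model} {K : ℕ} (hM : M.ConstantBeyond K) (l : Lit) :
    StableBeyond (fun n => l.HoldsAt M n) (K + l.numBoxes) := by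
  induction l with
  | bot => exact ⟨fun _ _ _ _ h => h, fun _ _ _ _ h => h⟩
  | var p =>
    refine ⟨fun n m hn hm h => ?_, fun n m hn hm h => ?_⟩
    · simp only [Lit.numBoxes, Nat.add_zero, Lit.HoldsAt] at *
      rw [hM.1 n hn] at h
      rwa [hM.1 m hm]
    · simp only [Lit.numBoxes, Nat.add_zero, Lit.HoldsAt] at *
      rw [hM.2 n hn] at h
      rwa [hM.2 m hm]
  | box o l ih =>
    obtain ⟨h₁, h₂⟩ := ih
    simp only [Lit.numBoxes]
    cases o with
    | always => exact ⟨fun _ _ _ _ h => h, fun _ _ _ _ h => h⟩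
    | future =>
      refine ⟨fun n m hn hm h k hk => ?_, fun n m hn hm h k hk => ?_⟩
      · exact h₁ (n + 1) k (by omega) (by omega) (h (n + 1) (by omega))
      · by_cases hkn : n < k
        · exact h k hkn
        · exact h₂ (n + 1) k (by omega) (by omega) (h (n + 1) (by omega))
    | past =>
      refine ⟨fun n m hn hm h k hk => ?_, fun n m hn hm h k hk => ?_⟩
      · by_cases hkn : k < n
        · exact h k hkn
        · exact h₁ (n - 1) k (by omega) (by omega) (h (n - 1) (by omega))
      · exact h₂ (n - 1) k (by omega) (by omega) (h (n - 1) (by omega))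

/-- The clauses inside the window are valid over the integers. Those at its ends hold because the
argument of each box is already constant there. -/
theorem Lit.satisfiedBy_holdsAt {M : Model} {K N : ℕ} (hM : M.ConstantBeyond K) {l : Lit}
    (hl : K + l.numBoxes ≤ N) :
    HornSAT.SatisfiedBy (fun x : PVar => x.1.HoldsAt M x.2) (l.semClauses N) := by
  induction l with
  | bot =>
    intro c hc
    obtain ⟨m, -, rfl⟩ := List.mem_map.1 hc
    intro h
    exact (h (.bot, m) (by simp)).elim
  | var p => intro c hc; simp [Lit.semClauses] at hc
  | box o l ih =>
    simp only [Lit.numBoxes] at hl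
    refine HornSAT.satisfiedBy_append.2 ⟨?_, ih (by omega)⟩
    -- Stability from `N - 1` on, which the box around `l` leaves room for, is needed because the
    -- end clauses compare `-N` with `-N + 1` and `N` with `N - 1`.
    obtain ⟨s₁, s₂⟩ := (l.stableBeyond hM).mono (K' := N - 1) (by omega)
    cases o with
    | always =>
      refine satisfiedBy_always.2 ⟨⟨fun m _ _ => ⟨fun h => h, fun h => h⟩, fun m _ _ h => h m⟩,
        fun h k => ?_⟩
      by_cases h₁ : (N : ℤ) < k
      · exact s₁ N k (by omega) (by omega) (h N (by omega) le_rfl)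
      · by_cases h₂ : k < -N
        · exact s₂ (-N) k (by omega) (by omega) (h (-N) le_rfl (by omega))
        · exact h k (by omega) (by omega)
    | future =>
      refine satisfiedBy_future.2 ⟨fun m _ _ => ⟨fun h k hk => h k (by omega),
        fun h => h (m + 1) (by omega), fun h h' k hk => ?_⟩, fun h => ?_, fun h k hk => ?_,
        fun h => ?_⟩
      · rcases (show k = m + 1 ∨ m + 1 < k by omega) with rfl | hk
        · exact h'
        · exact h k hk
      · exact s₁ (N + 1) N (by omega) (by omega) (h (N + 1) (by omega))
      · exact s₁ N k (by omega) (by omega) h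
      · exact s₂ (-N + 1) (-N) (by omega) (by omega) (h (-N + 1) (by omega))
    | past =>
      refine satisfiedBy_past.2 ⟨fun m _ _ => ⟨fun h k hk => h k (by omega),
        fun h => h m (by omega), fun h h' k hk => ?_⟩, fun h => ?_, fun h k hk => ?_,
        fun h => ?_⟩
      · rcases (show k = m ∨ k < m by omega) with rfl | hk
        · exact h'
        · exact h k hk
      · exact s₂ (-N - 1) (-N) (by omega) (by omega) (h (-N - 1) (by omega))
      · exact s₂ (-N) k (by omega) (by omega) h
      · exact s₁ (N - 1) N (by omega) (by omega) (h (N - 1) (by omega))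

theorem Clause.numBoxes_le {c : Clause} {l : Lit} (h : l ∈ c.body ∨ l = c.head) :
    l.numBoxes ≤ c.numBoxes := by
  unfold Clause.numBoxes
  rcases h with h | rfl
  · have := List.single_le_sum (l := c.body.map Lit.numBoxes) (by simp) _
      (List.mem_map_of_mem h)
    omega
  · omega

theorem Formula.numBoxes_le {φ : Formula} {d : Conjunct} (h : d ∈ φ) :
    d.numBoxes ≤ φ.numBoxes :=
  List.single_le_sum (l := φ.map Conjunct.numBoxes) (by simp) _ (List.mem_map_of_mem h)

theorem Clause.satisfiedBy_holdsAt {M : Model} {K N : ℕ} (hM : M.ConstantBeyond K) {c : Clause}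
    (hc : K + c.numBoxes ≤ N) :
    HornSAT.SatisfiedBy (fun x : PVar => x.1.HoldsAt M x.2) (c.semClauses N) := by
  refine HornSAT.satisfiedBy_append.2 ⟨fun d hd => ?_, Lit.satisfiedBy_holdsAt hM ?_⟩
  · obtain ⟨l, hl, hd⟩ := List.mem_flatMap.1 hd
    refine Lit.satisfiedBy_holdsAt hM ?_ d hd
    have := Clause.numBoxes_le (.inl hl)
    omega
  · have := Clause.numBoxes_le (c := c) (.inr rfl)
    omega

theorem Clause.satisfiedBy_at {M : Model} {c : Clause} {m : ℤ} (h : c.HoldsAt M m) :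
    (c.at m).SatisfiedBy (fun x : PVar => x.1.HoldsAt M x.2) := by
  rw [Clause.at, PropClause.satisfiedBy_some, List.forall_mem_map]
  exact h

theorem Formula.satisfiedBy_holdsAt {M : Model} {K N : ℕ} (hM : M.ConstantBeyond K)
    {φ : Formula} (hφ : K + φ.numBoxes ≤ N) (h : φ.HoldsAt M 0) :
    HornSAT.SatisfiedBy (fun x : PVar => x.1.HoldsAt M x.2)
      (φ.flatMap (Conjunct.hornClauses N)) := by
  intro c hc
  obtain ⟨d, hd, hc⟩ := List.mem_flatMap.1 hc
  have hb := Formula.numBoxes_le hd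
  have hd' := h d hd
  suffices HornSAT.SatisfiedBy (fun x : PVar => x.1.HoldsAt M x.2) (d.hornClauses N) from
    this c hc
  clear hc
  cases d with
  | init c =>
    simp only [Conjunct.numBoxes] at hb
    exact List.forall_mem_cons.2 ⟨Clause.satisfiedBy_at hd',
      Clause.satisfiedBy_holdsAt (c := c) hM (by omega)⟩
  | glob c =>
    simp only [Conjunct.numBoxes] at hb
    refine HornSAT.satisfiedBy_append.2 ⟨fun e he => ?_,
      Clause.satisfiedBy_holdsAt (c := c) hM (by omega)⟩
    obtain ⟨m, -, rfl⟩ := List.mem_map.1 he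
    exact Clause.satisfiedBy_at (hd' m)

/-- The assignment is truth in `M`: the prefix `b + 1` and at most `b` nested boxes fit into `W = 2b
+ 1`. Since `M` is constant beyond `W`, clamping recovers it. -/
theorem Formula.ShortModel.exists_assignment {φ : Formula} {M : Model} (h : φ.ShortModel M) :
    ∃ v, φ.hornInstance.SatisfiedBy v ∧ modelOf φ.windowSize v = M := by
  refine ⟨_, Formula.satisfiedBy_holdsAt h.1 ?_ h.2, ?_⟩
  · simp only [Formula.prefixLength, Formula.windowSize]; omega
  · have hN : φ.prefixLength ≤ φ.windowSize := by
      simp only [Formula.prefixLength, Formula.windowSize]; omega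
    funext n p
    have key : M (clamp φ.windowSize n) = M n := by
      by_cases h₁ : (φ.windowSize : ℤ) ≤ n
      · rw [show clamp φ.windowSize n = φ.windowSize by unfold clamp; omega,
          h.1.1 _ (by omega), h.1.1 n (by omega)]
      · by_cases h₂ : n ≤ -(φ.windowSize : ℤ)
        · rw [show clamp φ.windowSize n = -(φ.windowSize : ℤ) by unfold clamp; omega,
            h.1.2 _ (by omega), h.1.2 n (by omega)]
        · rw [clamp_of_mem (by omega) (by omega)]
    exact congrFun key p

end HornPTL

namespace HornPTL

/-! ### The size of the Horn-SAT instance -/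

theorem HornSAT.size_append {V : Type} (H H' : HornSAT V) :
    HornSAT.size (H ++ H' : List (PropClause V)) = H.size + H'.size := by
  simp [HornSAT.size]

theorem HornSAT.size_flatMap_le {α V : Type} (xs : List α) (f : α → HornSAT V) (g : α → ℕ) (k : ℕ)
    (h : ∀ x ∈ xs, (f x).size ≤ g x * k) :
    HornSAT.size (xs.flatMap f) ≤ (xs.map g).sum * k := by
  induction xs with
  | nil => simp [HornSAT.size]
  | cons x xs ih =>
    rw [List.flatMap_cons, HornSAT.size_append, List.map_cons, List.sum_cons, Nat.add_mul]
    exact Nat.add_le_add (h x (by simp)) (ih fun y hy => h y (by simp [hy]))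

theorem length_steps (N : ℕ) : (steps N).length = 2 * N := by simp [steps_eq]

theorem length_window (N : ℕ) : (window N).length = 2 * N + 1 := by simp [window_eq]

/-- Each of the `2N` steps contributes 2 + 2 + 3 literals for □_F and □_P, and the end clauses
contribute 6. For □ the total is `8N + (4N + 2) + (2N + 2)`, which is less. -/
theorem size_boxClauses_le (N : ℕ) (l : Lit) (o : BoxOp) :
    (boxClauses N l o).size ≤ 14 * N + 6 := by
  have h₁ : ∀ f : ℤ → HornSAT PVar, (∀ m, (f m).size ≤ 7) →
      HornSAT.size ((steps N).flatMap f) ≤ 14 * N := by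
    intro f hf
    refine (HornSAT.size_flatMap_le (steps N) f (fun _ => 1) 7 fun m _ => by simpa using hf m).trans ?_
    simp only [List.map_const', List.sum_replicate, length_steps, smul_eq_mul]
    omega
  have h₂ : ∀ f : ℤ → HornSAT PVar, (∀ m, (f m).size ≤ 4) →
      HornSAT.size ((steps N).flatMap f) ≤ 8 * N := by
    intro f hf
    refine (HornSAT.size_flatMap_le (steps N) f (fun _ => 1) 4 fun m _ => by simpa using hf m).trans ?_
    simp only [List.map_const', List.sum_replicate, length_steps, smul_eq_mul]
    omega
  cases o with
  | future =>
    simp only [boxClauses, HornSAT.size_append]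
    exact Nat.add_le_add (h₁ _ fun m => by simp [HornSAT.size]) (by simp [HornSAT.size])
  | past =>
    simp only [boxClauses, HornSAT.size_append]
    exact Nat.add_le_add (h₁ _ fun m => by simp [HornSAT.size]) (by simp [HornSAT.size])
  | always =>
    simp only [boxClauses, HornSAT.size_append]
    have := h₂ (fun m => [⟨[(Lit.box .always l, m)], some (.box .always l, m + 1)⟩,
         ⟨[(.box .always l, m + 1)], some (.box .always l, m)⟩]) fun m => by simp [HornSAT.size]
    have e₁ : HornSAT.size ((window N).map fun m => (⟨[(.box .always l, m)], some (l, m)⟩ :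
        PropClause PVar)) = (2 * N + 1) * 2 := by
      simp [HornSAT.size, Function.comp_def, length_window]
    have e₂ : HornSAT.size [(⟨(window N).map fun m => (l, m), some (.box .always l, 0)⟩ :
        PropClause PVar)] = 2 * N + 1 + 1 := by
      simp [HornSAT.size, length_window]
    rw [e₁, e₂]
    omega

theorem Lit.size_semClauses_le (N : ℕ) (l : Lit) :
    (l.semClauses N).size ≤ l.encode.length * (14 * N + 6) := by
  induction l with
  | bot =>
    have : (Lit.bot.semClauses N).size = (2 * N + 1) * 2 := by
      simp [Lit.semClauses, HornSAT.size, Function.comp_def, length_window]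
    rw [this]
    simp only [Lit.encode, List.length_singleton]
    omega
  | var p => simp [Lit.semClauses, HornSAT.size]
  | box o l ih =>
    simp only [Lit.semClauses, HornSAT.size_append, Lit.encode, List.length_cons]
    have := size_boxClauses_le N l o
    rw [Nat.add_mul]
    omega

theorem Lit.one_le_length_encode (l : Lit) : 1 ≤ l.encode.length := by
  cases l <;> simp [Lit.encode]

theorem Clause.length_encode (c : Clause) :
    c.encode.length = (c.body.map fun l => l.encode.length).sum + (1 + c.head.encode.length) := by
  simp only [Clause.encode, List.length_append, List.length_flatMap, List.length_cons]
  omega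

theorem Clause.size_semClauses_le (N : ℕ) (c : Clause) :
    (c.semClauses N).size ≤ c.encode.length * (14 * N + 6) := by
  rw [Clause.semClauses, HornSAT.size_append, c.length_encode, Nat.add_mul]
  refine Nat.add_le_add (HornSAT.size_flatMap_le _ _ _ _ fun l _ => l.size_semClauses_le N)
    ((c.head.size_semClauses_le N).trans (Nat.mul_le_mul_right _ (by omega)))

theorem Clause.length_body_lt (c : Clause) : c.body.length + 1 ≤ c.encode.length := by
  rw [c.length_encode]
  have : c.body.length ≤ (c.body.map fun l => l.encode.length).sum := by
    have := List.length_le_sum_of_one_le (c.body.map fun l => l.encode.length)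
      (by simpa using fun l _ => l.one_le_length_encode)
    simpa using this
  omega

/-- `14N + 6` per symbol for the semantics of literals, and `2N + 1` per symbol for the copies of
the clause. -/
theorem Conjunct.size_hornClauses_le (N : ℕ) (d : Conjunct) :
    (d.hornClauses N).size ≤ d.encode.length * (16 * N + 7) := by
  have key : ∀ c : Clause, (2 * N + 1) * (c.body.length + 1) + (c.semClauses N).size ≤
      (c.encode.length + 1) * (16 * N + 7) := by
    intro c
    have h₁ := Nat.mul_le_mul_left (2 * N + 1) c.length_body_lt
    have h₂ := c.size_semClauses_le N
    nlinarith
  cases d with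
  | init c =>
    have e : (Conjunct.hornClauses N (.init c)).size =
        c.body.length + 1 + (c.semClauses N).size := by
      simp [Conjunct.hornClauses, HornSAT.size, Clause.at]
    rw [e, Conjunct.encode, List.length_cons]
    refine le_trans ?_ (key c)
    exact Nat.add_le_add_right (Nat.le_mul_of_pos_left _ (by omega)) _
  | glob c =>
    have e : (Conjunct.hornClauses N (.glob c)).size =
        (2 * N + 1) * (c.body.length + 1) + (c.semClauses N).size := by
      rw [Conjunct.hornClauses, HornSAT.size_append]
      simp [HornSAT.size, Clause.at, Function.comp_def, length_window]
    rw [e, Conjunct.encode, List.length_cons]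
    exact key c

theorem Lit.numBoxes_le_length (l : Lit) : l.numBoxes ≤ l.encode.length := by
  induction l with
  | box o l ih => simpa [Lit.numBoxes, Lit.encode] using ih
  | _ => simp [Lit.numBoxes]

theorem Clause.numBoxes_le_length (c : Clause) : c.numBoxes ≤ c.encode.length := by
  rw [c.length_encode, Clause.numBoxes]
  have := c.head.numBoxes_le_length
  have : (c.body.map Lit.numBoxes).sum ≤ (c.body.map fun l => l.encode.length).sum :=
    List.sum_le_sum fun l _ => l.numBoxes_le_length
  omega

theorem Formula.numBoxes_le_size (φ : Formula) : φ.numBoxes ≤ φ.size := by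
  rw [Formula.numBoxes, Formula.size, Formula.encode, List.length_flatMap]
  refine List.sum_le_sum fun d _ => ?_
  cases d with
  | init c => exact c.numBoxes_le_length.trans (by simp [Conjunct.encode])
  | glob c => exact c.numBoxes_le_length.trans (by simp [Conjunct.encode])

/-- For `W = 2b + 1` the factor `16W + 7` is `32b + 23`, and `b` is at most the length of the
formula. -/
theorem Formula.size_hornInstance_le (φ : Formula) :
    φ.hornInstance.size ≤ φ.size * (32 * φ.size + 23) := by
  have h₁ : φ.hornInstance.size ≤ φ.size * (16 * φ.windowSize + 7) := by
    have := HornSAT.size_flatMap_le φ (Conjunct.hornClauses φ.windowSize)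
      (fun d => d.encode.length) (16 * φ.windowSize + 7)
      (fun d _ => d.size_hornClauses_le φ.windowSize)
    rwa [← List.length_flatMap] at this
  refine h₁.trans (Nat.mul_le_mul_left _ ?_)
  have := φ.numBoxes_le_size
  simp only [Formula.windowSize]
  omega

/-! ### Satisfiable formulas have short models -/

/-- The moments represented by the position `n`, when the positions from `-c` to `a` represent the
moments given by `g` and the other positions represent all moments beyond `T`. -/
def represented (c a : ℕ) (g : ℤ → ℤ) (T : ℤ) (n : ℤ) : Set ℤ :=
  {k | ((a : ℤ) < n ∧ T ≤ k) ∨ (n < -(c : ℤ) ∧ k ≤ -T) ∨ (-(c : ℤ) ≤ n ∧ n ≤ a ∧ k = g n)}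

theorem represented_nonempty (c a : ℕ) (g : ℤ → ℤ) (T n : ℤ) :
    (represented c a g T n).Nonempty := by
  by_cases h₁ : (a : ℤ) < n
  · exact ⟨T, .inl ⟨h₁, le_rfl⟩⟩
  · by_cases h₂ : n < -(c : ℤ)
    · exact ⟨-T, .inr (.inl ⟨h₂, le_rfl⟩)⟩
    · exact ⟨g n, .inr (.inr ⟨by omega, by omega, rfl⟩)⟩

/-- `ht` says that the last failure of `t`, if there is one, is kept by `g`. The lemma is the
induction step for □_F: universal quantification over represented moments commutes with the box. -/
theorem future_represented {c a : ℕ} {g : ℤ → ℤ} {T : ℤ} {t : ℤ → Prop}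
    (hg : ∀ i j, -(c : ℤ) ≤ i → i < j → j ≤ a → g i < g j)
    (hT : ∀ i, -(c : ℤ) ≤ i → i ≤ a → -T < g i ∧ g i < T) (hT₀ : 0 < T)
    (ht : ∀ k, ¬ t k → (∀ k', k < k' → t k') → ∃ i, -(c : ℤ) ≤ i ∧ i ≤ a ∧ g i = k) (n : ℤ) :
    (∀ n', n < n' → ∀ k ∈ represented c a g T n', t k) ↔
      ∀ k ∈ represented c a g T n, ∀ k', k < k' → t k' := by
  constructor
  · intro h k hk k' hkk'
    by_contra hcon
    -- The positions beyond `a` represent the whole final segment, so failures of `t` are bounded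
    -- above and there is a last one. It is kept at some position `i`, which the assumption forces
    -- to be at most `n`; but it is not before `k'`, hence later than `k`, contradicting the order.
    have hlim : ∀ k, T ≤ k → t k := fun k hk =>
      h (max n a + 1) (by omega) k (.inl ⟨by omega, hk⟩)
    obtain ⟨s, hs, hmax⟩ := Int.exists_greatest_of_bdd (P := fun k => ¬ t k)
      ⟨T, fun z hz => le_of_not_gt fun hlt => hz (hlim z hlt.le)⟩ ⟨k', hcon⟩
    obtain ⟨i, hi₁, hi₂, rfl⟩ := ht s hs fun k'' hk'' => by
      by_contra h'
      have := hmax k'' h'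
      omega
    have hks := hmax k' hcon
    have hin : i ≤ n := by
      by_contra hlt
      exact hs (h i (by omega) _ (.inr (.inr ⟨hi₁, hi₂, rfl⟩)))
    rcases hk with ⟨h₁, h₂⟩ | ⟨h₁, h₂⟩ | ⟨h₁, h₂, rfl⟩
    · have := (hT i hi₁ hi₂).2
      omega
    · omega
    · rcases hin.lt_or_eq with hlt | rfl
      · have := hg i n hi₁ hlt h₂
        omega
      · omega
  · intro h n' hn k' hk'
    rcases hk' with ⟨h₁, h₂⟩ | ⟨h₁, h₂⟩ | ⟨h₁, h₂, rfl⟩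
    · by_cases hna : (a : ℤ) < n
      · have hlim : ∀ k, T < k → t k := h T (.inl ⟨hna, le_rfl⟩)
        rcases h₂.lt_or_eq with hlt | rfl
        · exact hlim k' hlt
        -- The moment `T` is not strictly after `T`. If `t` failed at `T`, this would be the last
        -- failure, hence kept; but all kept moments lie before `T`.
        · by_contra hcon
          obtain ⟨i, hi₁, hi₂, hi⟩ := ht T hcon hlim
          have := (hT i hi₁ hi₂).2
          omega
      · by_cases hnc : n < -(c : ℤ)
        · exact h (-T) (.inr (.inl ⟨hnc, le_rfl⟩)) k' (by omega)
        · have := (hT n (by omega) (by omega)).2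
          exact h (g n) (.inr (.inr ⟨by omega, by omega, rfl⟩)) k' (by omega)
    · exact h (k' - 1) (.inr (.inl ⟨by omega, by omega⟩)) k' (by omega)
    · by_cases hnc : n < -(c : ℤ)
      · exact h (-T) (.inr (.inl ⟨hnc, le_rfl⟩)) _ (hT n' h₁ h₂).1
      · exact h (g n) (.inr (.inr ⟨by omega, by omega, rfl⟩)) _ (hg n n' (by omega) hn h₂)

theorem mem_represented_neg {c a : ℕ} {g : ℤ → ℤ} {T n k : ℤ} :
    k ∈ represented a c (fun i => -g (-i)) T n ↔ -k ∈ represented c a g T (-n) := by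
  simp only [represented, Set.mem_ofPred_eq]
  constructor
  · rintro (⟨h₁, h₂⟩ | ⟨h₁, h₂⟩ | ⟨h₁, h₂, rfl⟩)
    · exact .inr (.inl ⟨by omega, by omega⟩)
    · exact .inl ⟨by omega, by omega⟩
    · exact .inr (.inr ⟨by omega, by omega, by simp⟩)
  · rintro (⟨h₁, h₂⟩ | ⟨h₁, h₂⟩ | ⟨h₁, h₂, h₃⟩)
    · exact .inr (.inl ⟨by omega, by omega⟩)
    · exact .inl ⟨by omega, by omega⟩
    · exact .inr (.inr ⟨by omega, by omega, by omega⟩)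

/-- Time reversal of `future_represented`, exchanging `a` and `c`. -/
theorem past_represented {c a : ℕ} {g : ℤ → ℤ} {T : ℤ} {t : ℤ → Prop}
    (hg : ∀ i j, -(c : ℤ) ≤ i → i < j → j ≤ a → g i < g j)
    (hT : ∀ i, -(c : ℤ) ≤ i → i ≤ a → -T < g i ∧ g i < T) (hT₀ : 0 < T)
    (ht : ∀ k, ¬ t k → (∀ k', k' < k → t k') → ∃ i, -(c : ℤ) ≤ i ∧ i ≤ a ∧ g i = k) (n : ℤ) :
    (∀ n', n' < n → ∀ k ∈ represented c a g T n', t k) ↔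
      ∀ k ∈ represented c a g T n, ∀ k', k' < k → t k' := by
  have key := future_represented (c := a) (a := c) (g := fun i => -g (-i)) (T := T)
    (t := fun k => t (-k))
    (fun i j h₁ h₂ h₃ => by have := hg (-j) (-i) (by omega) (by omega) (by omega); omega)
    (fun i h₁ h₂ => by have := hT (-i) (by omega) (by omega); omega) hT₀
    (fun k hk h => by
      obtain ⟨i, h₁, h₂, h₃⟩ := ht (-k) hk fun k' hk' => by
        have := h (-k') (by omega)
        simpa using this
      exact ⟨-i, by omega, by omega, by simp [h₃]⟩) (-n)
  simp only [mem_represented_neg, neg_neg] at key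
  constructor
  · intro h k hk k' hk'
    have := key.1 (fun n' hn' k hk => h (-n') (by omega) (-k) hk) (-k) (by simpa using hk) (-k')
      (by omega)
    simpa using this
  · intro h n' hn' k hk
    have := key.2 (fun k hk k' hk' => h (-k) hk (-k') (by omega)) (-n') (by omega) (-k)
      (by simpa using hk)
    simpa using this

/-- An enumeration of a finite set of positive integers in increasing order. -/
theorem exists_enumeration (P : Finset ℤ) (hP : ∀ x ∈ P, 0 < x) :
    ∃ g : ℕ → ℤ, g 0 = 0 ∧ (∀ i j, i < j → j ≤ P.card → g i < g j) ∧
      (∀ x ∈ P, ∃ i ≤ P.card, g i = x) ∧ ∀ i ≤ P.card, g i = 0 ∨ g i ∈ P := by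
  induction P using Finset.induction_on_max with
  | empty => exact ⟨fun _ => 0, rfl, fun i j h h' => by simp at h'; omega, by simp, by simp⟩
  | insert x P hx ih =>
    have hxP : x ∉ P := fun h => lt_irrefl _ (hx x h)
    obtain ⟨g, hg₀, hg, hg', hg''⟩ := ih fun y hy => hP y (by simp [hy])
    rw [Finset.card_insert_of_notMem hxP]
    refine ⟨fun i => if i = P.card + 1 then x else g i, by simpa using hg₀, ?_, ?_, ?_⟩
    · intro i j hij hj
      dsimp only
      rw [if_neg (by omega : i ≠ P.card + 1)]
      split_ifs with h
      · rcases hg'' i (by omega) with h' | h'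
        · rw [h']; exact hP x (by simp)
        · exact hx _ h'
      · exact hg i j hij (by omega)
    · intro y hy
      rcases Finset.mem_insert.1 hy with rfl | hy
      · exact ⟨P.card + 1, le_rfl, if_pos rfl⟩
      · obtain ⟨i, hi, rfl⟩ := hg' y hy
        exact ⟨i, by omega, if_neg (by omega)⟩
    · intro i hi
      dsimp only
      split_ifs with h
      · simp
      · rcases hg'' i (by omega) with h' | h'
        · exact .inl h'
        · exact .inr (by simp [h'])

/-- The positive elements are enumerated upwards and the negative ones downwards, so that the moment
0 keeps the position 0 and each side is no longer than the set. -/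
theorem exists_enumeration_int (S : Finset ℤ) :
    ∃ (c a : ℕ) (g : ℤ → ℤ), c ≤ S.card ∧ a ≤ S.card ∧ g 0 = 0 ∧
      (∀ i j, -(c : ℤ) ≤ i → i < j → j ≤ a → g i < g j) ∧
      ∀ x ∈ insert 0 S, ∃ i, -(c : ℤ) ≤ i ∧ i ≤ a ∧ g i = x := by
  obtain ⟨g₁, h₁, h₂, h₃, h₄⟩ := exists_enumeration (S.filter (0 < ·)) (by simp)
  obtain ⟨g₂, k₁, k₂, k₃, k₄⟩ := exists_enumeration ((S.filter (· < 0)).image (- ·)) (by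
    simp only [Finset.mem_image, Finset.mem_filter]
    rintro x ⟨y, hy, rfl⟩
    omega)
  set a := (S.filter (0 < ·)).card
  set c := ((S.filter (· < 0)).image (- ·)).card with hc
  have hpos : ∀ i, i ≤ a → 0 < i → 0 < g₁ i := fun i h h' => by
    have := h₂ 0 i h' h; omega
  have hneg : ∀ i, i ≤ c → 0 < i → 0 < g₂ i := fun i h h' => by
    have := k₂ 0 i h' h; omega
  refine ⟨c, a, fun i => if 0 ≤ i then g₁ i.toNat else -g₂ (-i).toNat,
    Finset.card_image_le.trans (Finset.card_filter_le _ _), Finset.card_filter_le _ _,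
    by simpa using h₁, ?_, ?_⟩
  · intro i j hi hij hj
    dsimp only
    split_ifs with hi' hj' hj'
    · exact h₂ _ _ (by omega) (by omega)
    · omega
    · have := hneg (-i).toNat (by omega) (by omega)
      rcases (show j = 0 ∨ 0 < j by omega) with rfl | hj0
      · simp only [Int.toNat_zero, h₁]; omega
      · have := hpos j.toNat (by omega) (by omega)
        omega
    · have := k₂ (-j).toNat (-i).toNat (by omega) (by omega)
      omega
  · intro x hx
    rcases lt_trichotomy x 0 with hx0 | rfl | hx0
    · have hxS : x ∈ S := by
        rcases Finset.mem_insert.1 hx with rfl | h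
        · omega
        · exact h
      obtain ⟨i, hi, hgi⟩ := k₃ (-x) (by simp [hxS, hx0])
      have : i ≠ 0 := by rintro rfl; omega
      refine ⟨-i, by omega, by omega, ?_⟩
      dsimp only
      rw [if_neg (by omega)]
      simp [hgi]
    · exact ⟨0, by omega, by omega, by simpa using h₁⟩
    · have hxS : x ∈ S := by
        rcases Finset.mem_insert.1 hx with rfl | h
        · omega
        · exact h
      obtain ⟨i, hi, hgi⟩ := h₃ x (by simp [hxS, hx0])
      exact ⟨i, by omega, by omega, by simpa using hgi⟩

/-! ### Witnesses and the construction of short models -/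

/-- The occurrences of boxes in a literal, with their arguments. -/
def Lit.boxes : Lit → List (BoxOp × Lit)
  | .bot => []
  | .var _ => []
  | .box o l => (o, l) :: l.boxes

theorem Lit.length_boxes (l : Lit) : l.boxes.length = l.numBoxes := by
  induction l with
  | box o l ih => simp [Lit.boxes, Lit.numBoxes, ih]
  | _ => rfl

def Clause.boxes (c : Clause) : List (BoxOp × Lit) := c.body.flatMap Lit.boxes ++ c.head.boxes

def Conjunct.clause : Conjunct → Clause
  | .init c => c
  | .glob c => c

def Formula.boxes (φ : Formula) : List (BoxOp × Lit) := φ.flatMap fun d => d.clause.boxes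

theorem Formula.length_boxes (φ : Formula) : φ.boxes.length = φ.numBoxes := by
  rw [Formula.boxes, List.length_flatMap, Formula.numBoxes]
  congr 2
  funext d
  cases d <;> simp [Conjunct.clause, Conjunct.numBoxes, Clause.boxes, Clause.numBoxes,
    List.length_flatMap, Lit.length_boxes]

/-- `k` witnesses that `★ l` is not always true in `M`: for `future`, it is the last moment at which
`l` is false, and for `past`, it is the first one. -/
def IsWitness (M : Model) (k : ℤ) : BoxOp × Lit → Prop
  | (.always, l) => ¬ l.HoldsAt M k
  | (.future, l) => ¬ l.HoldsAt M k ∧ ∀ k', k < k' → l.HoldsAt M k'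
  | (.past, l) => ¬ l.HoldsAt M k ∧ ∀ k', k' < k → l.HoldsAt M k'

open Classical in
/-- A witness, if there is one. -/
noncomputable def witness (M : Model) (x : BoxOp × Lit) : ℤ :=
  if h : ∃ k, IsWitness M k x then h.choose else 0

theorem isWitness_witness {M : Model} {x : BoxOp × Lit} {k : ℤ} (h : IsWitness M k x) :
    IsWitness M (witness M x) x := by
  have : ∃ k, IsWitness M k x := ⟨k, h⟩
  rw [witness, dif_pos this]
  exact this.choose_spec

theorem Formula.Satisfiable.exists_shortModel {φ : Formula} (h : φ.Satisfiable) :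
    ∃ M, φ.ShortModel M := by
  classical
  obtain ⟨M, hM⟩ := h
  set S : Finset ℤ := (φ.boxes.map (witness M)).toFinset with hS
  have hcard : S.card ≤ φ.numBoxes := by
    refine (List.toFinset_card_le _).trans ?_
    rw [List.length_map, φ.length_boxes]
  obtain ⟨c, a, g, hc, ha, hg₀, hg, hgS⟩ := exists_enumeration_int S
  -- `T` exceeds the absolute values of all kept moments.
  obtain ⟨T, hT₀, hT⟩ : ∃ T : ℤ, 0 < T ∧
      ∀ i, -(c : ℤ) ≤ i → i ≤ a → -T < g i ∧ g i < T := by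
    refine ⟨∑ i ∈ Finset.Icc (-(c : ℤ)) a, |g i| + 1,
      by have := Finset.sum_nonneg fun i (_ : i ∈ Finset.Icc (-(c : ℤ)) a) => abs_nonneg (g i)
         omega, fun i h₁ h₂ => ?_⟩
    have := Finset.single_le_sum (fun i _ => abs_nonneg (g i)) (Finset.mem_Icc.2 ⟨h₁, h₂⟩)
    have h₃ := neg_abs_le (g i)
    have h₄ := le_abs_self (g i)
    omega
  set D := represented c a g T with hD
  set M' : Model := fun n p => ∀ k ∈ D n, M k p with hM'
  have hwit : ∀ x ∈ φ.boxes, ∃ i, -(c : ℤ) ≤ i ∧ i ≤ a ∧ g i = witness M x := fun x hx =>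
    hgS _ (Finset.mem_insert_of_mem (List.mem_toFinset.2 (List.mem_map_of_mem hx)))
  have claim : ∀ l : Lit, (∀ x ∈ l.boxes, x ∈ φ.boxes) → ∀ n,
      l.HoldsAt M' n ↔ ∀ k ∈ D n, l.HoldsAt M k := by
    intro l
    induction l with
    | bot =>
      intro _ n
      obtain ⟨k, hk⟩ := represented_nonempty c a g T n
      exact ⟨False.elim, fun h => h k hk⟩
    | var p => exact fun _ n => Iff.rfl
    | box o l ih =>
      intro hl n
      have hx : (o, l) ∈ φ.boxes := hl _ (by simp [Lit.boxes])
      have ih := ih fun x hx => hl x (by simp [Lit.boxes, hx])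
      cases o with
      | always =>
        simp only [Lit.HoldsAt, ih]
        constructor
        · intro h k _ k'
          by_contra hcon
          have hw := isWitness_witness (x := (.always, l)) (k := k') hcon
          obtain ⟨i, h₁, h₂, h₃⟩ := hwit _ hx
          rw [← h₃] at hw
          exact hw (h i (g i) (.inr (.inr ⟨h₁, h₂, rfl⟩)))
        · intro h n' k' _
          obtain ⟨k, hk⟩ := represented_nonempty c a g T n
          exact h k hk k'
      | future =>
        simp only [Lit.HoldsAt, ih]
        refine future_represented (t := fun k => l.HoldsAt M k) hg hT hT₀ (fun k hk hk' => ?_) n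
        -- Last failures are unique, so the chosen witness is `k`.
        have hw : IsWitness M (witness M _) _ := isWitness_witness (x := (.future, l)) ⟨hk, hk'⟩
        obtain ⟨i, h₁, h₂, h₃⟩ := hwit _ hx
        refine ⟨i, h₁, h₂, h₃.trans ?_⟩
        by_contra hne
        rcases lt_or_gt_of_ne hne with hlt | hlt
        · exact hk (hw.2 _ hlt)
        · exact hw.1 (hk' _ hlt)
      | past =>
        simp only [Lit.HoldsAt, ih]
        refine past_represented (t := fun k => l.HoldsAt M k) hg hT hT₀ (fun k hk hk' => ?_) n
        have hw : IsWitness M (witness M _) _ := isWitness_witness (x := (.past, l)) ⟨hk, hk'⟩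
        obtain ⟨i, h₁, h₂, h₃⟩ := hwit _ hx
        refine ⟨i, h₁, h₂, h₃.trans ?_⟩
        by_contra hne
        rcases lt_or_gt_of_ne hne with hlt | hlt
        · exact hw.1 (hk' _ hlt)
        · exact hk (hw.2 _ hlt)
  -- The Horn property enters here: a body true at a position is true at every represented moment,
  -- hence so is the head, hence the head is true at the position. A disjunctive head would break
  -- this.
  have hclause : ∀ d ∈ φ, ∀ n, (∀ k ∈ D n, d.clause.HoldsAt M k) → d.clause.HoldsAt M' n := by
    intro d hd n h hb
    have hsub : ∀ x ∈ d.clause.boxes, x ∈ φ.boxes := fun x hx =>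
      List.mem_flatMap.2 ⟨d, hd, hx⟩
    refine (claim _ (fun x hx => hsub x (List.mem_append_right _ hx)) n).2 fun k hk =>
      h k hk fun l hl => ?_
    exact (claim l (fun x hx => hsub x
      (List.mem_append_left _ (List.mem_flatMap.2 ⟨l, hl, hx⟩))) n).1 (hb l hl) k hk
  refine ⟨M', ⟨fun n hn => ?_, fun n hn => ?_⟩, fun d hd => ?_⟩
  -- Since `a` and `c` are at most `b`, all positions from `b + 1` on represent the same segment;
  -- likewise on the left.
  · have : D n = D φ.prefixLength := by
      simp only [Formula.prefixLength] at hn ⊢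
      ext k
      simp only [hD, represented, Set.mem_ofPred_eq]
      push_cast at hn ⊢
      constructor
      · rintro (⟨h₁, h₂⟩ | ⟨h₁, h₂⟩ | ⟨h₁, h₂, h₃⟩)
        · exact .inl ⟨by omega, h₂⟩
        · omega
        · omega
      · rintro (⟨h₁, h₂⟩ | ⟨h₁, h₂⟩ | ⟨h₁, h₂, h₃⟩)
        · exact .inl ⟨by omega, h₂⟩
        · omega
        · omega
    simp only [hM', this]
  · have : D n = D (-(φ.prefixLength : ℤ)) := by
      simp only [Formula.prefixLength] at hn ⊢
      ext k
      simp only [hD, represented, Set.mem_ofPred_eq]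
      push_cast at hn ⊢
      constructor
      · rintro (⟨h₁, h₂⟩ | ⟨h₁, h₂⟩ | ⟨h₁, h₂, h₃⟩)
        · omega
        · exact .inr (.inl ⟨by omega, h₂⟩)
        · omega
      · rintro (⟨h₁, h₂⟩ | ⟨h₁, h₂⟩ | ⟨h₁, h₂, h₃⟩)
        · omega
        · exact .inr (.inl ⟨by omega, h₂⟩)
        · omega
    simp only [hM', this]
  · have hd' := hM d hd
    cases d with
    | init c' =>
      -- The position 0 represents the moment 0 only, so initial clauses carry over.
      refine hclause _ hd 0 fun k hk => ?_
      rcases hk with ⟨h₁, h₂⟩ | ⟨h₁, h₂⟩ | ⟨h₁, h₂, rfl⟩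
      · omega
      · omega
      · rw [hg₀]; exact hd'
    | glob c' => exact fun n => hclause _ hd n fun k _ => hd' k

end HornPTL

/-! ### A Datalog program for satisfiability -/

namespace HornPTL

open StackProg

/-- Variables of the Datalog program: positions of the word, moments of time, and other positions.
Moments are numbered from 0. -/
inductive DVar
  | pos
  | time
  | aux

/-- States of a parser. The flag `h` tells the heads of clauses from literals in their bodies, and
`ok` says that the number read so far may end here. -/
inductive PState
  | conj
  | body
  | lit (h : Bool)
  | bits (h ok : Bool)

/-- The tags of facts: `holds i m` for the literal at the position `i` and the moment `m`,
`same i j` for two positions with the same literal, `clause i m` if the clause whose remaining part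
starts at `i` is to be true at `m`, `skip i m` for the positions in the middle of a literal of such
a clause, and `allUpTo i m` if the literal at `i + 1` is true at all moments up to `m`. -/
inductive Fact
  | parse (s : PState)
  | holds
  | same
  | clause
  | skip
  | allUpTo
  | bad

/-- The symbols after which a literal continues. -/
def Symb.Inner : Symb → Prop
  | .var => True
  | .bit _ => True
  | .box _ => True
  | _ => False

/-- The symbols that end a literal. -/
def Symb.Terminal : Symb → Prop
  | .bot => True
  | .endVar => True
  | _ => False

theorem finite_of_list {α : Type} (L : List α) (h : ∀ x, x ∈ L) : Finite α :=
  Set.finite_univ_iff.1 ((List.finite_toSet L).subset fun x _ => h x)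

instance : Finite BoxOp :=
  finite_of_list [.always, .future, .past] fun x => by cases x <;> simp

instance : Finite DVar := finite_of_list [.pos, .time, .aux] fun x => by cases x <;> simp

noncomputable instance : Fintype BoxOp := Fintype.ofFinite _

instance : Finite Symb :=
  finite_of_list ([.bot, .var, .endVar, .imp, .init, .glob] ++ [.bit true, .bit false] ++
    (Finset.univ : Finset BoxOp).toList.map .box) fun x => by
      cases x with
      | bit b => cases b <;> simp
      | _ => simp

instance : Finite PState :=
  finite_of_list ([.conj, .body] ++ (Finset.univ : Finset Bool).toList.map .lit ++
    (Finset.univ : Finset (Bool × Bool)).toList.map fun x => .bits x.1 x.2) fun x => by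
      cases x <;> simp

noncomputable instance : Fintype PState := Fintype.ofFinite _

instance : Finite Fact :=
  finite_of_list ([.holds, .same, .clause, .skip, .allUpTo, .bad] ++
    (Finset.univ : Finset PState).toList.map .parse) fun x => by cases x <;> simp

/-! #### Parsing -/

/-- The state of the parser after a literal. -/
def PState.after : Bool → PState
  | false => .body
  | true => .conj

inductive ParseRule
  | nil
  | init
  | glob
  | bodyLit
  | imp
  | bot (h : Bool)
  | box (h : Bool) (o : BoxOp)
  | var (h : Bool)
  | bit (h ok b : Bool)
  | endVar (h : Bool)

instance : Finite ParseRule :=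
  finite_of_list ([.nil, .init, .glob, .bodyLit, .imp] ++
    (Finset.univ : Finset Bool).toList.map .bot ++
    (Finset.univ : Finset (Bool × BoxOp)).toList.map (fun x => .box x.1 x.2) ++
    (Finset.univ : Finset Bool).toList.map .var ++
    (Finset.univ : Finset (Bool × Bool × Bool)).toList.map (fun x => .bit x.1 x.2.1 x.2.2) ++
    (Finset.univ : Finset Bool).toList.map .endVar) fun x => by cases x <;> simp

/-- If the symbol at a position is `a` and the next suffix is accepted in the state `s`, then the
suffix at this position is accepted in the state `s'`. -/
def parseStep (a : Symb) (s s' : PState) : Rule Symb Fact DVar :=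
  ⟨[.letter .pos (some a), .fact [.var .pos, .one] (.parse s)], [.var .pos], .parse s'⟩

/-- Acceptance is derived from the end of the word towards its beginning. Numerals have their least
significant bit first, so a nonempty one must end in the bit 1; the empty one denotes 0. This is
what `ok` checks, making exactly the words that encode formulas acceptable. -/
def parseRule : ParseRule → Rule Symb Fact DVar
  | .nil => ⟨[.letter .pos none], [.var .pos], .parse .conj⟩
  | .init => parseStep .init .body .conj
  | .glob => parseStep .glob .body .conj
  | .bodyLit => ⟨[.fact [.var .pos] (.parse (.lit false))], [.var .pos], .parse .body⟩
  | .imp => parseStep .imp (.lit true) .body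
  | .bot h => parseStep .bot (.after h) (.lit h)
  | .box h o => parseStep (.box o) (.lit h) (.lit h)
  | .var h => parseStep .var (.bits h true) (.lit h)
  | .bit h ok b => parseStep (.bit b) (.bits h b) (.bits h ok)
  | .endVar h => parseStep .endVar (.after h) (.bits h true)

/-! #### Clauses and variables -/

inductive ClauseRule
  | init
  | glob
  | skipStart
  | skipStep (a : {a : Symb // a.Inner})
  | skipEnd (a : {a : Symb // a.Terminal})
  | head
  | sameEnd (a : {a : Symb // a.Terminal})
  | sameStep (a : {a : Symb // a.Inner})
  | transfer
  | bad

noncomputable instance (p : Symb → Prop) : Fintype {a : Symb // p a} := Fintype.ofFinite _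

instance : Finite ClauseRule :=
  finite_of_list ([.init, .glob, .skipStart, .head, .transfer, .bad] ++
    Finset.univ.toList.map .skipStep ++ Finset.univ.toList.map .skipEnd ++
    Finset.univ.toList.map .sameEnd ++ Finset.univ.toList.map .sameStep)
    fun x => by cases x <;> simp

/-- The facts other than `parse` and `bad` live at `position * N + second index`, and `row` advances
the position by one. A clause shrinks from the left: a body literal that holds is skipped symbol by
symbol, and at `imp` the literal that follows is made true. Equal literals at different positions
are found by comparing suffixes from their ends, and share their truth through `transfer`. -/
def clauseRule : ClauseRule → Rule Symb Fact DVar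
  -- The second premise forces `aux` to be the length `n` of the word, and `2n + 1` is the number of
  -- the moment 0.
  | .init => ⟨[.letter .pos (some .init), .letter .aux none],
      [.mul .pos, .row, .var .aux, .var .aux, .one], .clause⟩
  | .glob => ⟨[.letter .pos (some .glob)], [.mul .pos, .row, .var .time], .clause⟩
  | .skipStart => ⟨[.fact [.mul .pos, .var .time] .clause, .fact [.mul .pos, .var .time] .holds],
      [.mul .pos, .var .time], .skip⟩
  | .skipStep a => ⟨[.letter .pos (some a.1), .fact [.mul .pos, .var .time] .skip],
      [.mul .pos, .row, .var .time], .skip⟩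
  | .skipEnd a => ⟨[.letter .pos (some a.1), .fact [.mul .pos, .var .time] .skip],
      [.mul .pos, .row, .var .time], .clause⟩
  | .head => ⟨[.letter .pos (some .imp), .fact [.mul .pos, .var .time] .clause],
      [.mul .pos, .row, .var .time], .holds⟩
  | .sameEnd a => ⟨[.letter .pos (some a.1), .letter .aux (some a.1)],
      [.mul .pos, .var .aux], .same⟩
  | .sameStep a => ⟨[.letter .pos (some a.1), .letter .aux (some a.1),
      .fact [.mul .pos, .row, .var .aux, .one] .same], [.mul .pos, .var .aux], .same⟩
  | .transfer => ⟨[.fact [.mul .pos, .var .time] .holds, .fact [.mul .pos, .var .aux] .same],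
      [.mul .aux, .var .time], .holds⟩
  | .bad => ⟨[.letter .pos (some .bot), .fact [.mul .pos, .var .time] .holds], [], .bad⟩

/-! #### Boxes -/

inductive BoxRule
  | futureUp
  | futureNext
  | futureDown
  | futureLast
  | futureLastConv
  | futureFirst
  | pastDown
  | pastPrev
  | pastUp
  | pastFirst
  | pastFirstConv
  | pastLast
  | alwaysUp
  | alwaysDown
  | alwaysInst
  | allFirst
  | allStep
  | allLast

instance : Finite BoxRule :=
  finite_of_list [.futureUp, .futureNext, .futureDown, .futureLast, .futureLastConv, .futureFirst,
    .pastDown, .pastPrev, .pastUp, .pastFirst, .pastFirstConv, .pastLast, .alwaysUp, .alwaysDown,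
    .alwaysInst, .allFirst, .allStep, .allLast] fun x => by cases x <;> simp

/-- The argument of a box at `i` is the literal at `i + 1`. The long clause for □ has a premise for
each moment, which no fixed rule can have, so `allUpTo` collects the moments one by one. The box is
introduced at the last moment, from where `alwaysDown` spreads it. -/
def boxRule : BoxRule → Rule Symb Fact DVar
  | .futureUp => ⟨[.letter .pos (some (.box .future)), .last .time false,
      .fact [.mul .pos, .var .time] .holds], [.mul .pos, .var .time, .one], .holds⟩
  | .futureNext => ⟨[.letter .pos (some (.box .future)), .last .time false,
      .fact [.mul .pos, .var .time] .holds], [.mul .pos, .row, .var .time, .one], .holds⟩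
  | .futureDown => ⟨[.letter .pos (some (.box .future)), .last .time false,
      .fact [.mul .pos, .var .time, .one] .holds,
      .fact [.mul .pos, .row, .var .time, .one] .holds], [.mul .pos, .var .time], .holds⟩
  | .futureLast => ⟨[.letter .pos (some (.box .future)), .last .time true,
      .fact [.mul .pos, .var .time] .holds], [.mul .pos, .row, .var .time], .holds⟩
  | .futureLastConv => ⟨[.letter .pos (some (.box .future)), .last .time true,
      .fact [.mul .pos, .row, .var .time] .holds], [.mul .pos, .var .time], .holds⟩
  | .futureFirst => ⟨[.letter .pos (some (.box .future)), .fact [.mul .pos] .holds],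
      [.mul .pos, .row], .holds⟩
  | .pastDown => ⟨[.letter .pos (some (.box .past)), .last .time false,
      .fact [.mul .pos, .var .time, .one] .holds], [.mul .pos, .var .time], .holds⟩
  | .pastPrev => ⟨[.letter .pos (some (.box .past)), .last .time false,
      .fact [.mul .pos, .var .time, .one] .holds], [.mul .pos, .row, .var .time], .holds⟩
  | .pastUp => ⟨[.letter .pos (some (.box .past)), .last .time false,
      .fact [.mul .pos, .var .time] .holds, .fact [.mul .pos, .row, .var .time] .holds],
      [.mul .pos, .var .time, .one], .holds⟩
  | .pastFirst => ⟨[.letter .pos (some (.box .past)), .fact [.mul .pos] .holds],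
      [.mul .pos, .row], .holds⟩
  | .pastFirstConv => ⟨[.letter .pos (some (.box .past)), .fact [.mul .pos, .row] .holds],
      [.mul .pos], .holds⟩
  | .pastLast => ⟨[.letter .pos (some (.box .past)), .last .time true,
      .fact [.mul .pos, .var .time] .holds], [.mul .pos, .row, .var .time], .holds⟩
  | .alwaysUp => ⟨[.letter .pos (some (.box .always)), .last .time false,
      .fact [.mul .pos, .var .time] .holds], [.mul .pos, .var .time, .one], .holds⟩
  | .alwaysDown => ⟨[.letter .pos (some (.box .always)), .last .time false,
      .fact [.mul .pos, .var .time, .one] .holds], [.mul .pos, .var .time], .holds⟩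
  | .alwaysInst => ⟨[.letter .pos (some (.box .always)),
      .fact [.mul .pos, .var .time] .holds], [.mul .pos, .row, .var .time], .holds⟩
  | .allFirst => ⟨[.letter .pos (some (.box .always)), .fact [.mul .pos, .row] .holds],
      [.mul .pos], .allUpTo⟩
  | .allStep => ⟨[.letter .pos (some (.box .always)), .last .time false,
      .fact [.mul .pos, .var .time] .allUpTo,
      .fact [.mul .pos, .row, .var .time, .one] .holds], [.mul .pos, .var .time, .one], .allUpTo⟩
  | .allLast => ⟨[.letter .pos (some (.box .always)), .last .time true,
      .fact [.mul .pos, .var .time] .allUpTo], [.mul .pos, .var .time], .holds⟩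

/-- The Datalog program. -/
def satRule : ParseRule ⊕ ClauseRule ⊕ BoxRule → Rule Symb Fact DVar :=
  Sum.elim parseRule (Sum.elim clauseRule boxRule)

/-! #### Addresses and letters -/

section Val

variable {V : Type} (N : ℕ) (e : V → ℕ) (v u : V)

theorem val_nil : Path.val N e [] = 0 := rfl

theorem val_var : Path.val N e [.var v] = e v := by simp [Path.val, Atom.val]

theorem val_succ : Path.val N e [.var v, .one] = e v + 1 := by simp [Path.val, Atom.val]

theorem val_cell : Path.val N e [.mul v, .var u] = e v * N + e u := by
  simp [Path.val, Atom.val]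

theorem val_right : Path.val N e [.mul v, .row, .var u] = (e v + 1) * N + e u := by
  simp [Path.val, Atom.val]; ring

theorem val_up : Path.val N e [.mul v, .var u, .one] = e v * N + (e u + 1) := by
  simp [Path.val, Atom.val]

theorem val_diag : Path.val N e [.mul v, .row, .var u, .one] = (e v + 1) * N + (e u + 1) := by
  simp [Path.val, Atom.val]; ring

theorem val_zero : Path.val N e [.mul v] = e v * N + 0 := by
  simp [Path.val, Atom.val]

theorem val_right_zero : Path.val N e [.mul v, .row] = (e v + 1) * N + 0 := by
  simp [Path.val, Atom.val]; ring

theorem val_center :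
    Path.val N e [.mul v, .row, .var u, .var u, .one] = (e v + 1) * N + (2 * e u + 1) := by
  simp [Path.val, Atom.val]; ring

end Val

theorem letterAt_eq_some {Γ : Type} {w : List Γ} {i : ℕ} {a : Γ} :
    letterAt w i = some (some a) ↔ w.drop i = a :: w.drop (i + 1) := by
  unfold letterAt
  by_cases h : i < w.length
  · rw [List.getElem?_append_left (by simpa using h), List.drop_eq_getElem_cons h]
    simp only [List.getElem?_map, List.getElem?_eq_getElem h, Option.map_some, Option.some.injEq,
      List.cons.injEq, and_true]
  · rw [List.drop_of_length_le (by omega), List.getElem?_append_right (by simpa using h)]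
    simp only [List.length_map, reduceCtorEq, iff_false]
    rcases (show i - w.length = 0 ∨ ∃ k, i - w.length = k + 1 by
      cases i - w.length <;> simp) with h | ⟨k, h⟩ <;> simp [h]

theorem letterAt_eq_none {Γ : Type} {w : List Γ} {i : ℕ} :
    letterAt w i = some none ↔ i = w.length := by
  unfold letterAt
  by_cases h : i < w.length
  · rw [List.getElem?_append_left (by simpa using h)]
    simp [h]
    omega
  · rw [List.getElem?_append_right (by simpa using h)]
    rcases (show i - w.length = 0 ∨ ∃ k, i - w.length = k + 1 by
      cases i - w.length <;> simp) with h | ⟨k, h⟩ <;> simp [h] <;> omega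

theorem lt_length_of_drop {Γ : Type} {w s : List Γ} {i : ℕ} {a : Γ} (h : w.drop i = a :: s) :
    i < w.length := by
  by_contra hn
  rw [List.drop_of_length_le (by omega)] at h
  cases h

theorem drop_succ_of_drop {Γ : Type} {w s : List Γ} {i : ℕ} {a : Γ} (h : w.drop i = a :: s) :
    w.drop (i + 1) = s := by
  rw [← List.drop_drop, h]
  rfl

theorem drop_add_of_drop {Γ : Type} {w u s : List Γ} {i : ℕ} (h : w.drop i = u ++ s) :
    w.drop (i + u.length) = s := by
  rw [← List.drop_drop, h]
  simp

/-! #### Unique readability -/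

/-- Literals, and their proper suffixes. -/
inductive LitTail : List Symb → Prop
  | last {a : Symb} : a.Terminal → LitTail [a]
  | cons {a : Symb} {u : List Symb} : a.Inner → LitTail u → LitTail (a :: u)

theorem Symb.Terminal.not_inner {a : Symb} (h : a.Terminal) : ¬ a.Inner := by
  cases a <;> simp_all [Symb.Terminal, Symb.Inner]

/-- A literal ends at its first terminal symbol, since inner and terminal symbols are disjoint. -/
theorem LitTail.unique {u u' r r' : List Symb} (h : LitTail u) (h' : LitTail u')
    (he : u ++ r = u' ++ r') : u = u' ∧ r = r' := by
  induction h generalizing u' with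
  | last ha =>
    cases h' with
    | last hb => simpa using he
    | cons hb _ =>
      simp only [List.cons_append, List.nil_append, List.cons.injEq] at he
      exact absurd (he.1 ▸ hb) ha.not_inner
  | cons ha _ ih =>
    cases h' with
    | last hb =>
      simp only [List.cons_append, List.nil_append, List.cons.injEq] at he
      exact absurd (he.1 ▸ ha) hb.not_inner
    | cons hb h' =>
      simp only [List.cons_append, List.cons.injEq] at he
      obtain ⟨rfl, rfl⟩ := ih h' he.2
      exact ⟨by rw [he.1], rfl⟩

theorem Lit.litTail (l : Lit) : LitTail l.encode := by
  induction l with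
  | bot => exact .last trivial
  | var p =>
    refine .cons trivial ?_
    induction Computability.encodeNat p with
    | nil => exact .last trivial
    | cons b bs ih => exact .cons trivial ih
  | box o l ih => exact .cons trivial ih

theorem Lit.encode_injective : Function.Injective Lit.encode := by
  intro l
  induction l with
  | bot => intro l' h; cases l' <;> simp_all [Lit.encode]
  | var p =>
    intro l' h
    cases l' with
    | var q =>
      simp only [Lit.encode, List.cons.injEq, true_and, List.append_cancel_right_eq] at h
      have h' : Computability.encodeNat p = Computability.encodeNat q :=
        List.map_injective_iff.2 (fun a b hab => by cases hab; rfl) h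
      have := congrArg Computability.decodeNat h'
      simp only [Computability.decode_encodeNat] at this
      rw [this]
    | _ => simp [Lit.encode] at h
  | box o l ih =>
    intro l' h
    cases l' with
    | box o' l' =>
      simp only [Lit.encode, List.cons.injEq, Symb.box.injEq] at h
      rw [h.1, ih h.2]
    | _ => simp [Lit.encode] at h

theorem Lit.encode_append_inj {l l' : Lit} {r r' : List Symb}
    (h : l.encode ++ r = l'.encode ++ r') : l = l' ∧ r = r' := by
  obtain ⟨h₁, h₂⟩ := l.litTail.unique l'.litTail h
  exact ⟨Lit.encode_injective h₁, h₂⟩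

end HornPTL

/-! #### Closed sets of facts -/

namespace HornPTL

open StackProg

set_option linter.unusedSimpArgs false

/-- The values of the variables. -/
def env (i m j : ℕ) : DVar → ℕ
  | .pos => i
  | .time => m
  | .aux => j

theorem closed_iff {w : List Symb} {X : Set (ℕ × Fact)} {r : Rule Symb Fact DVar} :
    r.Closed w X ↔ ∀ i < range w, ∀ m < range w, ∀ j < range w, r.Fires w (env i m j) X →
      (r.target.val (range w) (env i m j), r.tag) ∈ X := by
  constructor
  · intro h i hi m hm j hj
    exact h _ fun v => by cases v <;> assumption
  · intro h e he
    have := h _ (he .pos) _ (he .time) _ (he .aux)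
    rwa [show env (e .pos) (e .time) (e .aux) = e from funext fun v => by cases v <;> rfl] at this

theorem range_pos (w : List Symb) : 0 < range w := by simp [range]

theorem lt_range {w : List Symb} {i : ℕ} (h : i ≤ w.length) : i < range w := by
  unfold range; omega

/-! #### The parser -/

/-- The words accepted by the parser after a literal. -/
def AcceptsAfter : Bool → List Symb → Prop
  | false, s => ∃ (c : Clause) (φ : Formula), s = c.encode ++ φ.encode
  | true, s => ∃ φ : Formula, s = φ.encode

/-- The words accepted by the parser. -/
def PState.Accepts : PState → List Symb → Prop
  | .conj, s => AcceptsAfter true s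
  | .body, s => AcceptsAfter false s
  | .lit false, s => ∃ (l : Lit) (r : List Symb), s = l.encode ++ r ∧ AcceptsAfter false r
  | .lit true, s => ∃ (l : Lit) (r : List Symb), s = l.encode ++ r ∧ AcceptsAfter true r
  | .bits h ok, s => ∃ (bs : List Bool) (r : List Symb),
      s = bs.map .bit ++ .endVar :: r ∧ bs.getLastD ok = true ∧ AcceptsAfter h r

theorem PState.accepts_lit {h : Bool} {s : List Symb} :
    (PState.lit h).Accepts s ↔ ∃ (l : Lit) (r : List Symb), s = l.encode ++ r ∧ AcceptsAfter h r := by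
  cases h <;> rfl

theorem PState.accepts_after {h : Bool} {s : List Symb} :
    (PState.after h).Accepts s ↔ AcceptsAfter h s := by
  cases h <;> rfl

/-- The most significant bit comes last. -/
theorem getLastD_encodePosNum (n : PosNum) (b : Bool) :
    (Computability.encodePosNum n).getLastD b = true := by
  induction n generalizing b with
  | one => rfl
  | bit0 n ih => rw [Computability.encodePosNum, List.getLastD_cons, ih]
  | bit1 n ih => rw [Computability.encodePosNum, List.getLastD_cons, ih]

theorem getLastD_encodeNat (p : ℕ) : (Computability.encodeNat p).getLastD true = true := by
  unfold Computability.encodeNat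
  cases (p : Num) with
  | zero => rfl
  | pos n => exact getLastD_encodePosNum n true

theorem exists_encodePosNum {b : Bool} {bs : List Bool} (h : bs.getLastD b = true) :
    ∃ n, Computability.encodePosNum n = b :: bs := by
  induction bs generalizing b with
  | nil => exact ⟨.one, by simpa [Computability.encodePosNum] using h.symm⟩
  | cons c bs ih =>
    rw [List.getLastD_cons] at h
    obtain ⟨n, hn⟩ := ih h
    cases b with
    | false => exact ⟨.bit0 n, by rw [Computability.encodePosNum, hn]⟩
    | true => exact ⟨.bit1 n, by rw [Computability.encodePosNum, hn]⟩

theorem exists_encodeNat {bs : List Bool} (h : bs.getLastD true = true) :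
    ∃ p, Computability.encodeNat p = bs := by
  cases bs with
  | nil => exact ⟨0, rfl⟩
  | cons b bs =>
    rw [List.getLastD_cons] at h
    obtain ⟨n, hn⟩ := exists_encodePosNum h
    refine ⟨Num.pos n, ?_⟩
    rw [Computability.encodeNat, Num.of_to_nat]
    exact hn

theorem Formula.encode_cons (d : Conjunct) (φ : Formula) :
    Formula.encode (d :: φ) = d.encode ++ φ.encode := List.flatMap_cons

theorem Clause.encode_nil (l : Lit) : (Clause.mk [] l).encode = .imp :: l.encode := rfl

theorem Clause.encode_cons (l : Lit) (b : List Lit) (h : Lit) :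
    (Clause.mk (l :: b) h).encode = l.encode ++ (Clause.mk b h).encode := by
  simp [Clause.encode]

/-- The steps of the parser are sound. -/
theorem PState.accepts_step (w : List Symb) (n : ParseRule) :
    (parseRule n).Closed w {x | ∀ s, x.2 = .parse s → s.Accepts (w.drop x.1)} := by
  rw [closed_iff]
  intro i _ m _ j _ hf
  cases n <;>
    simp only [Rule.Fires, parseRule, parseStep, List.forall_mem_cons, Premise.Holds, val_var,
      val_succ, List.not_mem_nil, false_imp_iff, implies_true, and_true, env, letterAt_eq_some,
      letterAt_eq_none, Set.mem_ofPred_eq, Fact.parse.injEq, forall_eq', forall_eq] at hf ⊢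
  case nil => exact ⟨[], by rw [hf]; simp [Formula.encode]⟩
  case init =>
    obtain ⟨h₁, c, φ, h₂⟩ := hf
    exact ⟨.init c :: φ, by rw [h₁, h₂, Formula.encode_cons]; rfl⟩
  case glob =>
    obtain ⟨h₁, c, φ, h₂⟩ := hf
    exact ⟨.glob c :: φ, by rw [h₁, h₂, Formula.encode_cons]; rfl⟩
  case bodyLit =>
    obtain ⟨l, _, h₁, c, φ, rfl⟩ := hf
    exact ⟨⟨l :: c.body, c.head⟩, φ, by rw [h₁, Clause.encode_cons, List.append_assoc]⟩
  case imp =>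
    obtain ⟨h₁, l, _, h₂, φ, rfl⟩ := hf
    exact ⟨⟨[], l⟩, φ, by rw [h₁, h₂, Clause.encode_nil, List.cons_append]⟩
  case bot h =>
    rw [PState.accepts_after] at hf
    exact PState.accepts_lit.2 ⟨.bot, _, hf.1, hf.2⟩
  case box h o =>
    rw [PState.accepts_lit] at hf ⊢
    obtain ⟨h₁, l, r, h₂, h₃⟩ := hf
    exact ⟨.box o l, r, by rw [h₁, h₂]; rfl, h₃⟩
  case var h =>
    rw [PState.accepts_lit]
    obtain ⟨h₁, bs, r, h₂, h₃, h₄⟩ := hf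
    obtain ⟨p, rfl⟩ := exists_encodeNat h₃
    exact ⟨.var p, r, by rw [h₁, h₂]; simp [Lit.encode], h₄⟩
  case bit h ok b =>
    obtain ⟨h₁, bs, r, h₂, h₃, h₄⟩ := hf
    exact ⟨b :: bs, r, by rw [h₁, h₂]; rfl, by rw [List.getLastD_cons, h₃], h₄⟩
  case endVar h =>
    rw [PState.accepts_after] at hf
    exact ⟨[], _, hf.1, rfl, hf.2⟩

/-- The set of facts whose parse facts are sound is closed under all rules, since only the parser
rules conclude parse facts. -/
theorem exists_encode_eq {w : List Symb} (h : (0, .parse .conj) ∈ derivable satRule w) :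
    ∃ φ : Formula, φ.encode = w := by
  suffices hs : derivable satRule w ⊆ {x | ∀ s, x.2 = .parse s → s.Accepts (w.drop x.1)} by
    obtain ⟨φ, hφ⟩ := hs h .conj rfl
    exact ⟨φ, by simpa using hφ.symm⟩
  refine derivable_subset ?_
  rintro (n | n | n)
  · exact PState.accepts_step w n
  · rw [closed_iff]
    intro i _ m _ j _ hf s hs
    cases n <;> cases hs
  · rw [closed_iff]
    intro i _ m _ j _ hf s hs
    cases n <;> cases hs

/-! ### Completeness of the parser -/

section Closed

variable {w : List Symb} {X : Set (ℕ × Fact)}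

/-- All suffixes of `w` equal to `s` are accepted by the parser in the state `q`. -/
def Parses (w : List Symb) (X : Set (ℕ × Fact)) (q : PState) (s : List Symb) : Prop :=
  ∀ i ≤ w.length, w.drop i = s → (i, .parse q) ∈ X

theorem Parses.step {a : Symb} {q q' : PState} {s : List Symb}
    (hr : (parseStep a q q').Closed w X) (h : Parses w X q s) : Parses w X q' (a :: s) := by
  intro i hi hs
  have h' := drop_succ_of_drop hs
  simp only [closed_iff, Rule.Fires, parseStep, List.forall_mem_cons, Premise.Holds, val_var,
    val_succ, List.not_mem_nil, false_imp_iff, implies_true, and_true, env, letterAt_eq_some,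
    and_imp] at hr
  exact hr i (lt_range hi) 0 (range_pos w) 0 (range_pos w) (by rw [hs, h'])
    (h _ (lt_length_of_drop hs) h')

theorem parses_nil (hX : ∀ r, (satRule r).Closed w X) : Parses w X .conj [] := by
  intro i hi hs
  have hr := hX (.inl .nil)
  simp only [closed_iff, Rule.Fires, satRule, Sum.elim_inl, parseRule, List.forall_mem_cons,
    Premise.Holds, val_var, List.not_mem_nil, false_imp_iff, implies_true, and_true, env,
    letterAt_eq_none] at hr
  rw [List.drop_eq_nil_iff] at hs
  exact hr i (lt_range hi) 0 (range_pos w) 0 (range_pos w) (by omega)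

theorem parses_bits (hX : ∀ r, (satRule r).Closed w X) {h ok : Bool} {bs : List Bool}
    {s : List Symb} (hb : bs.getLastD ok = true) (hs : Parses w X (.after h) s) :
    Parses w X (.bits h ok) (bs.map .bit ++ .endVar :: s) := by
  induction bs generalizing ok with
  | nil =>
    obtain rfl : ok = true := hb
    exact hs.step (hX (.inl (.endVar h)))
  | cons b bs ih =>
    rw [List.getLastD_cons] at hb
    exact (ih hb).step (hX (.inl (.bit h ok b)))

theorem parses_lit (hX : ∀ r, (satRule r).Closed w X) {h : Bool} {s : List Symb} (l : Lit)
    (hs : Parses w X (.after h) s) : Parses w X (.lit h) (l.encode ++ s) := by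
  induction l with
  | bot => exact hs.step (hX (.inl (.bot h)))
  | var p =>
    have := (parses_bits hX (getLastD_encodeNat p) hs).step (hX (.inl (.var h)))
    simpa [Lit.encode] using this
  | box o l ih => exact ih.step (hX (.inl (.box h o)))

theorem parses_clause (hX : ∀ r, (satRule r).Closed w X) {s : List Symb} (c : Clause)
    (hs : Parses w X .conj s) : Parses w X .body (c.encode ++ s) := by
  obtain ⟨b, l⟩ := c
  induction b with
  | nil => exact (parses_lit hX (h := true) l hs).step (hX (.inl .imp))
  | cons l' b ih =>
    rw [Clause.encode_cons, List.append_assoc]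
    intro i hi hd
    have hr := hX (.inl .bodyLit)
    simp only [closed_iff, Rule.Fires, satRule, Sum.elim_inl, parseRule, List.forall_mem_cons,
      Premise.Holds, val_var, List.not_mem_nil, false_imp_iff, implies_true, and_true, env] at hr
    exact hr i (lt_range hi) 0 (range_pos w) 0 (range_pos w)
      (parses_lit hX (h := false) l' ih i hi hd)

theorem parses_formula (hX : ∀ r, (satRule r).Closed w X) (φ : Formula) :
    Parses w X .conj φ.encode := by
  induction φ with
  | nil => exact parses_nil hX
  | cons d φ ih =>
    rw [Formula.encode_cons]
    cases d with
    | init c => exact (parses_clause hX c ih).step (hX (.inl .init))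
    | glob c => exact (parses_clause hX c ih).step (hX (.inl .glob))

end Closed

theorem parse_mem_derivable (φ : Formula) :
    (0, .parse .conj) ∈ derivable satRule φ.encode :=
  parses_formula (closed_derivable satRule φ.encode) φ 0 (Nat.zero_le _) rfl

end HornPTL

/-! #### Moments -/

namespace HornPTL

open StackProg

set_option linter.unusedSimpArgs false

/-- The moments represented by the Datalog program are those from `-W` to `W` for this `W`. -/
def halfRange (w : List Symb) : ℕ := 2 * w.length + 1

/-- The moment with the number `k`. -/
def moment (w : List Symb) (k : ℕ) : ℤ := (k : ℤ) - halfRange w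

theorem moment_succ (w : List Symb) (k : ℕ) : moment w (k + 1) = moment w k + 1 := by
  simp only [moment]; push_cast; ring

theorem moment_zero (w : List Symb) : moment w 0 = -(halfRange w : ℤ) := by simp [moment]

theorem moment_center (w : List Symb) : moment w (2 * w.length + 1) = 0 := by
  simp [moment, halfRange]

theorem moment_last {w : List Symb} {k : ℕ} (h : k + 1 = range w) : moment w k = halfRange w := by
  simp only [range] at h
  simp only [moment, halfRange]
  omega

theorem forall_moment {w : List Symb} {P : ℤ → Prop} :
    (∀ m, -(halfRange w : ℤ) ≤ m → m ≤ halfRange w → P m) ↔ ∀ k < range w, P (moment w k) := by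
  constructor
  · intro h k hk
    refine h _ ?_ ?_ <;> simp only [moment, halfRange, range] at hk ⊢ <;> omega
  · intro h m hm hm'
    have := h (m + halfRange w).toNat (by simp only [halfRange, range] at *; omega)
    rwa [moment, show (((m + halfRange w).toNat : ℕ) : ℤ) - halfRange w = m by omega] at this

theorem forall_moment_lt {w : List Symb} {P : ℤ → Prop} :
    (∀ m, -(halfRange w : ℤ) ≤ m → m < halfRange w → P m) ↔
      ∀ k, k + 1 < range w → P (moment w k) := by
  constructor
  · intro h k hk
    refine h _ ?_ ?_ <;> simp only [moment, halfRange, range] at hk ⊢ <;> omega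
  · intro h m hm hm'
    have := h (m + halfRange w).toNat (by simp only [halfRange, range] at *; omega)
    rwa [moment, show (((m + halfRange w).toNat : ℕ) : ℤ) - halfRange w = m by omega] at this

theorem forall_moment_last {w : List Symb} {P : ℤ → Prop} :
    P (halfRange w) ↔ ∀ k, k + 1 = range w → P (moment w k) := by
  constructor
  · intro h k hk
    rwa [moment_last hk]
  · intro h
    have hk : range w - 1 + 1 = range w := by simp [range]
    rw [← moment_last hk]
    exact h _ hk

variable {w : List Symb} {l : Lit} {v : PVar → Prop}

theorem satisfiedBy_future_moment :
    HornSAT.SatisfiedBy v (boxClauses (halfRange w) l .future) ↔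
      (∀ k, k + 1 < range w →
        (v (.box .future l, moment w k) → v (.box .future l, moment w (k + 1))) ∧
        (v (.box .future l, moment w k) → v (l, moment w (k + 1))) ∧
        (v (.box .future l, moment w (k + 1)) → v (l, moment w (k + 1)) →
          v (.box .future l, moment w k))) ∧
      (∀ k, k + 1 = range w → (v (.box .future l, moment w k) ↔ v (l, moment w k))) ∧
      (v (.box .future l, moment w 0) → v (l, moment w 0)) := by
  rw [satisfiedBy_future, forall_moment_lt, moment_zero,
    ← forall_moment_last (P := fun m => v (.box .future l, m) ↔ v (l, m))]
  simp only [moment_succ]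
  tauto

theorem satisfiedBy_past_moment :
    HornSAT.SatisfiedBy v (boxClauses (halfRange w) l .past) ↔
      (∀ k, k + 1 < range w →
        (v (.box .past l, moment w (k + 1)) → v (.box .past l, moment w k)) ∧
        (v (.box .past l, moment w (k + 1)) → v (l, moment w k)) ∧
        (v (.box .past l, moment w k) → v (l, moment w k) →
          v (.box .past l, moment w (k + 1)))) ∧
      (∀ k, k + 1 = range w → v (.box .past l, moment w k) → v (l, moment w k)) ∧
      (v (.box .past l, moment w 0) ↔ v (l, moment w 0)) := by
  rw [satisfiedBy_past, forall_moment_lt, moment_zero,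
    ← forall_moment_last (P := fun m => v (.box .past l, m) → v (l, m))]
  simp only [moment_succ]
  tauto

theorem satisfiedBy_always_moment :
    HornSAT.SatisfiedBy v (boxClauses (halfRange w) l .always) ↔
      ((∀ k, k + 1 < range w →
        (v (.box .always l, moment w k) → v (.box .always l, moment w (k + 1))) ∧
        (v (.box .always l, moment w (k + 1)) → v (.box .always l, moment w k))) ∧
      (∀ k < range w, v (.box .always l, moment w k) → v (l, moment w k))) ∧
      ((∀ k < range w, v (l, moment w k)) → v (.box .always l, 0)) := by
  rw [satisfiedBy_always, forall_moment_lt, forall_moment, forall_moment]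
  simp only [moment_succ]

/-! #### From closed sets of facts to models -/

section Closed

variable {X : Set (ℕ × Fact)}

/-- The assignment given by a set of facts. -/
def assignment (w : List Symb) (X : Set (ℕ × Fact)) (x : PVar) : Prop :=
  ∃ (i : ℕ) (r : List Symb), w.drop i = x.1.encode ++ r ∧
    (i * range w + (x.2 + halfRange w).toNat, .holds) ∈ X

theorem Lit.encode_ne_nil (l : Lit) : l.encode ≠ [] := by
  cases l <;> simp [Lit.encode]

theorem lt_length_of_drop_encode {i : ℕ} {r : List Symb} (h : w.drop i = l.encode ++ r) :
    i < w.length := by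
  by_contra hn
  rw [List.drop_of_length_le (by omega)] at h
  exact l.encode_ne_nil (List.append_eq_nil_iff.1 h.symm).1

theorem same_mem (hX : ∀ r, (satRule r).Closed w X) {u r r' : List Symb} (hu : LitTail u)
    {i j : ℕ} (hi : w.drop i = u ++ r) (hj : w.drop j = u ++ r') :
    (i * range w + j, .same) ∈ X := by
  have h₁ := fun a => hX (.inr (.inl (.sameEnd a)))
  have h₂ := fun a => hX (.inr (.inl (.sameStep a)))
  simp only [closed_iff, Rule.Fires, satRule, Sum.elim_inl, Sum.elim_inr, clauseRule,
    List.forall_mem_cons, Premise.Holds, val_cell, val_diag, List.not_mem_nil, false_imp_iff,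
    implies_true, and_true, env, letterAt_eq_some, and_imp] at h₁ h₂
  induction hu generalizing i j with
  | last ha =>
    have hi' := lt_range (lt_length_of_drop hi).le
    have hj' := lt_range (lt_length_of_drop hj).le
    exact h₁ ⟨_, ha⟩ i hi' 0 (range_pos w) j hj' (by rw [hi, drop_succ_of_drop hi]; rfl)
      (by rw [hj, drop_succ_of_drop hj]; rfl)
  | cons ha hu ih =>
    have hi' := lt_range (lt_length_of_drop hi).le
    have hj' := lt_range (lt_length_of_drop hj).le
    exact h₂ ⟨_, ha⟩ i hi' 0 (range_pos w) j hj' (by rw [hi, drop_succ_of_drop hi]; rfl)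
      (by rw [hj, drop_succ_of_drop hj]; rfl) (ih (drop_succ_of_drop hi) (drop_succ_of_drop hj))

/-- The assignment asks for some occurrence of the literal; by `same` and `transfer` the choice of
the occurrence does not matter. -/
theorem assignment_iff (hX : ∀ r, (satRule r).Closed w X) {i : ℕ} {r : List Symb}
    (hi : w.drop i = l.encode ++ r) {k : ℕ} (hk : k < range w) :
    assignment w X (l, moment w k) ↔ (i * range w + k, .holds) ∈ X := by
  have hm : (moment w k + halfRange w).toNat = k := by simp [moment]
  rw [assignment, hm]
  constructor
  · rintro ⟨j, r', hj, h⟩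
    have hr := hX (.inr (.inl .transfer))
    simp only [closed_iff, Rule.Fires, satRule, Sum.elim_inl, Sum.elim_inr, clauseRule,
      List.forall_mem_cons, Premise.Holds, val_cell, List.not_mem_nil, false_imp_iff,
      implies_true, and_true, env, and_imp] at hr
    exact hr j (lt_range (lt_length_of_drop_encode hj).le) k hk i
      (lt_range (lt_length_of_drop_encode hi).le) h (same_mem hX l.litTail hj hi)
  · exact fun h => ⟨i, r, hi, h⟩

/-- Closure under the box rules yields the clauses for boxes, and the absence of `bad` those for
falsity. -/
theorem satisfiedBy_semClauses (hX : ∀ r, (satRule r).Closed w X) (hbad : (0, .bad) ∉ X)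
    {i : ℕ} {r : List Symb} (hi : w.drop i = l.encode ++ r) :
    HornSAT.SatisfiedBy (assignment w X) (l.semClauses (halfRange w)) := by
  induction l generalizing i with
  | bot =>
    intro c hc
    obtain ⟨m, hm, rfl⟩ := List.mem_map.1 hc
    intro h
    obtain ⟨j, r', hj, h⟩ := h _ (List.mem_singleton_self _)
    have hr := hX (.inr (.inl .bad))
    simp only [closed_iff, Rule.Fires, satRule, Sum.elim_inl, Sum.elim_inr, clauseRule,
      List.forall_mem_cons, Premise.Holds, val_cell, val_nil, List.not_mem_nil, false_imp_iff,
      implies_true, and_true, env, letterAt_eq_some, and_imp] at hr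
    refine absurd (hr j (lt_range (lt_length_of_drop_encode hj).le) _ ?_ 0 (range_pos w) ?_ h) hbad
    · rw [mem_window] at hm
      simp only [halfRange, range] at hm ⊢
      omega
    · rw [hj, drop_succ_of_drop hj]; rfl
  | var p => intro c hc; cases hc
  | box o l ih =>
    have hi₁ : w.drop (i + 1) = l.encode ++ r := drop_succ_of_drop hi
    have hlt := lt_range (lt_length_of_drop_encode hi).le
    have hbox := fun k hk => assignment_iff hX hi (k := k) hk
    have hlit := fun k hk => assignment_iff hX hi₁ (k := k) hk
    have hl : w.drop i = .box o :: w.drop (i + 1) := by rw [hi, hi₁]; rfl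
    have h0 := range_pos w
    refine HornSAT.satisfiedBy_append.2 ⟨?_, ih hi₁⟩
    cases o with
    | future =>
      have h₁ := hX (.inr (.inr .futureUp))
      have h₂ := hX (.inr (.inr .futureNext))
      have h₃ := hX (.inr (.inr .futureDown))
      have h₄ := hX (.inr (.inr .futureLast))
      have h₅ := hX (.inr (.inr .futureLastConv))
      have h₆ := hX (.inr (.inr .futureFirst))
      simp only [closed_iff, Rule.Fires, satRule, Sum.elim_inr, boxRule, List.forall_mem_cons,
        Premise.Holds, val_cell, val_up, val_right, val_diag, val_zero, val_right_zero,
        List.not_mem_nil, false_imp_iff, implies_true, and_true, env, letterAt_eq_some, and_imp,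
        iff_true, Bool.false_eq_true, iff_false] at h₁ h₂ h₃ h₄ h₅ h₆
      rw [satisfiedBy_future_moment]
      refine ⟨fun k hk => ?_, fun k hk => ?_, ?_⟩
      · rw [hbox k (by omega), hbox (k + 1) hk, hlit (k + 1) hk]
        exact ⟨h₁ i hlt k (by omega) 0 h0 hl (by omega), h₂ i hlt k (by omega) 0 h0 hl (by omega),
          h₃ i hlt k (by omega) 0 h0 hl (by omega)⟩
      · rw [hbox k (by omega), hlit k (by omega)]
        exact ⟨h₄ i hlt k (by omega) 0 h0 hl hk, h₅ i hlt k (by omega) 0 h0 hl hk⟩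
      · rw [hbox 0 h0, hlit 0 h0]
        exact h₆ i hlt 0 h0 0 h0 hl
    | past =>
      have h₁ := hX (.inr (.inr .pastDown))
      have h₂ := hX (.inr (.inr .pastPrev))
      have h₃ := hX (.inr (.inr .pastUp))
      have h₄ := hX (.inr (.inr .pastLast))
      have h₅ := hX (.inr (.inr .pastFirst))
      have h₆ := hX (.inr (.inr .pastFirstConv))
      simp only [closed_iff, Rule.Fires, satRule, Sum.elim_inr, boxRule, List.forall_mem_cons,
        Premise.Holds, val_cell, val_up, val_right, val_diag, val_zero, val_right_zero,
        List.not_mem_nil, false_imp_iff, implies_true, and_true, env, letterAt_eq_some, and_imp,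
        iff_true, Bool.false_eq_true, iff_false] at h₁ h₂ h₃ h₄ h₅ h₆
      rw [satisfiedBy_past_moment]
      refine ⟨fun k hk => ?_, fun k hk => ?_, ?_⟩
      · rw [hbox k (by omega), hbox (k + 1) hk, hlit k (by omega)]
        exact ⟨h₁ i hlt k (by omega) 0 h0 hl (by omega), h₂ i hlt k (by omega) 0 h0 hl (by omega),
          h₃ i hlt k (by omega) 0 h0 hl (by omega)⟩
      · rw [hbox k (by omega), hlit k (by omega)]
        exact h₄ i hlt k (by omega) 0 h0 hl hk
      · rw [hbox 0 h0, hlit 0 h0]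
        exact ⟨h₅ i hlt 0 h0 0 h0 hl, h₆ i hlt 0 h0 0 h0 hl⟩
    | always =>
      have h₁ := hX (.inr (.inr .alwaysUp))
      have h₂ := hX (.inr (.inr .alwaysDown))
      have h₃ := hX (.inr (.inr .alwaysInst))
      have h₄ := hX (.inr (.inr .allFirst))
      have h₅ := hX (.inr (.inr .allStep))
      have h₆ := hX (.inr (.inr .allLast))
      simp only [closed_iff, Rule.Fires, satRule, Sum.elim_inr, boxRule, List.forall_mem_cons,
        Premise.Holds, val_cell, val_up, val_right, val_diag, val_zero, val_right_zero,
        List.not_mem_nil, false_imp_iff, implies_true, and_true, env, letterAt_eq_some, and_imp,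
        iff_true, Bool.false_eq_true, iff_false] at h₁ h₂ h₃ h₄ h₅ h₆
      rw [satisfiedBy_always_moment]
      refine ⟨⟨fun k hk => ?_, fun k hk => ?_⟩, fun hall => ?_⟩
      · rw [hbox k (by omega), hbox (k + 1) hk]
        exact ⟨h₁ i hlt k (by omega) 0 h0 hl (by omega), h₂ i hlt k (by omega) 0 h0 hl (by omega)⟩
      · rw [hbox k hk, hlit k hk]
        exact h₃ i hlt k hk 0 h0 hl
      · have hup : ∀ k < range w, (i * range w + k, .allUpTo) ∈ X := by
          intro k hk
          induction k with
          | zero => exact h₄ i hlt 0 h0 0 h0 hl ((hlit 0 h0).1 (hall 0 h0))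
          | succ k ih =>
            exact h₅ i hlt k (by omega) 0 h0 hl (by omega) (ih (by omega))
              ((hlit (k + 1) hk).1 (hall (k + 1) hk))
        have hdown : ∀ d < range w, (i * range w + (range w - 1 - d), .holds) ∈ X := by
          intro d hd
          induction d with
          | zero => exact h₆ i hlt _ (by omega) 0 h0 hl (by omega) (hup _ (by omega))
          | succ d ih =>
            refine h₂ i hlt _ (by omega) 0 h0 hl (by omega) ?_
            rw [show range w - 1 - (d + 1) + 1 = range w - 1 - d by omega]
            exact ih (by omega)
        -- The moment 0 is the centre of the window, hence its own mirror image when counting down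
        -- from the last moment.
        have hc : range w - 1 - (2 * w.length + 1) = 2 * w.length + 1 := by
          simp only [range]; omega
        have hc' : 2 * w.length + 1 < range w := by simp only [range]; omega
        rw [← moment_center w, hbox _ hc', ← hc]
        exact hdown _ hc'

theorem clause_mem_of_skip (hX : ∀ r, (satRule r).Closed w X) {u r : List Symb} (hu : LitTail u)
    {i k : ℕ} (hk : k < range w) (hi : w.drop i = u ++ r)
    (hs : (i * range w + k, .skip) ∈ X) : ((i + u.length) * range w + k, .clause) ∈ X := by
  have h₁ := fun a => hX (.inr (.inl (.skipEnd a)))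
  have h₂ := fun a => hX (.inr (.inl (.skipStep a)))
  simp only [closed_iff, Rule.Fires, satRule, Sum.elim_inl, Sum.elim_inr, clauseRule,
    List.forall_mem_cons, Premise.Holds, val_cell, val_right, List.not_mem_nil, false_imp_iff,
    implies_true, and_true, env, letterAt_eq_some, and_imp] at h₁ h₂
  induction hu generalizing i with
  | last ha =>
    exact h₁ ⟨_, ha⟩ i (lt_range (lt_length_of_drop hi).le) k hk 0 (range_pos w)
      (by rw [hi, drop_succ_of_drop hi]; rfl) hs
  | @cons a u ha hu ih =>
    have := h₂ ⟨_, ha⟩ i (lt_range (lt_length_of_drop hi).le) k hk 0 (range_pos w)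
      (by rw [hi, drop_succ_of_drop hi]; rfl) hs
    have := ih (drop_succ_of_drop hi) this
    rwa [show i + 1 + u.length = i + (a :: u).length by rw [List.length_cons]; omega] at this

theorem satisfiedBy_clause_at (hX : ∀ r, (satRule r).Closed w X) {c : Clause} {i k : ℕ}
    {r : List Symb} (hk : k < range w) (hi : w.drop i = c.encode ++ r)
    (hc : (i * range w + k, .clause) ∈ X) :
    (c.at (moment w k)).SatisfiedBy (assignment w X) := by
  rw [Clause.at, PropClause.satisfiedBy_some]
  obtain ⟨b, l⟩ := c
  have h₁ := hX (.inr (.inl .skipStart))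
  have h₂ := hX (.inr (.inl .head))
  simp only [closed_iff, Rule.Fires, satRule, Sum.elim_inl, Sum.elim_inr, clauseRule,
    List.forall_mem_cons, Premise.Holds, val_cell, val_right, List.not_mem_nil, false_imp_iff,
    implies_true, and_true, env, letterAt_eq_some, and_imp] at h₁ h₂
  intro hb
  simp only [List.forall_mem_map] at hb
  induction b generalizing i with
  | nil =>
    have hi₁ : w.drop (i + 1) = l.encode ++ r := drop_succ_of_drop hi
    rw [assignment_iff hX hi₁ hk]
    exact h₂ i (lt_range (lt_length_of_drop hi).le) k hk 0 (range_pos w)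
      (by rw [hi, hi₁]; rfl) hc
  | cons l' b ih =>
    rw [Clause.encode_cons, List.append_assoc] at hi
    have hh := (assignment_iff hX hi hk).1 (hb l' List.mem_cons_self)
    have hs := h₁ i (lt_range (lt_length_of_drop_encode hi).le) k hk 0 (range_pos w) hc hh
    exact ih (clause_mem_of_skip hX l'.litTail hk hi hs) (drop_add_of_drop hi)
      fun l'' h => hb l'' (List.mem_cons_of_mem _ h)

theorem Clause.exists_drop_lit {c : Clause} {i : ℕ} {r : List Symb}
    (hi : w.drop i = c.encode ++ r) (hl : l ∈ c.body ∨ l = c.head) :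
    ∃ j r', w.drop j = l.encode ++ r' := by
  obtain ⟨b, h⟩ := c
  induction b generalizing i with
  | nil =>
    obtain hl | rfl := hl
    · cases hl
    · exact ⟨i + 1, r, drop_succ_of_drop hi⟩
  | cons l' b ih =>
    rw [Clause.encode_cons, List.append_assoc] at hi
    simp only [List.mem_cons, or_assoc] at hl
    obtain rfl | hl := hl
    · exact ⟨i, _, hi⟩
    · exact ih (drop_add_of_drop hi) hl

theorem satisfiedBy_clause_semClauses (hX : ∀ r, (satRule r).Closed w X) (hbad : (0, .bad) ∉ X)
    {c : Clause} {i : ℕ} {r : List Symb} (hi : w.drop i = c.encode ++ r) :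
    HornSAT.SatisfiedBy (assignment w X) (c.semClauses (halfRange w)) := by
  refine HornSAT.satisfiedBy_append.2 ⟨?_, ?_⟩
  · intro d hd
    obtain ⟨l, hl, hd⟩ := List.mem_flatMap.1 hd
    obtain ⟨j, r', hj⟩ := Clause.exists_drop_lit hi (.inl hl)
    exact satisfiedBy_semClauses hX hbad hj d hd
  · obtain ⟨j, r', hj⟩ := Clause.exists_drop_lit hi (.inr rfl)
    exact satisfiedBy_semClauses hX hbad hj

theorem Formula.exists_drop_conjunct {φ : Formula} {d : Conjunct} (hd : d ∈ φ) :
    ∃ i r, φ.encode.drop i = d.encode ++ r := by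
  obtain ⟨s, t, rfl⟩ := List.append_of_mem hd
  refine ⟨(Formula.encode s).length, Formula.encode t, ?_⟩
  simp [Formula.encode]

/-- A formula is satisfiable if falsity is not derivable. -/
theorem Formula.satisfiable_of_closed {φ : Formula} (hX : ∀ r, (satRule r).Closed φ.encode X)
    (hbad : (0, .bad) ∉ X) : φ.Satisfiable := by
  refine ⟨modelOf (halfRange φ.encode) (assignment φ.encode X), Formula.holdsAt_modelOf ?_⟩
  intro x hx
  obtain ⟨d, hd, hx⟩ := List.mem_flatMap.1 hx
  obtain ⟨i, r, hi⟩ := Formula.exists_drop_conjunct hd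
  have h₁ := hX (.inr (.inl .init))
  have h₂ := hX (.inr (.inl .glob))
  simp only [closed_iff, Rule.Fires, satRule, Sum.elim_inl, Sum.elim_inr, clauseRule,
    List.forall_mem_cons, Premise.Holds, val_center, val_right, List.not_mem_nil, false_imp_iff,
    implies_true, and_true, env, letterAt_eq_some, letterAt_eq_none, and_imp] at h₁ h₂
  cases d with
  | init c =>
    have hi₁ : φ.encode.drop (i + 1) = c.encode ++ r := drop_succ_of_drop hi
    have hm := h₁ i (lt_range (lt_length_of_drop hi).le) 0 (range_pos _) _ (lt_range le_rfl)
      (by rw [hi, hi₁]; rfl) rfl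
    have hc := satisfiedBy_clause_at hX (by simp only [range]; omega) hi₁ hm
    rw [moment_center] at hc
    obtain rfl | hx := List.mem_cons.1 hx
    · exact hc
    · exact satisfiedBy_clause_semClauses hX hbad hi₁ x hx
  | glob c =>
    have hi₁ : φ.encode.drop (i + 1) = c.encode ++ r := drop_succ_of_drop hi
    obtain hx | hx := List.mem_append.1 hx
    · obtain ⟨m, hm, rfl⟩ := List.mem_map.1 hx
      rw [mem_window] at hm
      refine (forall_moment (P := fun m => (c.at m).SatisfiedBy (assignment φ.encode X))).2
        (fun k hk => ?_) m hm.1 hm.2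
      exact satisfiedBy_clause_at hX hk hi₁ (h₂ i (lt_range (lt_length_of_drop hi).le) k hk 0
        (range_pos _) (by rw [hi, hi₁]; rfl))
    · exact satisfiedBy_clause_semClauses hX hbad hi₁ x hx

end Closed

end HornPTL

/-! #### From models to facts -/

namespace HornPTL

open StackProg

set_option linter.unusedSimpArgs false

variable {w : List Symb} {M : Model} {l : Lit}

/-- The literal at the position `i`, if any, is true at the moment `k`. -/
def LitTrue (w : List Symb) (M : Model) (i : ℕ) (k : ℕ) : Prop :=
  ∀ (l : Lit) (r : List Symb), w.drop i = l.encode ++ r → l.HoldsAt M (moment w k)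

/-- The meaning of a fact in a model. -/
def Fact.Sem (w : List Symb) (M : Model) : Fact → ℕ → ℕ → Prop
  | .parse _, _, _ => True
  | .holds, i, k => LitTrue w M i k
  | .same, i, j => ∃ u r r', LitTail u ∧ w.drop i = u ++ r ∧ w.drop j = u ++ r'
  | .clause, i, k => ∃ (c : Clause) (r : List Symb), w.drop i = c.encode ++ r ∧
      c.HoldsAt M (moment w k)
  | .skip, i, k => ∀ u r, LitTail u → w.drop i = u ++ r →
      ∃ (c : Clause) (r' : List Symb), r = c.encode ++ r' ∧ c.HoldsAt M (moment w k)
  | .allUpTo, i, k => ∀ k' ≤ k, LitTrue w M (i + 1) k'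
  | .bad, _, _ => False

/-- The facts that are true in a model. -/
def trueFacts (w : List Symb) (M : Model) : Set (ℕ × Fact) :=
  -- Addresses are decoded by division. Parse facts and `bad` are addressed differently, but their
  -- meaning ignores the decoded numbers.
  {x | x.2.Sem w M (x.1 / range w) (x.1 % range w)}

theorem mem_trueFacts {t : Fact} {i k : ℕ} (hk : k < range w) :
    (i * range w + k, t) ∈ trueFacts w M ↔ t.Sem w M i k := by
  have h₁ : (i * range w + k) / range w = i := by
    rw [Nat.add_comm, Nat.add_mul_div_right _ _ (range_pos w), Nat.div_eq_of_lt hk, Nat.zero_add]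
  have h₂ : (i * range w + k) % range w = k := by
    rw [Nat.add_comm, Nat.add_mul_mod_self_right, Nat.mod_eq_of_lt hk]
  rw [trueFacts, Set.mem_ofPred_eq, h₁, h₂]

theorem bad_notMem_trueFacts (n : ℕ) : (n, .bad) ∉ trueFacts w M := fun h => h

theorem litTrue_iff {i k : ℕ} {r : List Symb} (h : w.drop i = l.encode ++ r) :
    LitTrue w M i k ↔ l.HoldsAt M (moment w k) := by
  refine ⟨fun h' => h' l r h, fun hl l' r' h' => ?_⟩
  rw [h] at h'
  rwa [← (Lit.encode_append_inj h').1]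

theorem LitTail.ne_imp_cons {u s r : List Symb} (h : LitTail u) : .imp :: s ≠ u ++ r := by
  intro he
  cases h with
  | last ha => cases he; exact ha
  | cons ha hu => cases he; exact ha

theorem Lit.inner_or_terminal (l : Lit) : ∀ a ∈ l.encode, a.Inner ∨ a.Terminal := by
  suffices h : ∀ u, LitTail u → ∀ a ∈ u, a.Inner ∨ a.Terminal from h _ l.litTail
  intro u hu
  induction hu with
  | last ha => simpa using Or.inr ha
  | cons ha _ ih => exact List.forall_mem_cons.2 ⟨.inl ha, ih⟩

theorem Clause.notMem_encode (c : Clause) {a : Symb} (ha : a = .init ∨ a = .glob) :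
    a ∉ c.encode := by
  have hl : ∀ l : Lit, a ∉ l.encode := fun l h => by
    have := l.inner_or_terminal a h
    obtain rfl | rfl := ha <;> simp [Symb.Inner, Symb.Terminal] at this
  simp only [Clause.encode, List.mem_append, List.mem_flatMap, List.mem_cons, hl, and_false,
    exists_false, or_false, false_or]
  obtain rfl | rfl := ha <;> simp

/-- The symbols `init` and `glob` do not occur inside clauses, so each occurrence starts a conjunct.
-/
theorem Formula.exists_conjunct {φ : Formula} {i : ℕ} {a : Symb} {s : List Symb}
    (h : φ.encode.drop i = a :: s) (ha : a = .init ∨ a = .glob) :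
    ∃ d ∈ φ, ∃ r, a :: s = d.encode ++ r := by
  induction φ generalizing i with
  | nil => simp [Formula.encode] at h
  | cons d φ ih =>
    rw [Formula.encode_cons, List.drop_append] at h
    by_cases hi : i < d.encode.length
    · cases i with
      | zero => exact ⟨d, List.mem_cons_self, Formula.encode φ, by simpa using h.symm⟩
      | succ i =>
        exfalso
        have hmem : ∀ c : Clause, i < c.encode.length →
            c.encode.drop i ++ Formula.encode φ = a :: s → False := by
          intro c hc he
          rw [List.drop_eq_getElem_cons hc, List.cons_append, List.cons.injEq] at he
          exact c.notMem_encode ha (he.1 ▸ List.getElem_mem hc)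
        have h0 : i + 1 - d.encode.length = 0 := by omega
        rw [h0, List.drop_zero] at h
        cases d with
        | init c => exact hmem c (by simpa [Conjunct.encode] using hi) h
        | glob c => exact hmem c (by simpa [Conjunct.encode] using hi) h
    · rw [List.drop_of_length_le (by omega), List.nil_append] at h
      obtain ⟨d', hd', h'⟩ := ih h
      exact ⟨d', List.mem_cons_of_mem _ hd', h'⟩

theorem closed_parseRule (n : ParseRule) : (parseRule n).Closed w (trueFacts w M) := by
  rw [closed_iff]
  intro i _ m _ j _ _
  cases n <;> exact trivial

/-- By unique readability the literal at `i` is the first one of the body. As it is true, the clause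
without it is still true. -/
theorem sem_skip_of_clause {i k : ℕ} (hc : Fact.clause.Sem w M i k) (hh : LitTrue w M i k) :
    Fact.skip.Sem w M i k := by
  intro u r hu hd
  obtain ⟨⟨b, h⟩, r', hc, hm⟩ := hc
  rw [hd] at hc
  cases b with
  | nil => exact absurd hc.symm hu.ne_imp_cons
  | cons l b =>
    rw [Clause.encode_cons, List.append_assoc] at hc
    obtain ⟨rfl, rfl⟩ := hu.unique l.litTail hc
    refine ⟨⟨b, h⟩, r', rfl, fun hb => hm ?_⟩
    exact List.forall_mem_cons.2 ⟨hh l _ hd, hb⟩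

theorem litTrue_of_clause {i k : ℕ} (hd : w.drop i = .imp :: w.drop (i + 1))
    (hc : Fact.clause.Sem w M i k) : LitTrue w M (i + 1) k := by
  obtain ⟨⟨b, h⟩, r', hc, hm⟩ := hc
  rw [hd] at hc
  cases b with
  | nil =>
    rw [Clause.encode_nil, List.cons_append, List.cons.injEq] at hc
    exact (litTrue_iff hc.2).2 (hm (by simp))
  | cons l b =>
    rw [Clause.encode_cons, List.append_assoc] at hc
    exact absurd hc l.litTail.ne_imp_cons

theorem closed_clauseRule {φ : Formula} (hφ : φ.HoldsAt M 0) (n : ClauseRule) :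
    (clauseRule n).Closed φ.encode (trueFacts φ.encode M) := by
  rw [closed_iff]
  intro i hi k hk j hj hf
  cases n <;>
    simp only [Rule.Fires, clauseRule, List.forall_mem_cons, Premise.Holds, val_nil, val_cell,
      val_right, val_diag, val_center, List.not_mem_nil, false_imp_iff, implies_true, and_true, env,
      letterAt_eq_some, letterAt_eq_none, mem_trueFacts hk, mem_trueFacts hj] at hf ⊢
  case init =>
    obtain ⟨h, rfl⟩ := hf
    rw [mem_trueFacts (by simp only [range]; omega)]
    obtain ⟨d, hd, r, hr⟩ := Formula.exists_conjunct h (.inl rfl)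
    cases d with
    | init c =>
      rw [Conjunct.encode, List.cons_append, List.cons.injEq] at hr
      exact ⟨c, r, hr.2, by rw [moment_center]; exact hφ _ hd⟩
    | glob c => cases hr
  case glob =>
    obtain ⟨d, hd, r, hr⟩ := Formula.exists_conjunct hf (.inr rfl)
    cases d with
    | init c => cases hr
    | glob c =>
      rw [Conjunct.encode, List.cons_append, List.cons.injEq] at hr
      exact ⟨c, r, hr.2, hφ _ hd _⟩
  case skipStart => exact sem_skip_of_clause hf.1 hf.2
  case skipStep a =>
    intro u r hu hd
    exact hf.2 (a :: u) r (.cons a.2 hu) (by rw [hf.1, hd]; rfl)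
  case skipEnd a => exact hf.2 [a.1] _ (.last a.2) hf.1
  case head => exact litTrue_of_clause hf.1 hf.2
  case sameEnd a => exact ⟨[a.1], _, _, .last a.2, hf.1, hf.2⟩
  case sameStep a =>
    obtain ⟨h₁, h₂, h₃⟩ := hf
    rw [mem_trueFacts (lt_range (lt_length_of_drop h₂))] at h₃
    obtain ⟨u, r, r', hu, h₄, h₅⟩ := h₃
    exact ⟨a :: u, r, r', .cons a.2 hu, by rw [h₁, h₄]; rfl, by rw [h₂, h₅]; rfl⟩
  case transfer =>
    obtain ⟨h, u, r, r', hu, h₁, h₂⟩ := hf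
    intro l r'' hl
    rw [h₂] at hl
    obtain ⟨rfl, rfl⟩ := hu.unique l.litTail hl
    exact h l r h₁
  case bad => exact hf.2 .bot _ hf.1

/-- Either there are literals at the positions `i` and `i + 1`, or none. -/
theorem litTrue_box {K : ℕ} (hM : M.ConstantBeyond K) (hK : K ≤ w.length + 1) {i : ℕ} {o : BoxOp}
    (ho : w.drop i = .box o :: w.drop (i + 1)) :
    (∃ l : Lit, (∀ k, LitTrue w M i k ↔ (Lit.box o l).HoldsAt M (moment w k)) ∧
      (∀ k, LitTrue w M (i + 1) k ↔ l.HoldsAt M (moment w k)) ∧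
      HornSAT.SatisfiedBy (fun x : PVar => x.1.HoldsAt M x.2) (boxClauses (halfRange w) l o)) ∨
    ∀ k, LitTrue w M i k ∧ LitTrue w M (i + 1) k := by
  by_cases hl : ∃ (l : Lit) (r : List Symb), w.drop (i + 1) = l.encode ++ r
  · obtain ⟨l, r, hl⟩ := hl
    have hbox : w.drop i = (Lit.box o l).encode ++ r := by rw [ho, hl]; rfl
    refine .inl ⟨l, fun k => litTrue_iff hbox, fun k => litTrue_iff hl, ?_⟩
    -- The literal has at most as many boxes as symbols, so with `K` at most `n + 1` it is stable
    -- within `2n + 1`, for `n` the length of the word.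
    have hlen := congrArg List.length hbox
    have hnum := (Lit.box o l).numBoxes_le_length
    simp only [List.length_drop, List.length_append] at hlen
    exact (HornSAT.satisfiedBy_append.1 (Lit.satisfiedBy_holdsAt hM (l := .box o l)
      (by simp only [halfRange]; omega))).1
  · refine .inr fun k => ⟨fun l r h => ?_, fun l r h => absurd ⟨l, r, h⟩ hl⟩
    rw [ho] at h
    cases l with
    | bot => cases h
    | var p => cases h
    | box o' l => exact absurd ⟨l, r, (List.cons.inj h).2⟩ hl

/-- Where a literal follows the box, the rules are clauses valid in the short model; where none
does, every `LitTrue` involved is vacuous. -/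
theorem closed_boxRule {K : ℕ} (hM : M.ConstantBeyond K) (hK : K ≤ w.length + 1) (n : BoxRule) :
    (boxRule n).Closed w (trueFacts w M) := by
  have hfuture : ∀ {i}, w.drop i = .box .future :: w.drop (i + 1) →
      (∀ k, k + 1 < range w → (LitTrue w M i k → LitTrue w M i (k + 1)) ∧
        (LitTrue w M i k → LitTrue w M (i + 1) (k + 1)) ∧
        (LitTrue w M i (k + 1) → LitTrue w M (i + 1) (k + 1) → LitTrue w M i k)) ∧
      (∀ k, k + 1 = range w → (LitTrue w M i k ↔ LitTrue w M (i + 1) k)) ∧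
      (LitTrue w M i 0 → LitTrue w M (i + 1) 0) := by
    intro i ho
    obtain ⟨l, h₁, h₂, h₃⟩ | h := litTrue_box hM hK ho
    · simp only [h₁, h₂]
      exact satisfiedBy_future_moment.1 h₃
    · simp [h]
  have hpast : ∀ {i}, w.drop i = .box .past :: w.drop (i + 1) →
      (∀ k, k + 1 < range w → (LitTrue w M i (k + 1) → LitTrue w M i k) ∧
        (LitTrue w M i (k + 1) → LitTrue w M (i + 1) k) ∧
        (LitTrue w M i k → LitTrue w M (i + 1) k → LitTrue w M i (k + 1))) ∧
      (∀ k, k + 1 = range w → LitTrue w M i k → LitTrue w M (i + 1) k) ∧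
      (LitTrue w M i 0 ↔ LitTrue w M (i + 1) 0) := by
    intro i ho
    obtain ⟨l, h₁, h₂, h₃⟩ | h := litTrue_box hM hK ho
    · simp only [h₁, h₂]
      exact satisfiedBy_past_moment.1 h₃
    · simp [h]
  have halways : ∀ {i}, w.drop i = .box .always :: w.drop (i + 1) →
      (∀ k k', LitTrue w M i k → LitTrue w M i k' ∧ LitTrue w M (i + 1) k) ∧
      ∀ k, (∀ k' < range w, LitTrue w M (i + 1) k') → LitTrue w M i k := by
    intro i ho
    obtain ⟨l, h₁, h₂, h₃⟩ | h := litTrue_box hM hK ho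
    · simp only [h₁, h₂]
      exact ⟨fun k k' h => ⟨h, h _⟩, fun k h => (satisfiedBy_always_moment.1 h₃).2 h⟩
    · simp [h]
  rw [closed_iff]
  intro i _ k hk j _ hf
  have h0 := range_pos w
  cases n <;>
    simp only [Rule.Fires, boxRule, List.forall_mem_cons, Premise.Holds, val_cell, val_up,
      val_right, val_diag, val_zero, val_right_zero, List.not_mem_nil, false_imp_iff,
      implies_true, and_true, env, letterAt_eq_some, mem_trueFacts hk, mem_trueFacts h0,
      iff_true, Bool.false_eq_true, iff_false] at hf ⊢
  case futureUp =>
    have hk' : k + 1 < range w := by omega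
    rw [mem_trueFacts hk']
    exact ((hfuture hf.1).1 k hk').1 hf.2.2
  case futureNext =>
    have hk' : k + 1 < range w := by omega
    rw [mem_trueFacts hk']
    exact ((hfuture hf.1).1 k hk').2.1 hf.2.2
  case futureDown =>
    have hk' : k + 1 < range w := by omega
    rw [mem_trueFacts hk', mem_trueFacts hk'] at hf
    exact ((hfuture hf.1).1 k hk').2.2 hf.2.2.1 hf.2.2.2
  case futureLast => exact ((hfuture hf.1).2.1 k hf.2.1).1 hf.2.2
  case futureLastConv => exact ((hfuture hf.1).2.1 k hf.2.1).2 hf.2.2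
  case futureFirst => exact (hfuture hf.1).2.2 hf.2
  case pastDown =>
    have hk' : k + 1 < range w := by omega
    rw [mem_trueFacts hk'] at hf
    exact ((hpast hf.1).1 k hk').1 hf.2.2
  case pastPrev =>
    have hk' : k + 1 < range w := by omega
    rw [mem_trueFacts hk'] at hf
    exact ((hpast hf.1).1 k hk').2.1 hf.2.2
  case pastUp =>
    have hk' : k + 1 < range w := by omega
    rw [mem_trueFacts hk']
    exact ((hpast hf.1).1 k hk').2.2 hf.2.2.1 hf.2.2.2
  case pastFirst => exact (hpast hf.1).2.2.1 hf.2
  case pastFirstConv => exact (hpast hf.1).2.2.2 hf.2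
  case pastLast => exact (hpast hf.1).2.1 k hf.2.1 hf.2.2
  case alwaysUp =>
    rw [mem_trueFacts (by omega)]
    exact ((halways hf.1).1 k _ hf.2.2).1
  case alwaysDown =>
    rw [mem_trueFacts (by omega)] at hf
    exact ((halways hf.1).1 _ k hf.2.2).1
  case alwaysInst => exact ((halways hf.1).1 k 0 hf.2).2
  case allFirst =>
    intro k' hk'
    obtain rfl : k' = 0 := by omega
    exact hf.2
  case allStep =>
    rw [mem_trueFacts (by omega)] at hf ⊢
    intro k' hk'
    obtain hk' | rfl := Nat.le_succ_iff.1 hk'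
    · exact hf.2.2.1 k' hk'
    · exact hf.2.2.2
  case allLast => exact (halways hf.1).2 k fun k' hk' => hf.2.2 k' (by omega)

/-- Falsity is not derivable from a satisfiable formula. -/
theorem Formula.Satisfiable.bad_notMem {φ : Formula} (h : φ.Satisfiable) :
    (0, .bad) ∉ derivable satRule φ.encode := by
  obtain ⟨M, hM, hφ⟩ := h.exists_shortModel
  intro hbad
  refine bad_notMem_trueFacts (w := φ.encode) (M := M) 0 (derivable_subset ?_ hbad)
  rintro (n | n | n)
  · exact closed_parseRule n
  · exact closed_clauseRule hφ n
  · exact closed_boxRule hM (Nat.succ_le_succ φ.numBoxes_le_size) n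

theorem inPTime_satisfiabilityProblem : InPTime satisfiabilityProblem := by
  refine inPTime_of_datalog satRule (.parse .conj) .bad _ fun w => ?_
  constructor
  · rintro ⟨φ, rfl, hφ⟩
    exact ⟨parse_mem_derivable φ, hφ.bad_notMem⟩
  · rintro ⟨hp, hb⟩
    obtain ⟨φ, rfl⟩ := exists_encode_eq hp
    exact ⟨φ, rfl, Formula.satisfiable_of_closed (closed_derivable satRule _) hb⟩

end HornPTL

theorem mainTheorem11 :
    -- satisfiability is in PTime
    HornPTL.InPTime HornPTL.satisfiabilityProblem ∧
    -- satisfiable formulas have models with a prefix of linear length and loops of length 1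
    (∀ φ : HornPTL.Formula,
      φ.prefixLength ≤ φ.size + 1 ∧ (φ.Satisfiable → ∃ M, φ.ShortModel M)) ∧
    -- the existence of such a model is encoded by a Horn-SAT instance
    (∀ φ : HornPTL.Formula,
      ((∃ M, φ.ShortModel M) ↔ φ.hornInstance.Satisfiable) ∧
      (∀ v, φ.hornInstance.SatisfiedBy v →
        φ.HoldsAt (HornPTL.modelOf φ.windowSize v) 0) ∧
      (∀ M, φ.ShortModel M →
        ∃ v, φ.hornInstance.SatisfiedBy v ∧ HornPTL.modelOf φ.windowSize v = M)) ∧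
    -- the instance is of polynomial size
    (∃ P : Polynomial ℕ, ∀ φ : HornPTL.Formula, φ.hornInstance.size ≤ P.eval φ.size) := by
  refine ⟨HornPTL.inPTime_satisfiabilityProblem,
    fun φ => ⟨Nat.succ_le_succ φ.numBoxes_le_size, fun h => h.exists_shortModel⟩,
    fun φ => ⟨⟨?_, ?_⟩, fun v hv => HornPTL.Formula.holdsAt_modelOf hv,
      fun M hM => hM.exists_assignment⟩,
    .X * (32 * .X + 23), fun φ => ?_⟩
  · rintro ⟨M, hM⟩
    obtain ⟨v, hv, -⟩ := hM.exists_assignment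
    exact ⟨v, hv⟩
  · rintro ⟨v, hv⟩
    -- The model read off from the assignment is only known to be constant beyond `W`, not beyond `b
    -- + 1`, so it is shortened again.
    exact HornPTL.Formula.Satisfiable.exists_shortModel
      ⟨_, HornPTL.Formula.holdsAt_modelOf hv⟩
  · have := φ.size_hornInstance_le
    simpa using this
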